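/- **Conventions.** $\mathbb M=\mathbb R^4$ carries the Minkowski product $(xy)=x^0y^0-x^1y^1-x^2y^2-x^3y^3$, $H=\{e\in\mathbb M: (ee)<0\}$, and $\mathcal D(H)$ is the space of complex test functions on $H$. For $u\in\mathcal D'(\Omega)$, $\Omega\subset\mathbb M$ open, $\varphi\in C_c^\infty(\Omega)$, put $\widehat{\varphi u}(k)=u(\varphi e^{i(k\,\cdot)})$; $(x;k)\in \mathrm{WF}\,u$ iff $x\in\Omega$, $k\neq0$ and for no $\varphi\in C_c^\infty(\Omega)$ with $\varphi(x)\ne0$ is $\widehat{\varphi u}$ rapidly decreasing in an open conic neighbourhood of $k$. The Hörmander product $w=uv$ of $u,v\in\mathcal D'(\Omega)$ exists if $(x;k)\in\mathrm{WF}\,u$ implies $(x;-k)\notin\mathrm{WF}\,v$ and there is $w\in\mathcal D'(\Omega)$ such that every $x\in\Omega$ has a neighbourhood $U$ with $\widehat{\varphi^2w}(k)=(2\pi)^{-4}\int \widehat{\varphi u}(l)\,\widehat{\varphi v}(k-l)\,d^4l$ (absolutely convergent) for all $k\in\mathbb M$ and all $\varphi\in C_c^\infty(\Omega)$ supported in $U$.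 Products of several factors are iterated Hörmander products. **Propagators.** All integrals $\int \frac{d^4p}{(2\pi)^4}e^{-i(px)}K(p)$ below are understood as limits in $\mathcal S'(\mathbb M)$ (tested against each Schwartz function) after replacing each $\pm i0$ by $\pm i\varepsilon$ and letting the $\varepsilon$'s tend to $0^+$; in the string-localized case the parameters of $(pe)-i0$, of $(pe')+i0$ and of $p^2-m^2+i0$ are independent and the limit is joint. (a) For $m\ge0$, polynomials $M,N\in\mathbb C[p^0,\dots,p^3]$: the point-localized propagator $\int \frac{d^4p}{(2\pi)^4}e^{-i(px)}\Big(\frac{M(p)}{p^2-m^2+i0}+N(p)\Big)$. For $M=1$, $N=0$ it is the scalar Feynman propagator of mass $m$. (b) For $m\ge 0$, $s\in\mathbb N$, real four-vectors $f,f'$, complex numbers $\beta_n$ $(0\le 2n\le s)$ and $c\in\mathcal D(H)$: the smeared string-localized kinematic propagator $$\langle T_0A^{(s)}_{c,f}A^{(s)}_{c,f'}\rangle(x)=\int\frac{d^4p}{(2\pi)^4}e^{-i(px)}\int d^4e\int d^4e'\,c(e)c(e')\,\frac{M_{f,f'}(p,e,e')}{p^2-m^2+i0},$$ $$M_{f,f'}=(-1)^s\sum_{2n\le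 s}\beta_n\,(E_{ff})^n(E_{f'f'})^n(E_{ff'})^{s-2n},$$ where $E_{ff}=f^\mu E_{\mu\nu}(p,e,-e)f^\nu$, $E_{f'f'}=f'^\mu E_{\mu\nu}(p,-e',e')f'^\nu$, $E_{ff'}=f^\mu E_{\mu\nu}(p,e,e')f'^\nu$ and $$E_{\mu\nu}(p,e,e')=\eta_{\mu\nu}-\frac{e_\nu p_\mu}{(pe)-i0}-\frac{e'_\mu p_\nu}{(pe')+i0}+\frac{(ee')p_\mu p_\nu}{[(pe)-i0][(pe')+i0]},$$ so that each $(pe)$ comes with $-i0$ and each $(pe')$ with $+i0$. **Theorem.** (i) For all parameters with $m\ge0$, the limits defining (a) and (b) exist and are unique tempered distributions. (ii) For $m>0$, and all $s,\beta,f,f',c$, the wavefront set of $\langle T_0A^{(s)}_{c,f}A^{(s)}_{c,f'}\rangle$ is contained in that of the scalar Feynman propagator of mass $m$. (iii) For every finite nonempty list of distributions, each of which is a massive or massless smeared string-localized kinematic propagator (b) or a massive or massless point-localized propagator (a) (with possibly different parameters), the iterated Hörmander product of their restrictions to $\mathbb M\setminus\{0\}$ exists and is a unique element of $\mathcal D'(\mathbb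 M\setminus\{0\})$. In particular products of massive string-localized kinematic propagators with each other, with massless string-localized kinematic propagators and with point-localized propagators are well-defined on $\mathbb M\setminus\{0\}$. -/

import Mathlib

open MeasureTheory Filter Topology TopologicalSpace
open scoped Distributions SchwartzMap ContDiff

noncomputable section

namespace StringLocalized

/-! ### Minkowski space -/

/-- Minkowski space: real four-vectors `(x⁰, x¹, x², x³)`. The Euclidean norm and Lebesgue measure
of the underlying space are used for growth conditions and integration. -/
abbrev Mink : Type := EuclideanSpace ℝ (Fin 4)

/-- The Minkowski product `(xy) = x⁰y⁰ - x¹y¹ - x²y² - x³y³`. -/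
def mdot (x y : Mink) : ℝ := x 0 * y 0 - x 1 * y 1 - x 2 * y 2 - x 3 * y 3

theorem contDiff_mdot_right (k : Mink) : ContDiff ℝ ∞ (fun x : Mink => mdot k x) := by
  unfold mdot; fun_prop

theorem continuous_mdot_self : Continuous (fun x : Mink => mdot x x) := by
  unfold mdot; fun_prop

/-- The open set `H` of spacelike vectors. -/
def spacelike : Opens Mink :=
  ⟨{e | mdot e e < 0}, isOpen_lt continuous_mdot_self continuous_const⟩

/-- Minkowski space without the origin. -/
def punctured : Opens Mink := ⟨{0}ᶜ, isOpen_compl_singleton⟩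

/-- The plane wave `x ↦ exp(i(kx))`, with the Minkowski product in the exponent. -/
def planeWave (k x : Mink) : ℂ := Complex.exp (Complex.I * (mdot k x : ℂ))

theorem contDiff_planeWave (k : Mink) : ContDiff ℝ ∞ (planeWave k) := by
  have h : ContDiff ℝ ∞ (fun x : Mink => ((mdot k x : ℝ) : ℂ)) :=
    Complex.ofRealCLM.contDiff.comp (contDiff_mdot_right k)
  exact (contDiff_const.mul h).cexp

/-! ### Test functions and distributions -/

section Distributions

variable {Ω : Opens Mink}

/-- Product of a test function with a smooth function. -/
def mulSmooth (φ : 𝓓(Ω, ℂ)) (g : Mink → ℂ) (hg : ContDiff ℝ ∞ g) : 𝓓(Ω, ℂ) where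
  toFun := fun x => φ x * g x
  contDiff' := φ.contDiff.mul hg
  hasCompactSupport' := φ.hasCompactSupport.mul_right
  tsupport_subset' := (tsupport_mul_subset_left).trans φ.tsupport_subset

/-- The value of a complex distribution on a complex test function, by complex linearity
(Mathlib's distributions are evaluated on real test functions). -/
def evalC (u : 𝓓'(Ω, ℂ)) (φ : 𝓓(Ω, ℂ)) : ℂ :=
  u (TestFunction.postcompCLM Complex.reCLM φ) +
    Complex.I * u (TestFunction.postcompCLM Complex.imCLM φ)

/-- A test function on `Ω` is a Schwartz function. -/
def testToSchwartz (φ : 𝓓(Ω, ℂ)) : 𝓢(Mink, ℂ) :=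
  φ.hasCompactSupport.toSchwartzMap φ.contDiff

variable (Ω) in
/-- The inclusion of test functions in Schwartz functions is continuous. -/
def testToSchwartzCLM : 𝓓(Ω, ℂ) →L[ℝ] 𝓢(Mink, ℂ) :=
  TestFunction.mkCLM ℝ testToSchwartz (fun _ _ => rfl) (fun _ _ => rfl) (by
    intro K hK
    let Φ : 𝓓^{⊤}_{K}(Mink, ℂ) →ₗ[ℝ] 𝓢(Mink, ℂ) :=
      { toFun := testToSchwartz ∘ TestFunction.ofSupportedIn hK
        map_add' := fun _ _ => rfl
        map_smul' := fun _ _ => rfl }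
    change Continuous Φ
    refine WithSeminorms.continuous_of_isBounded
      (ContDiffMapSupportedIn.withSeminorms ℝ Mink ℂ ⊤ K)
      (schwartz_withSeminorms ℝ Mink ℂ) _ (.of_real fun i => ?_)
    obtain ⟨R, hR⟩ := K.isCompact.isBounded.exists_norm_le
    refine ⟨{i.2}, (max R 0) ^ i.1, fun f => ?_⟩
    refine SchwartzMap.seminorm_le_bound ℝ i.1 i.2 _ (by positivity) fun x => ?_
    have hΦ : (Φ f : Mink → ℂ) = f := rfl
    rw [hΦ]
    by_cases hx : x ∈ K
    · simp only [Finset.sup_singleton]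
      gcongr
      · exact (hR x hx).trans (le_max_left _ _)
      · exact ContDiffMapSupportedIn.norm_iteratedFDeriv_apply_le_seminorm_top ℝ
    · have h0 : iteratedFDeriv ℝ i.2 f x = 0 := f.iteratedFDeriv_zero_on_compl hx
      rw [h0, norm_zero, mul_zero]
      positivity)

variable (Ω) in
/-- Restriction of a tempered distribution on Minkowski space to the open set `Ω`. -/
def restrict (u : 𝓢'(Mink, ℂ)) : 𝓓'(Ω, ℂ) where
  toFun φ := u (testToSchwartzCLM Ω (TestFunction.postcompCLM Complex.ofRealCLM φ))
  map_add' φ ψ := by simp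
  map_smul' a φ := by
    rw [map_smul, map_smul]
    exact (u.toLinearMap.restrictScalars ℝ).map_smul a _
  cont := u.cont.comp ((testToSchwartzCLM Ω).cont.comp
    (TestFunction.postcompCLM Complex.ofRealCLM).cont)

/-! ### Wavefront sets -/

/-- The Fourier transform `k ↦ u(φ e^{i(k·)})` of the compactly supported distribution `φu`, with
the sign and the duality pairing used on Minkowski space. -/
def localFourier (u : 𝓓'(Ω, ℂ)) (φ : 𝓓(Ω, ℂ)) (k : Mink) : ℂ :=
  evalC u (mulSmooth φ (planeWave k) (contDiff_planeWave k))

/-- `g` decays faster than any power on the set `V`. -/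
def RapidlyDecreasingOn (g : Mink → ℂ) (V : Set Mink) : Prop :=
  ∀ N : ℕ, ∃ C : ℝ, ∀ k ∈ V, (1 + ‖k‖) ^ N * ‖g k‖ ≤ C

/-- The cone of nonzero directions that have no open conic neighbourhood on which `g` is rapidly
decreasing. -/
def singularDirections (g : Mink → ℂ) : Set Mink :=
  {k | k ≠ 0 ∧ ¬ ∃ V : Set Mink, IsOpen V ∧ k ∈ V ∧ (∀ t : ℝ, 0 < t → ∀ l ∈ V, t • l ∈ V) ∧
    RapidlyDecreasingOn g V}

/-- The wavefront set `WF u` of a distribution on `Ω`, as a set of pairs `(x, k)` with `x ∈ Ω` and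
`k ≠ 0`. -/
def WF (u : 𝓓'(Ω, ℂ)) : Set (Mink × Mink) :=
  {q | q.1 ∈ Ω ∧ q.2 ≠ 0 ∧
    ∀ φ : 𝓓(Ω, ℂ), φ q.1 ≠ 0 → q.2 ∈ singularDirections (localFourier u φ)}

/-! ### Hörmander products -/

/-- `w` is the Hörmander product of `u` and `v`: no `(x, k) ∈ WF u` has `(x, -k) ∈ WF v`, and
near each point `w` is the product of `u` and `v` in the sense that, for each test function `φ`
supported near that point, the Fourier transform of `φ²w` is the (absolutely convergent)
convolution of those of `φu` and `φv`. -/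
structure IsHormanderProduct (u v w : 𝓓'(Ω, ℂ)) : Prop where
  criterion : ∀ x k : Mink, (x, k) ∈ WF u → (x, -k) ∉ WF v
  local_product : ∀ x ∈ Ω, ∃ U : Set Mink, IsOpen U ∧ x ∈ U ∧
    ∀ φ : 𝓓(Ω, ℂ), tsupport φ ⊆ U → ∀ k : Mink,
      Integrable (fun l : Mink => localFourier u φ l * localFourier v φ (k - l)) ∧
      localFourier w (mulSmooth φ φ φ.contDiff) k =
        ((2 * Real.pi : ℝ) ^ 4 : ℂ)⁻¹ *
          ∫ l : Mink, localFourier u φ l * localFourier v φ (k - l)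

/-- `w` is the iterated Hörmander product of a nonempty list of distributions. -/
inductive IsIteratedProduct : List 𝓓'(Ω, ℂ) → 𝓓'(Ω, ℂ) → Prop
  | single (u : 𝓓'(Ω, ℂ)) : IsIteratedProduct [u] u
  | cons (u : 𝓓'(Ω, ℂ)) (L : List 𝓓'(Ω, ℂ)) (v w : 𝓓'(Ω, ℂ)) :
      IsIteratedProduct L v → IsHormanderProduct u v w → IsIteratedProduct (u :: L) w

end Distributions

/-! ### Propagators -/

/-- `∫ d⁴x/(2π)⁴ e^{-i(px)} φ(x)`. -/
def inverseFourier (φ : 𝓢(Mink, ℂ)) (p : Mink) : ℂ :=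
  ((2 * Real.pi : ℝ) ^ 4 : ℂ)⁻¹ * ∫ x : Mink, planeWave (-p) x * φ x

/-- `u(x) = lim ∫ d⁴p/(2π)⁴ e^{-i(px)} K_t(p)` as a tempered distribution, the limit being taken
along the filter `l` in the regularisation parameter `t`. -/
def IsFourierLimit {ι : Type} (l : Filter ι) (K : ι → Mink → ℂ) (u : 𝓢'(Mink, ℂ)) : Prop :=
  ∀ φ : 𝓢(Mink, ℂ), Tendsto (fun t => ∫ p : Mink, K t p * inverseFourier φ p) l (𝓝 (u φ))

/-- `p² - m² + iδ`. -/
def massShell (m δ : ℝ) (p : Mink) : ℂ := (mdot p p : ℂ) - (m : ℂ) ^ 2 + Complex.I * (δ : ℂ)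

/-- The value at `p` of a polynomial with complex coefficients in `p⁰, …, p³`. -/
def evalPoly (M : MvPolynomial (Fin 4) ℂ) (p : Mink) : ℂ :=
  MvPolynomial.eval (fun i => ((p i : ℝ) : ℂ)) M

/-- A propagator of point-localized fields of mass `m`:
`u(x) = ∫ d⁴p/(2π)⁴ e^{-i(px)} (M(p)/(p² - m² + i0) + N(p))`. The first term is the kinematic
propagator with kernel `M`, the second a linear combination of derivatives of `δ(x)`. -/
def IsPointPropagator (m : ℝ) (M N : MvPolynomial (Fin 4) ℂ) (u : 𝓢'(Mink, ℂ)) : Prop :=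
  IsFourierLimit (𝓝[>] (0 : ℝ)) (fun δ p => evalPoly M p / massShell m δ p + evalPoly N p) u

/-- The scalar Feynman propagator `v(x) = ∫ d⁴p/(2π)⁴ e^{-i(px)} / (p² - m² + i0)`. -/
def IsFeynmanPropagator (m : ℝ) (v : 𝓢'(Mink, ℂ)) : Prop := IsPointPropagator m 1 0 v

/-- The contraction `f^μ E_{μν}(p,e,e') g^ν` of
`E_{μν} = η_{μν} - e_ν p_μ/((pe) - iε) - e'_μ p_ν/((pe') + iε')`
`  + (ee') p_μ p_ν/(((pe) - iε)((pe') + iε'))`. -/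
def stringE (ε ε' : ℝ) (p e e' f g : Mink) : ℂ :=
  (mdot f g : ℂ)
    - (mdot f p : ℂ) * (mdot e g : ℂ) / ((mdot p e : ℂ) - Complex.I * ε)
    - (mdot f e' : ℂ) * (mdot p g : ℂ) / ((mdot p e' : ℂ) + Complex.I * ε')
    + (mdot e e' : ℂ) * (mdot f p : ℂ) * (mdot p g : ℂ) /
        (((mdot p e : ℂ) - Complex.I * ε) * ((mdot p e' : ℂ) + Complex.I * ε'))

/-- The kernel `(-1)^s ∑_{2n ≤ s} β_n (E_ff)^n (E_f'f')^n (E_ff')^{s-2n}` of the kinematic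
propagator of the spin/helicity-`s` string-localized potentials contracted with `f` and `f'`, where
`E_ff = f^μ E_{μν}(p,e,-e) f^ν`, `E_f'f' = f'^μ E_{μν}(p,-e',e') f'^ν` and
`E_ff' = f^μ E_{μν}(p,e,e') f'^ν`. Each `(pe)` comes with `-iε`, each `(pe')` with `+iε'`. -/
def stringKernel (s : ℕ) (β : ℕ → ℂ) (f f' : Mink) (ε ε' : ℝ) (p e e' : Mink) : ℂ :=
  (-1) ^ s * ∑ n ∈ Finset.range (s / 2 + 1),
    β n * stringE ε ε p e (-e) f f ^ n * stringE ε' ε' p (-e') e' f' f' ^ n *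
      stringE ε ε' p e e' f f' ^ (s - 2 * n)

/-- `∫ d⁴e ∫ d⁴e' c(e) c(e') M(p,e,e')` with `M` the kernel above. -/
def smearedKernel (s : ℕ) (β : ℕ → ℂ) (f f' : Mink) (c : 𝓓(spacelike, ℂ)) (ε ε' : ℝ)
    (p : Mink) : ℂ :=
  ∫ e : Mink, ∫ e' : Mink, c e * c e' * stringKernel s β f f' ε ε' p e e'

/-- The smeared string-localized kinematic propagator of mass `m`,
`u(x) = ∫ d⁴p/(2π)⁴ e^{-i(px)} ∫ d⁴e ∫ d⁴e' c(e) c(e') M(p,e,e') / (p² - m² + i0)`,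
the limits of the three regularisations `(pe) - i0`, `(pe') + i0`, `p² - m² + i0` being taken
jointly and independently of each other. -/
def IsStringPropagator (m : ℝ) (s : ℕ) (β : ℕ → ℂ) (f f' : Mink) (c : 𝓓(spacelike, ℂ))
    (u : 𝓢'(Mink, ℂ)) : Prop :=
  IsFourierLimit (𝓝[>] (0 : ℝ) ×ˢ 𝓝[>] (0 : ℝ) ×ˢ 𝓝[>] (0 : ℝ))
    (fun t p => smearedKernel s β f f' c t.1 t.2.1 p / massShell m t.2.2 p) u

/-- `u` is one of the propagators whose products are considered: a massive or massless smeared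
string-localized kinematic propagator, or a massive or massless propagator of point-localized
fields. -/
def IsPropagator (u : 𝓢'(Mink, ℂ)) : Prop :=
  (∃ (m : ℝ) (s : ℕ) (β : ℕ → ℂ) (f f' : Mink) (c : 𝓓(spacelike, ℂ)),
      0 ≤ m ∧ IsStringPropagator m s β f f' c u) ∨
    ∃ (m : ℝ) (M N : MvPolynomial (Fin 4) ℂ), 0 ≤ m ∧ IsPointPropagator m M N u

end StringLocalized

end

/-!
# Products of string-localized propagators away from the origin

Everything is reduced to the scalar kernel `1/(p² - m² + i0)` multiplied by a symbol in momentum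
space.

*Existence.* Schwinger's formula `1/z = -i ∫₀^∞ exp(iτz) dτ` turns the regularised scalar kernel into
a proper-time integral of Fresnel integrals `∫ exp(iτp²) ψ(p) d⁴p`. These are bounded, and they are
`O(τ⁻²)` because the quadratic form `p²` is nondegenerate in four dimensions. Hence the limit
`δ → 0⁺` exists for every mass, with bounds uniform in the mass (`tendsto_scalarReg`,
`exists_norm_scalarReg_le`). A smeared power of `1/((pe) - iε)` is an integral along the ray through
`p` of the Fourier transform of the smearing function, so it satisfies the bounds of a homogeneous
symbol uniformly in `ε`, up to `ε = 0`; the degrees in the string-localized kernel add up to zero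
(`exists_isSymbolFamily_smearedKernel`). Such a symbol is singular at `p = 0` only. There the kernel
is decomposed into dyadic shells; by scaling, the shell of size `2⁻ʲ` contributes `O(4⁻ʲ)`, uniformly
in all regularisation parameters (`exists_limit_of_isSymbolFamily`). The low frequencies do not
affect wavefront sets, so every propagator acts in momentum space as a smooth symbol times the scalar
kernel (`HasSymbol`).

*Wavefront sets.* Multiplication by a symbol in momentum space does not enlarge the wavefront set:
expanding the symbol `b(k + q)` at `q = 0` by Hadamard's lemma, each factor `q` is a derivative of
the test function and each derivative of `b` gains a power of `‖k‖`
(`HasSymbol.rapidlyDecreasingOn_modulate`, `HasSymbol.WF_restrict_subset`).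

*Products.* In position space the Fresnel integral has the phase `-x²/(4τ)`. Against
`φ(x) exp(i(kx))`, with `φ` supported where `n·x < 0`, the derivative of the total phase along the
reflection of `n` is at least a constant times `‖k‖ + 1/(2τ)` in the directions `n·k > 0`.
Integration by parts gives rapid decrease there (`exists_norm_scalarLim_modulate_le`). As `n` is
arbitrary, the wavefront set over `x ≠ 0` lies on the ray `{λx : λ > 0}`; the uniform form of this is
`IsHalfSpaceRegular`, and it passes to all propagators. Rays are proper convex cones. Thus localized
Fourier transforms can be convolved when the localizations lie in a common proper cone around a
coordinate half-axis, and a partition of unity on eight such cones assembles the product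
(`prodDistribution`, `isHormanderProduct_prodDistribution`). The product is regular in the same sense
(`isHalfSpaceRegular_prodDistribution`), which makes the iteration possible. Uniqueness follows from
Fourier inversion, since a product is prescribed near each point (`IsHormanderProduct.unique`).
-/

noncomputable section

namespace StringLocalized

/-! ### Calculus -/

section Calculus

variable {E F : Type*} [NormedAddCommGroup E] [NormedSpace ℝ E]
  [NormedAddCommGroup F] [NormedSpace ℝ F]

/-- Differentiation under the integral sign to all orders, on an open set `s`, for an integrand
whose derivatives are dominated locally uniformly on `s`. -/
theorem iteratedFDeriv_integral_eq_of_dominated {α : Type*} [MeasurableSpace α] {μ : Measure α}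
    {s : Set E} (hs : IsOpen s) {f : α → E → F} (hf : ∀ a, ContDiff ℝ ∞ (f a))
    (hmeas : ∀ (n : ℕ) (x : E), AEStronglyMeasurable (fun a => iteratedFDeriv ℝ n (f a) x) μ)
    (hbound : ∀ (n : ℕ), ∀ x ∈ s, ∃ u ∈ 𝓝 x, ∃ b : α → ℝ, Integrable b μ ∧
      ∀ᵐ a ∂μ, ∀ y ∈ u, ‖iteratedFDeriv ℝ n (f a) y‖ ≤ b a) :
    ContDiffOn ℝ ∞ (fun x => ∫ a, f a x ∂μ) s ∧
      ∀ (n : ℕ), ∀ x ∈ s, iteratedFDeriv ℝ n (fun x => ∫ a, f a x ∂μ) x =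
        ∫ a, iteratedFDeriv ℝ n (f a) x ∂μ := by
  have hint : ∀ (n : ℕ), ∀ x ∈ s, Integrable (fun a => iteratedFDeriv ℝ n (f a) x) μ := by
    intro n x hx
    obtain ⟨u, hu, b, hb, hub⟩ := hbound n x hx
    exact hb.mono' (hmeas n x) (hub.mono fun a ha => ha x (mem_of_mem_nhds hu))
  have hder : ∀ (n : ℕ), ∀ x ∈ s,
      HasFDerivAt (fun x => ∫ a, iteratedFDeriv ℝ n (f a) x ∂μ)
        (∫ a, fderiv ℝ (iteratedFDeriv ℝ n (f a)) x ∂μ) x := by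
    intro n x hx
    obtain ⟨u, hu, b, hb, hub⟩ := hbound (n + 1) x hx
    refine hasFDerivAt_integral_of_dominated_of_fderiv_le (bound := b)
      (F' := fun x a => fderiv ℝ (iteratedFDeriv ℝ n (f a)) x)
      hu (Eventually.of_forall fun y => hmeas n y) (hint n x hx) ?_ ?_ hb ?_
    · simp only [fderiv_iteratedFDeriv]
      exact (LinearIsometryEquiv.continuous _).comp_aestronglyMeasurable (hmeas (n + 1) x)
    · filter_upwards [hub] with a ha y hy
      rw [norm_fderiv_iteratedFDeriv]
      exact ha y hy
    · refine Eventually.of_forall fun a y _ => DifferentiableAt.hasFDerivAt ?_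
      exact ((hf a).differentiable_iteratedFDeriv (m := n) (by exact_mod_cast ENat.natCast_lt_top n)) y
  have key : ∀ (n : ℕ), ∀ x ∈ s, iteratedFDeriv ℝ n (fun x => ∫ a, f a x ∂μ) x =
        ∫ a, iteratedFDeriv ℝ n (f a) x ∂μ := by
    intro n
    induction n with
    | zero =>
      intro x hx
      have h : ∀ g : E → F, iteratedFDeriv ℝ 0 g x =
          (continuousMultilinearCurryFin0 ℝ E F).symm (g x) := fun g => by
        rw [iteratedFDeriv_zero_eq_comp]; rfl
      simp only [h]
      exact ((continuousMultilinearCurryFin0 ℝ E F).symm.toContinuousLinearEquiv.integral_comp_comm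
        (fun a => f a x)).symm
    | succ n ih =>
      intro x hx
      have h : ∀ g : E → F, iteratedFDeriv ℝ (n + 1) g x =
          (continuousMultilinearCurryLeftEquiv ℝ (fun _ : Fin (n + 1) => E) F).symm
            (fderiv ℝ (iteratedFDeriv ℝ n g) x) := fun g => by
        rw [iteratedFDeriv_succ_eq_comp_left]; rfl
      have hev : iteratedFDeriv ℝ n (fun x => ∫ a, f a x ∂μ) =ᶠ[𝓝 x]
          fun x => ∫ a, iteratedFDeriv ℝ n (f a) x ∂μ :=
        Filter.eventually_of_mem (hs.mem_nhds hx) ih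
      simp only [h]
      rw [hev.fderiv_eq, (hder n x hx).fderiv]
      exact (ContinuousLinearEquiv.integral_comp_comm (𝕜 := ℝ) (μ := μ) (E := E →L[ℝ] (E [×n]→L[ℝ] F))
        (F := E [×(n + 1)]→L[ℝ] F) (continuousMultilinearCurryLeftEquiv ℝ
        (fun _ : Fin (n + 1) => E) F).symm.toContinuousLinearEquiv _).symm
  refine ⟨?_, key⟩
  refine contDiffOn_of_differentiableOn (n := ⊤) fun m _ => ?_
  refine DifferentiableOn.congr ?_ (iteratedFDerivWithin_of_isOpen m hs)
  refine DifferentiableOn.congr ?_ (key m)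
  exact fun x hx => (hder m x hx).differentiableAt.differentiableWithinAt

/-- Leibniz bound with weights: derivatives of order `i` of the factors bounded by
`A ρ^(d-i)` and `B ρ^(e-i)` give a product with derivatives bounded by `2^n A B ρ^(d+e-n)`. -/
theorem norm_iteratedFDeriv_mul_le_weighted {s : Set E} (hs : IsOpen s) {f g : E → ℂ}
    (hf : ContDiffOn ℝ ∞ f s) (hg : ContDiffOn ℝ ∞ g s) {x : E} (hx : x ∈ s) {ρ A B : ℝ}
    (hρ : 0 < ρ) (hA0 : 0 ≤ A) (d e : ℤ) (n : ℕ)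
    (hA : ∀ i ≤ n, ‖iteratedFDeriv ℝ i f x‖ ≤ A * ρ ^ (d - i))
    (hB : ∀ i ≤ n, ‖iteratedFDeriv ℝ i g x‖ ≤ B * ρ ^ (e - i)) :
    ‖iteratedFDeriv ℝ n (fun y => f y * g y) x‖ ≤ 2 ^ n * A * B * ρ ^ (d + e - n) := by
  have h := norm_iteratedFDerivWithin_mul_le hf hg hs.uniqueDiffOn hx (n := n)
    (by exact_mod_cast le_top)
  simp only [iteratedFDerivWithin_of_isOpen _ hs hx] at h
  refine h.trans ?_
  have hsum : ∑ i ∈ Finset.range (n + 1), (n.choose i : ℝ) = 2 ^ n := by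
    exact_mod_cast Nat.sum_range_choose n
  rw [← hsum, Finset.sum_mul, Finset.sum_mul, Finset.sum_mul]
  refine Finset.sum_le_sum fun i hi => ?_
  have hi' : i ≤ n := Nat.lt_succ_iff.mp (Finset.mem_range.mp hi)
  have e1 : ρ ^ (d + e - n) = ρ ^ (d - i) * ρ ^ (e - ((n - i : ℕ) : ℤ)) := by
    rw [← zpow_add₀ hρ.ne']; congr 1; push_cast [hi']; ring
  calc (n.choose i : ℝ) * ‖iteratedFDeriv ℝ i f x‖ * ‖iteratedFDeriv ℝ (n - i) g x‖
      ≤ (n.choose i : ℝ) * (A * ρ ^ (d - i)) * (B * ρ ^ (e - ((n - i : ℕ) : ℤ))) := by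
        gcongr
        · exact hA i hi'
        · exact hB _ (Nat.sub_le _ _)
    _ = _ := by rw [e1]; ring

theorem norm_iteratedFDeriv_mul_le_of_le {s : Set E} (hs : IsOpen s) {f g : E → ℂ}
    (hf : ContDiffOn ℝ ∞ f s) (hg : ContDiffOn ℝ ∞ g s) {x : E} (hx : x ∈ s) {A B : ℝ}
    (hA0 : 0 ≤ A) (n : ℕ) (hA : ∀ i ≤ n, ‖iteratedFDeriv ℝ i f x‖ ≤ A)
    (hB : ∀ i ≤ n, ‖iteratedFDeriv ℝ i g x‖ ≤ B) :
    ‖iteratedFDeriv ℝ n (fun y => f y * g y) x‖ ≤ 2 ^ n * A * B := by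
  have := norm_iteratedFDeriv_mul_le_weighted hs hf hg hx one_pos hA0 0 0 n
    (by simpa using hA) (by simpa using hB)
  simpa using this

/-- Peetre's inequality. -/
theorem one_add_norm_le_mul {V : Type*} [NormedAddCommGroup V] (k q : V) :
    1 + ‖k‖ ≤ (1 + ‖k + q‖) * (1 + ‖q‖) := by
  have h : ‖k‖ ≤ ‖k + q‖ + ‖q‖ := by
    calc ‖k‖ = ‖(k + q) - q‖ := by rw [add_sub_cancel_right]
      _ ≤ _ := norm_sub_le _ _
  nlinarith [norm_nonneg (k + q), norm_nonneg q]

theorem one_add_norm_add_le_mul {V : Type*} [NormedAddCommGroup V] (k q : V) :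
    1 + ‖k + q‖ ≤ (1 + ‖k‖) * (1 + ‖q‖) := by
  have h := norm_add_le k q
  nlinarith [norm_nonneg k, norm_nonneg q]

theorem zpow_one_add_norm_add_le {V : Type*} [NormedAddCommGroup V] (k q : V) (d : ℤ) :
    (1 + ‖k + q‖) ^ d ≤ (1 + ‖k‖) ^ d * (1 + ‖q‖) ^ d.natAbs := by
  have h0 : (0 : ℝ) < 1 + ‖k‖ := by positivity
  have h1 : (0 : ℝ) < 1 + ‖q‖ := by positivity
  have h2 : (0 : ℝ) < 1 + ‖k + q‖ := by positivity
  obtain ⟨m, rfl | rfl⟩ := Int.eq_nat_or_neg d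
  · simp only [Int.natAbs_natCast, zpow_natCast]
    rw [← mul_pow]
    gcongr
    exact one_add_norm_add_le_mul k q
  · simp only [Int.natAbs_neg, Int.natAbs_natCast, zpow_neg, zpow_natCast]
    rw [inv_mul_eq_div, le_div_iff₀ (by positivity), inv_mul_eq_div, div_le_iff₀ (by positivity),
      ← mul_pow]
    gcongr
    rw [mul_comm]
    exact one_add_norm_le_mul k q

/-- Multiplication by a function with polynomially bounded derivatives, in terms of Schwartz
seminorms. -/
theorem pow_mul_norm_iteratedFDeriv_mul_le {b : E → ℂ} (hb : ContDiff ℝ ∞ b) {A : ℝ}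
    (hA : 0 ≤ A) (D N : ℕ) (hbA : ∀ n ≤ N, ∀ p, ‖iteratedFDeriv ℝ n b p‖ ≤ A * (1 + ‖p‖) ^ D)
    (ψ : 𝓢(E, ℂ)) (κ n : ℕ) (hn : n ≤ N) (p : E) :
    (1 + ‖p‖) ^ κ * ‖iteratedFDeriv ℝ n (fun y => b y * ψ y) p‖ ≤
      A * (2 ^ (N + (κ + D)) *
        ((Finset.Iic (κ + D, N)).sup (schwartzSeminormFamily ℝ E ℂ)) ψ) := by
  set S := ((Finset.Iic (κ + D, N)).sup (schwartzSeminormFamily ℝ E ℂ)) ψ with hS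
  have hS0 : 0 ≤ S := apply_nonneg _ _
  have h1 : ∀ i ≤ n, ‖iteratedFDeriv ℝ i ψ p‖ ≤ 2 ^ (κ + D) * S / (1 + ‖p‖) ^ (κ + D) := by
    intro i hi
    rw [le_div_iff₀ (by positivity), mul_comm]
    exact SchwartzMap.one_add_le_sup_seminorm_apply (𝕜 := ℝ) (m := (κ + D, N)) (k := κ + D)
      (n := i) le_rfl (hi.trans hn) ψ p
  have h2 := norm_iteratedFDeriv_mul_le_of_le isOpen_univ hb.contDiffOn
    (ψ.smooth ⊤).contDiffOn (Set.mem_univ p) (by positivity) n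
    (fun i hi => hbA i (hi.trans hn) p) h1
  have hp : (0 : ℝ) < 1 + ‖p‖ := by positivity
  calc (1 + ‖p‖) ^ κ * ‖iteratedFDeriv ℝ n (fun y => b y * ψ y) p‖
      ≤ (1 + ‖p‖) ^ κ * (2 ^ n * (A * (1 + ‖p‖) ^ D) *
          (2 ^ (κ + D) * S / (1 + ‖p‖) ^ (κ + D))) := by gcongr
    _ = 2 ^ n * (A * (2 ^ (κ + D) * S)) := by
        rw [pow_add (1 + ‖p‖)]; field_simp
    _ ≤ 2 ^ N * (A * (2 ^ (κ + D) * S)) := by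
        gcongr
        norm_num
    _ = _ := by rw [pow_add 2 N]; ring

end Calculus

/-! ### The Minkowski product and the Fourier transform -/

theorem mdot_add_left (x y z : Mink) : mdot (x + y) z = mdot x z + mdot y z := by
  simp [mdot]; ring

theorem mdot_smul_left (a : ℝ) (x y : Mink) : mdot (a • x) y = a * mdot x y := by
  simp [mdot]; ring

theorem mdot_smul_right (a : ℝ) (x y : Mink) : mdot x (a • y) = a * mdot x y := by
  simp [mdot]; ring

theorem mdot_comm (x y : Mink) : mdot x y = mdot y x := by
  simp [mdot]; ring

theorem mdot_neg_left (x y : Mink) : mdot (-x) y = -mdot x y := by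
  simp [mdot]; ring

theorem mdot_neg_right (x y : Mink) : mdot x (-y) = -mdot x y := by
  simp [mdot]; ring

/-- Reflection of the spatial coordinates, which turns the Euclidean inner product into the
Minkowski product. -/
def reflect : Mink ≃ₗᵢ[ℝ] Mink :=
  LinearIsometryEquiv.piLpCongrRight 2 fun i : Fin 4 =>
    if i = 0 then LinearIsometryEquiv.refl ℝ ℝ else LinearIsometryEquiv.neg ℝ

theorem reflect_apply (p : Mink) (i : Fin 4) : reflect p i = if i = 0 then p i else - p i := by
  simp only [reflect, LinearIsometryEquiv.piLpCongrRight_apply]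
  split_ifs <;> simp

theorem inner_reflect (x p : Mink) : inner ℝ x (reflect p) = mdot x p := by
  rw [PiLp.inner_apply, Fin.sum_univ_four]
  simp [reflect_apply, mdot]
  ring

theorem reflect_reflect (p : Mink) : reflect (reflect p) = p := by
  ext i
  simp only [reflect_apply]
  split_ifs <;> simp

theorem mdot_reflect (x p : Mink) : mdot x (reflect p) = inner ℝ x p := by
  rw [← inner_reflect, reflect_reflect]

theorem abs_mdot_le (x p : Mink) : |mdot x p| ≤ ‖x‖ * ‖p‖ := by
  rw [← inner_reflect]
  exact (abs_real_inner_le_norm _ _).trans (by rw [reflect.norm_map])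

/-- The Minkowski product as a continuous bilinear map. -/
def mdotL : Mink →L[ℝ] Mink →L[ℝ] ℝ :=
  (innerSL ℝ).comp (reflect : Mink →L[ℝ] Mink)

theorem mdotL_apply (x y : Mink) : mdotL x y = mdot x y := by
  simp only [mdotL, ContinuousLinearMap.comp_apply]
  change inner ℝ (reflect x) y = _
  rw [real_inner_comm, inner_reflect, mdot_comm]

@[fun_prop]
theorem contDiff_mdot {E : Type*} [NormedAddCommGroup E] [NormedSpace ℝ E] {n : WithTop ℕ∞}
    {f g : E → Mink} (hf : ContDiff ℝ n f) (hg : ContDiff ℝ n g) :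
    ContDiff ℝ n (fun x => mdot (f x) (g x)) := by
  simp only [← mdotL_apply]
  exact (mdotL.contDiff.comp hf).clm_apply hg

@[fun_prop]
theorem continuous_mdot {X : Type*} [TopologicalSpace X]
    {f g : X → Mink} (hf : Continuous f) (hg : Continuous g) :
    Continuous (fun x => mdot (f x) (g x)) := by
  simp only [← mdotL_apply]
  exact (mdotL.continuous.comp hf).clm_apply hg

theorem norm_planeWave (k x : Mink) : ‖planeWave k x‖ = 1 := by
  rw [planeWave, mul_comm, Complex.norm_exp_ofReal_mul_I]

theorem planeWave_add (k q x : Mink) : planeWave (k + q) x = planeWave k x * planeWave q x := by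
  rw [planeWave, planeWave, planeWave, ← Complex.exp_add, mdot_add_left]
  push_cast; ring_nf

@[fun_prop]
theorem continuous_planeWave {X : Type*} [TopologicalSpace X]
    {f g : X → Mink} (hf : Continuous f) (hg : Continuous g) :
    Continuous (fun x => planeWave (f x) (g x)) := by
  unfold planeWave
  fun_prop

@[fun_prop]
theorem contDiff_planeWave_comp {E : Type*} [NormedAddCommGroup E] [NormedSpace ℝ E]
    {n : WithTop ℕ∞} {f g : E → Mink} (hf : ContDiff ℝ n f) (hg : ContDiff ℝ n g) :
    ContDiff ℝ n (fun x => planeWave (f x) (g x)) := by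
  unfold planeWave
  exact (contDiff_const.mul (Complex.ofRealCLM.contDiff.comp (contDiff_mdot hf hg))).cexp

/-- `p ↦ ηp / 2π`, relating the frequency variable of Mathlib's Fourier transform to momentum. -/
def freqEquiv : Mink ≃L[ℝ] Mink :=
  reflect.toContinuousLinearEquiv.trans
    (LinearEquiv.smulOfNeZero ℝ Mink (2 * Real.pi)⁻¹
      (by positivity)).toContinuousLinearEquiv

theorem freqEquiv_apply (p : Mink) : freqEquiv p = (2 * Real.pi)⁻¹ • reflect p := rfl

theorem two_pi_ne_zero : ((2 * Real.pi : ℝ) ^ 4 : ℂ) ≠ 0 := by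
  have : (2 * Real.pi : ℝ) ≠ 0 := by positivity
  exact_mod_cast pow_ne_zero 4 this

theorem integral_comp_freqEquiv (f : Mink → ℂ) :
    ∫ q : Mink, f (freqEquiv q) = ((2 * Real.pi : ℝ) ^ 4 : ℂ) * ∫ w : Mink, f w := by
  have h1 : ∫ q : Mink, f (freqEquiv q) = ∫ q : Mink, f ((2 * Real.pi)⁻¹ • q) := by
    simp only [freqEquiv_apply]
    exact (reflect.measurePreserving).integral_comp
      reflect.toHomeomorph.measurableEmbedding (fun q => f ((2 * Real.pi)⁻¹ • q))
  rw [h1, Measure.integral_comp_smul, finrank_euclideanSpace, Fintype.card_fin]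
  have : |(((2 * Real.pi)⁻¹ ^ 4 : ℝ))⁻¹| = (2 * Real.pi) ^ 4 := by
    rw [inv_pow, inv_inv, abs_of_pos (by positivity)]
  rw [this, Complex.real_smul]
  push_cast; ring

/-- The map `φ ↦ inverseFourier φ` as a continuous linear automorphism of the Schwartz space. -/
def invF : 𝓢(Mink, ℂ) ≃L[ℂ] 𝓢(Mink, ℂ) :=
  ContinuousLinearEquiv.equivOfInverse
    (((2 * Real.pi : ℝ) ^ 4 : ℂ)⁻¹ • (SchwartzMap.compCLMOfContinuousLinearEquiv ℂ freqEquiv).comp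
      (SchwartzMap.fourierTransformCLM ℂ))
    (((2 * Real.pi : ℝ) ^ 4 : ℂ) •
      (FourierTransform.fourierInvCLM ℂ 𝓢(Mink, ℂ)).comp
        (SchwartzMap.compCLMOfContinuousLinearEquiv ℂ freqEquiv.symm))
    (by
      intro φ
      have : SchwartzMap.compCLMOfContinuousLinearEquiv ℂ freqEquiv.symm
          (SchwartzMap.compCLMOfContinuousLinearEquiv ℂ freqEquiv
            (SchwartzMap.fourierTransformCLM ℂ φ)) = FourierTransform.fourier φ := by
        ext x; simp
      simp only [smul_apply, ContinuousLinearMap.comp_apply, map_smul, this,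
        smul_smul]
      rw [inv_mul_cancel₀ two_pi_ne_zero, one_smul]
      simp)
    (by
      intro φ
      simp only [smul_apply, ContinuousLinearMap.comp_apply, map_smul,
        smul_smul]
      rw [mul_inv_cancel₀ two_pi_ne_zero, one_smul]
      ext x; simp)

theorem invF_apply (φ : 𝓢(Mink, ℂ)) (p : Mink) : invF φ p = inverseFourier φ p := by
  change ((2 * Real.pi : ℝ) ^ 4 : ℂ)⁻¹ • (FourierTransform.fourier (φ : Mink → ℂ)) (freqEquiv p) = _
  rw [Real.fourier_eq', inverseFourier, smul_eq_mul]
  congr 1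
  refine integral_congr_ae (Eventually.of_forall fun x => ?_)
  simp only [smul_eq_mul, planeWave]
  congr 2
  rw [freqEquiv_apply, inner_smul_right, inner_reflect, mdot_neg_left, mdot_comm p x]
  have : (Real.pi : ℂ) ≠ 0 := by exact_mod_cast Real.pi_ne_zero
  push_cast
  field_simp

/-- Fourier inversion. -/
theorem integral_invF_mul_planeWave (φ : 𝓢(Mink, ℂ)) (x : Mink) :
    ∫ q : Mink, invF φ q * planeWave q x = φ x := by
  have h0 : FourierTransformInv.fourierInv (FourierTransform.fourier φ) = φ := by simp
  have h : FourierTransformInv.fourierInv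
      (FourierTransform.fourier (φ : Mink → ℂ)) x = φ x := by
    rw [← SchwartzMap.fourier_coe, ← SchwartzMap.fourierInv_coe, h0]
  rw [Real.fourierInv_eq'] at h
  have h2 := integral_comp_freqEquiv (fun v => Complex.exp (↑(2 * Real.pi * inner ℝ v x) * Complex.I)
    • FourierTransform.fourier (φ : Mink → ℂ) v)
  rw [h] at h2
  have h3 : ∀ q, invF φ q * planeWave q x = ((2 * Real.pi : ℝ) ^ 4 : ℂ)⁻¹ *
      (Complex.exp (↑(2 * Real.pi * inner ℝ (freqEquiv q) x) * Complex.I)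
    • FourierTransform.fourier (φ : Mink → ℂ) (freqEquiv q)) := by
    intro q
    change (((2 * Real.pi : ℝ) ^ 4 : ℂ)⁻¹ •
      (FourierTransform.fourier (φ : Mink → ℂ)) (freqEquiv q)) * planeWave q x = _
    rw [smul_eq_mul, mul_assoc, smul_eq_mul]
    congr 1
    rw [mul_comm, planeWave]
    congr 2
    rw [freqEquiv_apply, inner_smul_left, real_inner_comm, inner_reflect, mdot_comm q x]
    have : (Real.pi : ℂ) ≠ 0 := by exact_mod_cast Real.pi_ne_zero
    simp only [RCLike.conj_to_real]
    push_cast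
    field_simp
  simp only [h3]
  rw [integral_const_mul, h2, inv_mul_cancel_left₀ two_pi_ne_zero]

/-- Modulation becomes translation in momentum space. -/
theorem invF_modulate {φ φ' : 𝓢(Mink, ℂ)} {k : Mink}
    (h : ∀ x, φ' x = φ x * planeWave k x) (p : Mink) : invF φ' p = invF φ (p - k) := by
  rw [invF_apply, invF_apply, inverseFourier, inverseFourier]
  congr 1
  refine integral_congr_ae (Eventually.of_forall fun x => ?_)
  simp only [h]
  rw [neg_sub, sub_eq_add_neg, planeWave_add]
  ring

/-- A directional derivative becomes multiplication by `i (p v)` in momentum space. -/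
theorem invF_fderiv {φ φ' : 𝓢(Mink, ℂ)} {v : Mink}
    (h : ∀ x, φ' x = fderiv ℝ φ x v) (p : Mink) :
    invF φ' p = Complex.I * (mdot p v : ℂ) * invF φ p := by
  have h1 : φ' = LineDeriv.lineDerivOp v φ := by
    ext x; rw [h, SchwartzMap.lineDerivOp_apply_eq_fderiv]
  change ((2 * Real.pi : ℝ) ^ 4 : ℂ)⁻¹ • (FourierTransform.fourier φ') (freqEquiv p) =
    _ * (((2 * Real.pi : ℝ) ^ 4 : ℂ)⁻¹ • (FourierTransform.fourier φ) (freqEquiv p))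
  rw [h1, SchwartzMap.fourier_lineDerivOp_eq, smul_apply,
    SchwartzMap.smulLeftCLM_apply_apply (by fun_prop)]
  rw [freqEquiv_apply, inner_smul_left, real_inner_comm, inner_reflect, mdot_comm v p]
  have : (Real.pi : ℂ) ≠ 0 := by exact_mod_cast Real.pi_ne_zero
  simp only [RCLike.conj_to_real, Complex.real_smul, smul_eq_mul]
  push_cast
  field_simp

/-! ### The proper-time representation of the scalar propagator -/

/-- The Fresnel integral `∫ exp(iτ(pp)) ψ(p) d⁴p`. -/
def fresnel (ψ : 𝓢(Mink, ℂ)) (τ : ℝ) : ℂ :=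
  ∫ p : Mink, Complex.exp (Complex.I * (τ * mdot p p : ℝ)) * ψ p

theorem norm_exp_I_mul (r : ℝ) : ‖Complex.exp (Complex.I * (r : ℂ))‖ = 1 := by
  rw [mul_comm, Complex.norm_exp_ofReal_mul_I]

theorem continuous_fresnel (ψ : 𝓢(Mink, ℂ)) : Continuous (fresnel ψ) := by
  unfold fresnel
  refine continuous_of_dominated (bound := fun p => ‖ψ p‖) (fun τ => ?_) (fun τ => ?_)
    ψ.integrable.norm ?_
  · have := ψ.continuous
    exact Continuous.aestronglyMeasurable (by fun_prop)
  · refine Eventually.of_forall fun p => ?_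
    rw [norm_mul, norm_exp_I_mul, one_mul]
  · refine Eventually.of_forall fun p => ?_
    fun_prop

theorem norm_fresnel_le_integral (ψ : 𝓢(Mink, ℂ)) (τ : ℝ) : ‖fresnel ψ τ‖ ≤ ∫ p, ‖ψ p‖ := by
  refine (norm_integral_le_integral_norm _).trans (le_of_eq ?_)
  refine integral_congr_ae (Eventually.of_forall fun p => ?_)
  simp only [norm_mul, norm_exp_I_mul, one_mul]

/-- The coefficients of the regularised quadratic form `-ε|p|² + iτ(pp)`. -/
def gaussCoeff (ε τ : ℝ) (i : Fin 4) : ℂ :=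
  if i = 0 then (ε : ℂ) - Complex.I * τ else (ε : ℂ) + Complex.I * τ

theorem gaussCoeff_re (ε τ : ℝ) (i : Fin 4) : (gaussCoeff ε τ i).re = ε := by
  unfold gaussCoeff; split_ifs <;> simp

theorem gaussCoeff_norm_ge (ε τ : ℝ) (i : Fin 4) : τ ≤ ‖gaussCoeff ε τ i‖ := by
  refine le_trans ?_ (Complex.abs_im_le_norm _)
  unfold gaussCoeff; split_ifs <;> simp [le_abs_self]

theorem gaussCoeff_ne_zero {ε τ : ℝ} (hτ : 0 < τ) (i : Fin 4) : gaussCoeff ε τ i ≠ 0 := by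
  rw [← norm_pos_iff]
  exact hτ.trans_le (gaussCoeff_norm_ge ε τ i)

theorem integral_euclidean_eq (f : Mink → ℂ) :
    ∫ p : Mink, f p = ∫ v : Fin 4 → ℝ, f (WithLp.toLp 2 v) :=
  ((PiLp.volume_preserving_toLp (Fin 4)).integral_comp
    (MeasurableEquiv.toLp 2 _).measurableEmbedding f).symm

theorem integral_gauss_mul_planeWave {ε τ : ℝ} (hε : 0 < ε) (x : Mink) :
    ∫ p : Mink, Complex.exp (-∑ i, gaussCoeff ε τ i * (p i : ℂ) ^ 2) * planeWave (-p) x =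
      ∏ i, ((Real.pi : ℂ) / gaussCoeff ε τ i) ^ (1 / 2 : ℂ) *
        Complex.exp (-(x i : ℂ) ^ 2 / (4 * gaussCoeff ε τ i)) := by
  rw [integral_euclidean_eq]
  have h := GaussianFourier.integral_cexp_neg_sum_mul_add
    (b := gaussCoeff ε τ) (fun i => by rw [gaussCoeff_re]; exact hε)
    (fun i => -Complex.I * (reflect x i : ℂ))
  have h2 : ∀ v : Fin 4 → ℝ, Complex.exp (-∑ i, gaussCoeff ε τ i * ((WithLp.toLp 2 v : Mink) i : ℂ) ^ 2) *
      planeWave (-(WithLp.toLp 2 v)) x = Complex.exp (-∑ i, gaussCoeff ε τ i * (v i : ℂ) ^ 2 +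
        ∑ i, -Complex.I * (reflect x i : ℂ) * v i) := by
    intro v
    rw [Complex.exp_add, planeWave]
    congr 2
    rw [Fin.sum_univ_four]
    simp [mdot, reflect_apply]
    ring
  simp only [h2]
  rw [h]
  refine Finset.prod_congr rfl fun i _ => ?_
  congr 2
  rw [mul_pow, neg_sq, Complex.I_sq, reflect_apply]
  split_ifs <;> simp

theorem norm_exp_neg_sq_div_le {ε τ : ℝ} (hε : 0 ≤ ε) (x : Mink) :
    ‖∏ i, Complex.exp (-(x i : ℂ) ^ 2 / (4 * gaussCoeff ε τ i))‖ ≤ 1 := by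
  rw [norm_prod]
  refine Finset.prod_le_one (fun _ _ => norm_nonneg _) fun i _ => ?_
  rw [Complex.norm_exp, Real.exp_le_one_iff]
  have : -(x i : ℂ) ^ 2 / (4 * gaussCoeff ε τ i) =
      ((-(x i) ^ 2 / 4 : ℝ) : ℂ) * (gaussCoeff ε τ i)⁻¹ := by
    push_cast; rw [div_eq_mul_inv, mul_inv]; ring
  rw [this, Complex.re_ofReal_mul, Complex.inv_re, gaussCoeff_re]
  have h1 : 0 ≤ ε / Complex.normSq (gaussCoeff ε τ i) := div_nonneg hε (Complex.normSq_nonneg _)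
  nlinarith [sq_nonneg (x i), mul_nonneg (sq_nonneg (x i)) h1]

theorem norm_gaussFactor_le {ε τ : ℝ} (hτ : 0 < τ) :
    ‖∏ i, ((Real.pi : ℂ) / gaussCoeff ε τ i) ^ (1 / 2 : ℂ)‖ ≤ (Real.pi / τ) ^ 2 := by
  rw [norm_prod]
  have h : ∀ i, ‖((Real.pi : ℂ) / gaussCoeff ε τ i) ^ (1 / 2 : ℂ)‖ ≤ (Real.pi / τ) ^ (1 / 2 : ℝ) := by
    intro i
    have : (1 / 2 : ℂ) = ((1 / 2 : ℝ) : ℂ) := by push_cast; rfl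
    rw [this, Complex.norm_cpow_real]
    refine Real.rpow_le_rpow (norm_nonneg _) ?_ (by norm_num)
    rw [norm_div, Complex.norm_real, Real.norm_of_nonneg Real.pi_pos.le]
    exact div_le_div_of_nonneg_left Real.pi_pos.le hτ (gaussCoeff_norm_ge ε τ i)
  refine (Finset.prod_le_prod (fun _ _ => norm_nonneg _) (fun i _ => h i)).trans ?_
  have h0 : 0 ≤ Real.pi / τ := by positivity
  rw [Finset.prod_const, Finset.card_univ, Fintype.card_fin, ← Real.rpow_natCast, ← Real.rpow_mul h0]
  norm_num

theorem exp_neg_sum_gaussCoeff (ε τ : ℝ) (p : Mink) :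
    Complex.exp (-∑ i, gaussCoeff ε τ i * (p i : ℂ) ^ 2) =
      (Real.exp (-ε * ‖p‖ ^ 2) : ℂ) * Complex.exp (Complex.I * (τ * mdot p p : ℝ)) := by
  rw [Complex.ofReal_exp, ← Complex.exp_add, EuclideanSpace.norm_sq_eq]
  congr 1
  simp [Fin.sum_univ_four, gaussCoeff, mdot]
  ring

/-- The Fresnel integral with a Gaussian convergence factor `exp(-ε‖p‖²)`: Fubini moves the Gaussian
integral onto the plane waves, where it can be computed. -/
theorem norm_fresnel_reg_le {ε τ : ℝ} (hε : 0 < ε) (hτ : 0 < τ) (φ : 𝓢(Mink, ℂ)) :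
    ‖∫ p : Mink, Complex.exp (-∑ i, gaussCoeff ε τ i * (p i : ℂ) ^ 2) * invF φ p‖ ≤
      (τ ^ 2)⁻¹ * ‖∫ x : Mink, φ x * ∏ i, Complex.exp (-(x i : ℂ) ^ 2 / (4 * gaussCoeff ε τ i))‖ := by
  set g : Mink → ℂ := fun p => Complex.exp (-∑ i, gaussCoeff ε τ i * (p i : ℂ) ^ 2) with hg
  have hgi : Integrable g := by
    have h := GaussianFourier.integrable_cexp_neg_sum_mul_add
      (b := gaussCoeff ε τ) (fun i => by rw [gaussCoeff_re]; exact hε) 0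
    simp only [Pi.zero_apply, zero_mul, Finset.sum_const_zero, add_zero] at h
    exact ((PiLp.volume_preserving_toLp (Fin 4)).integrable_comp_emb
      (MeasurableEquiv.toLp 2 _).measurableEmbedding (g := g)).mp h
  have hprod : Integrable (Function.uncurry fun (p x : Mink) => g p * (planeWave (-p) x * φ x))
      (volume.prod volume) := by
    refine (hgi.norm.mul_prod φ.integrable.norm).mono' ?_ (Eventually.of_forall fun z => ?_)
    · have := φ.continuous
      have : Continuous g := by fun_prop
      exact Continuous.aestronglyMeasurable (by unfold Function.uncurry; fun_prop)
    · simp [Function.uncurry, norm_planeWave]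
  have e1 : ∫ p : Mink, g p * invF φ p = ((2 * Real.pi : ℝ) ^ 4 : ℂ)⁻¹ *
      ∫ x : Mink, (∏ i, ((Real.pi : ℂ) / gaussCoeff ε τ i) ^ (1 / 2 : ℂ)) *
        (φ x * ∏ i, Complex.exp (-(x i : ℂ) ^ 2 / (4 * gaussCoeff ε τ i))) := by
    simp only [invF_apply, inverseFourier]
    rw [← integral_const_mul]
    have : ∀ p : Mink, g p * (((2 * Real.pi : ℝ) ^ 4 : ℂ)⁻¹ * ∫ x : Mink, planeWave (-p) x * φ x) =
        ((2 * Real.pi : ℝ) ^ 4 : ℂ)⁻¹ * ∫ x : Mink, g p * (planeWave (-p) x * φ x) := by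
      intro p; rw [integral_const_mul]; ring
    simp only [this]
    rw [integral_const_mul, integral_integral_swap hprod, integral_const_mul]
    congr 1
    have h2 : ∀ x : Mink, ∫ p : Mink, g p * (planeWave (-p) x * φ x) =
        (∏ i, ((Real.pi : ℂ) / gaussCoeff ε τ i) ^ (1 / 2 : ℂ)) *
        (φ x * ∏ i, Complex.exp (-(x i : ℂ) ^ 2 / (4 * gaussCoeff ε τ i))) := by
      intro x
      simp only [← mul_assoc]
      rw [integral_mul_const, integral_gauss_mul_planeWave hε, Finset.prod_mul_distrib]
      ring
    simp only [h2]
  rw [e1, integral_const_mul, norm_mul, norm_mul, ← mul_assoc]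
  gcongr
  have hpi : ‖((2 * Real.pi : ℝ) ^ 4 : ℂ)⁻¹‖ = ((2 * Real.pi) ^ 4)⁻¹ := by
    rw [norm_inv, norm_pow, Complex.norm_real, Real.norm_of_nonneg (by positivity)]
  rw [hpi]
  calc ((2 * Real.pi) ^ 4)⁻¹ * _ ≤ ((2 * Real.pi) ^ 4)⁻¹ * (Real.pi / τ) ^ 2 := by
        gcongr; exact norm_gaussFactor_le hτ
    _ = (16 * Real.pi ^ 2)⁻¹ * (τ ^ 2)⁻¹ := by
        have := Real.pi_ne_zero
        field_simp; ring
    _ ≤ 1 * (τ ^ 2)⁻¹ := by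
        gcongr
        refine inv_le_one_of_one_le₀ ?_
        nlinarith [Real.pi_gt_three]
    _ = _ := one_mul _

/-- In position space the Fresnel integral of `invF φ` is `τ⁻²` times an oscillatory integral
of `φ`. -/
theorem norm_fresnel_invF_le {τ : ℝ} (hτ : 0 < τ) (φ : 𝓢(Mink, ℂ)) :
    ‖fresnel (invF φ) τ‖ ≤ (τ ^ 2)⁻¹ *
      ‖∫ x : Mink, Complex.exp (-Complex.I * (mdot x x / (4 * τ) : ℝ)) * φ x‖ := by
  have h1 : Tendsto (fun ε : ℝ => ‖∫ p : Mink,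
      Complex.exp (-∑ i, gaussCoeff ε τ i * (p i : ℂ) ^ 2) * invF φ p‖) (𝓝[>] 0)
      (𝓝 ‖fresnel (invF φ) τ‖) := by
    refine Tendsto.norm ?_
    unfold fresnel
    simp only [exp_neg_sum_gaussCoeff]
    refine tendsto_integral_filter_of_dominated_convergence (fun p => ‖invF φ p‖) ?_ ?_
      (invF φ).integrable.norm ?_
    · refine Eventually.of_forall fun ε => ?_
      have := (invF φ).continuous
      exact Continuous.aestronglyMeasurable (by fun_prop)
    · filter_upwards [self_mem_nhdsWithin] with ε hε
      refine Eventually.of_forall fun p => ?_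
      have hε' : (0 : ℝ) < ε := hε
      rw [norm_mul, norm_mul, norm_exp_I_mul, mul_one, Complex.norm_real,
        Real.norm_of_nonneg (Real.exp_pos _).le]
      refine mul_le_of_le_one_left (norm_nonneg _) ?_
      rw [Real.exp_le_one_iff]
      nlinarith [sq_nonneg ‖p‖]
    · refine Eventually.of_forall fun p => ?_
      refine Tendsto.mul_const _ ?_
      have : Continuous fun ε : ℝ => (Real.exp (-ε * ‖p‖ ^ 2) : ℂ) *
          Complex.exp (Complex.I * (τ * mdot p p : ℝ)) := by fun_prop
      have h := (this.tendsto 0).mono_left (nhdsWithin_le_nhds (s := Set.Ioi 0))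
      simpa using h
  have h2 : Tendsto (fun ε : ℝ => (τ ^ 2)⁻¹ * ‖∫ x : Mink, φ x *
      ∏ i, Complex.exp (-(x i : ℂ) ^ 2 / (4 * gaussCoeff ε τ i))‖) (𝓝[>] 0)
      (𝓝 ((τ ^ 2)⁻¹ *
      ‖∫ x : Mink, Complex.exp (-Complex.I * (mdot x x / (4 * τ) : ℝ)) * φ x‖)) := by
    refine (Tendsto.norm ?_).const_mul _
    refine tendsto_integral_filter_of_dominated_convergence (fun p => ‖φ p‖) ?_ ?_
      φ.integrable.norm ?_
    · refine Eventually.of_forall fun ε => ?_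
      have := φ.continuous
      exact Continuous.aestronglyMeasurable (by fun_prop)
    · filter_upwards [self_mem_nhdsWithin] with ε hε
      refine Eventually.of_forall fun p => ?_
      rw [norm_mul]
      exact mul_le_of_le_one_right (norm_nonneg _) (norm_exp_neg_sq_div_le (le_of_lt hε) p)
    · refine Eventually.of_forall fun x => ?_
      have hc : ContinuousAt (fun ε : ℝ => φ x *
          ∏ i, Complex.exp (-(x i : ℂ) ^ 2 / (4 * gaussCoeff ε τ i))) 0 := by
        refine continuousAt_const.mul (tendsto_finsetProd _ fun i _ => ?_)
        refine ContinuousAt.cexp ?_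
        refine continuousAt_const.div ?_ (by simpa using gaussCoeff_ne_zero hτ i)
        unfold gaussCoeff
        split_ifs <;> fun_prop
      have h := hc.tendsto.mono_left (nhdsWithin_le_nhds (s := Set.Ioi 0))
      convert h using 2
      rw [mul_comm, ← Complex.exp_sum]
      congr 2
      have : (τ : ℂ) ≠ 0 := by exact_mod_cast hτ.ne'
      simp [Fin.sum_univ_four, gaussCoeff, mdot]
      field_simp
      ring_nf
      simp [Complex.I_sq]
      ring
  -- both sides of the regularised bound converge as `ε → 0⁺`
  refine le_of_tendsto_of_tendsto h1 h2 ?_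
  filter_upwards [self_mem_nhdsWithin] with ε hε
  exact norm_fresnel_reg_le hε hτ φ

/-- `ψ` tested against the regularised scalar kernel `1/(p² - m² + iδ)`. -/
def scalarReg (m δ : ℝ) (ψ : 𝓢(Mink, ℂ)) : ℂ := ∫ p : Mink, ψ p / massShell m δ p

/-- `ψ` tested against `1/(p² - m² + i0)`, by the proper-time formula
`-i ∫₀^∞ exp(-iτm²) ∫ exp(iτp²) ψ(p) d⁴p dτ`. -/
def scalarLim (m : ℝ) (ψ : 𝓢(Mink, ℂ)) : ℂ :=
  -Complex.I * ∫ τ in Set.Ioi (0 : ℝ), Complex.exp (Complex.I * (-(τ * m ^ 2) : ℝ)) * fresnel ψ τ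

theorem massShell_im (m δ : ℝ) (p : Mink) : (massShell m δ p).im = δ := by
  simp [massShell, ← Complex.ofReal_pow]

theorem le_norm_massShell {m δ : ℝ} (p : Mink) : δ ≤ ‖massShell m δ p‖ := by
  have := Complex.abs_im_le_norm (massShell m δ p)
  rw [massShell_im] at this
  exact (le_abs_self _).trans this

theorem massShell_ne_zero {m δ : ℝ} (hδ : 0 < δ) (p : Mink) : massShell m δ p ≠ 0 := by
  rw [← norm_pos_iff]
  exact hδ.trans_le (le_norm_massShell p)

theorem continuous_massShell (m δ : ℝ) : Continuous (massShell m δ) := by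
  unfold massShell; fun_prop

theorem exp_I_mul_massShell (m δ τ : ℝ) (p : Mink) :
    Complex.exp (Complex.I * massShell m δ p * τ) =
      (Real.exp (-(δ * τ)) : ℂ) * Complex.exp (Complex.I * (-(τ * m ^ 2) : ℝ)) *
        Complex.exp (Complex.I * (τ * mdot p p : ℝ)) := by
  rw [Complex.ofReal_exp, ← Complex.exp_add, ← Complex.exp_add]
  congr 1
  rw [massShell]
  push_cast
  linear_combination (δ * τ : ℂ) * Complex.I_sq

theorem inv_eq_integral_exp {z : ℂ} (hz : 0 < z.im) :
    z⁻¹ = -Complex.I * ∫ τ in Set.Ioi (0 : ℝ), Complex.exp (Complex.I * z * τ) := by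
  have hz0 : z ≠ 0 := by rintro rfl; simp at hz
  rw [integral_exp_mul_complex_Ioi (by simpa using hz)]
  have := Complex.I_ne_zero
  simp
  field_simp

/-- Schwinger's formula. -/
theorem scalarReg_eq {m δ : ℝ} (hδ : 0 < δ) (ψ : 𝓢(Mink, ℂ)) :
    scalarReg m δ ψ = -Complex.I * ∫ τ in Set.Ioi (0 : ℝ), (Real.exp (-(δ * τ)) : ℂ) *
      (Complex.exp (Complex.I * (-(τ * m ^ 2) : ℝ)) * fresnel ψ τ) := by
  have hc := ψ.continuous
  have hm := continuous_massShell m δ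
  have h1 : ∀ p, ψ p / massShell m δ p =
      -Complex.I * ∫ τ in Set.Ioi (0 : ℝ), ψ p * Complex.exp (Complex.I * massShell m δ p * τ) := by
    intro p
    rw [div_eq_mul_inv, inv_eq_integral_exp (by rwa [massShell_im]), integral_const_mul]
    ring
  have hprod : Integrable (Function.uncurry fun (p : Mink) (τ : ℝ) =>
      ψ p * Complex.exp (Complex.I * massShell m δ p * τ))
      (volume.prod (volume.restrict (Set.Ioi 0))) := by
    refine (ψ.integrable.norm.mul_prod
      (integrableOn_exp_mul_Ioi (neg_lt_zero.mpr hδ) 0)).mono' ?_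
      (Eventually.of_forall fun z => ?_)
    · exact Continuous.aestronglyMeasurable (by unfold Function.uncurry; fun_prop)
    · simp only [Function.uncurry, exp_I_mul_massShell, norm_mul, norm_exp_I_mul, mul_one,
        Complex.norm_real, Real.norm_of_nonneg (Real.exp_pos _).le, neg_mul, le_refl]
  unfold scalarReg
  simp only [h1]
  rw [integral_const_mul, integral_integral_swap hprod]
  congr 1
  refine integral_congr_ae (Eventually.of_forall fun τ => ?_)
  simp only [fresnel]
  rw [← integral_const_mul, ← integral_const_mul]
  refine integral_congr_ae (Eventually.of_forall fun p => ?_)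
  simp only [exp_I_mul_massShell]
  ring

/-- The size of `ψ` controlling the proper-time integral. -/
def fresnelNorm (ψ : 𝓢(Mink, ℂ)) : ℝ := (∫ p, ‖ψ p‖) + ∫ x, ‖invF.symm ψ x‖

theorem fresnelNorm_nonneg (ψ : 𝓢(Mink, ℂ)) : 0 ≤ fresnelNorm ψ := by
  unfold fresnelNorm; positivity

theorem norm_fresnel_le (ψ : 𝓢(Mink, ℂ)) {τ : ℝ} (hτ : 0 < τ) :
    ‖fresnel ψ τ‖ ≤ 2 * fresnelNorm ψ * (1 + τ ^ 2)⁻¹ := by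
  have hA : 0 ≤ ∫ p, ‖ψ p‖ := by positivity
  have hB : 0 ≤ ∫ x, ‖invF.symm ψ x‖ := by positivity
  unfold fresnelNorm
  rw [← div_eq_mul_inv, le_div_iff₀ (by positivity)]
  have h1 := norm_fresnel_le_integral ψ τ
  have h2 : τ ^ 2 * ‖fresnel ψ τ‖ ≤ ∫ x, ‖invF.symm ψ x‖ := by
    have h := norm_fresnel_invF_le hτ (invF.symm ψ)
    rw [ContinuousLinearEquiv.apply_symm_apply] at h
    rw [← le_inv_mul_iff₀ (by positivity)]
    refine h.trans ?_
    gcongr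
    refine (norm_integral_le_integral_norm _).trans (le_of_eq ?_)
    refine integral_congr_ae (Eventually.of_forall fun p => ?_)
    simp only [norm_mul, neg_mul, ← mul_neg, ← Complex.ofReal_neg, norm_exp_I_mul, one_mul]
  nlinarith

theorem integrable_fresnelBound (c : ℝ) :
    Integrable (fun τ : ℝ => c * (1 + τ ^ 2)⁻¹) (volume.restrict (Set.Ioi 0)) :=
  (integrable_inv_one_add_sq.const_mul c).restrict

theorem integral_fresnelBound_le {c : ℝ} (hc : 0 ≤ c) :
    ∫ τ in Set.Ioi (0 : ℝ), c * (1 + τ ^ 2)⁻¹ ≤ c * Real.pi := by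
  refine (setIntegral_le_integral (integrable_inv_one_add_sq.const_mul c)
    (Eventually.of_forall fun τ => by positivity)).trans (le_of_eq ?_)
  rw [integral_const_mul, integral_univ_inv_one_add_sq]

theorem norm_scalarReg_le_fresnelNorm {m δ : ℝ} (hδ : 0 < δ) (ψ : 𝓢(Mink, ℂ)) :
    ‖scalarReg m δ ψ‖ ≤ 2 * Real.pi * fresnelNorm ψ := by
  rw [scalarReg_eq hδ, norm_mul, norm_neg, Complex.norm_I, one_mul]
  refine (norm_integral_le_of_norm_le (integrable_fresnelBound (2 * fresnelNorm ψ)) ?_).trans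
    ((integral_fresnelBound_le (by have := fresnelNorm_nonneg ψ; positivity)).trans
      (le_of_eq (by ring)))
  filter_upwards [ae_restrict_mem measurableSet_Ioi] with τ hτ
  have hτ' : (0 : ℝ) < τ := hτ
  rw [norm_mul, norm_mul, norm_exp_I_mul, one_mul, Complex.norm_real,
    Real.norm_of_nonneg (Real.exp_pos _).le]
  refine (mul_le_of_le_one_left (norm_nonneg _) ?_).trans (norm_fresnel_le ψ hτ')
  rw [Real.exp_le_one_iff]
  have : 0 < δ * τ := by positivity
  linarith

/-- The limit `δ → 0⁺` of the scalar kernel exists, for all masses including `m = 0`. -/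
theorem tendsto_scalarReg (m : ℝ) (ψ : 𝓢(Mink, ℂ)) :
    Tendsto (fun δ => scalarReg m δ ψ) (𝓝[>] 0) (𝓝 (scalarLim m ψ)) := by
  have hcf := continuous_fresnel ψ
  have h : Tendsto (fun δ : ℝ => -Complex.I * ∫ τ in Set.Ioi (0 : ℝ), (Real.exp (-(δ * τ)) : ℂ) *
      (Complex.exp (Complex.I * (-(τ * m ^ 2) : ℝ)) * fresnel ψ τ)) (𝓝[>] 0)
      (𝓝 (scalarLim m ψ)) := by
    refine Tendsto.const_mul _ ?_
    refine tendsto_integral_filter_of_dominated_convergence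
      (fun τ => 2 * fresnelNorm ψ * (1 + τ ^ 2)⁻¹) ?_ ?_ (integrable_fresnelBound _) ?_
    · exact Eventually.of_forall fun δ => Continuous.aestronglyMeasurable (by fun_prop)
    · filter_upwards [self_mem_nhdsWithin] with δ hδ
      filter_upwards [ae_restrict_mem measurableSet_Ioi] with τ hτ
      have hτ' : (0 : ℝ) < τ := hτ
      have hδ' : (0 : ℝ) < δ := hδ
      rw [norm_mul, norm_mul, norm_exp_I_mul, one_mul, Complex.norm_real,
        Real.norm_of_nonneg (Real.exp_pos _).le]
      refine (mul_le_of_le_one_left (norm_nonneg _) ?_).trans (norm_fresnel_le ψ hτ')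
      rw [Real.exp_le_one_iff]
      have : 0 < δ * τ := by positivity
      linarith
    · refine Eventually.of_forall fun τ => ?_
      have hc : Continuous (fun δ : ℝ => (Real.exp (-(δ * τ)) : ℂ) *
        (Complex.exp (Complex.I * (-(τ * m ^ 2) : ℝ)) * fresnel ψ τ)) := by fun_prop
      simpa using (hc.tendsto 0).mono_left (nhdsWithin_le_nhds (s := Set.Ioi 0))
  refine h.congr' ?_
  filter_upwards [self_mem_nhdsWithin] with δ hδ
  exact (scalarReg_eq hδ ψ).symm

/-- `∫ ‖f‖` is bounded by finitely many Schwartz seminorms of `f`; the same holds after applying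
a continuous operator. -/
theorem exists_integral_norm_le (A : 𝓢(Mink, ℂ) →L[ℝ] 𝓢(Mink, ℂ)) :
    ∃ (K N : ℕ) (C : ℝ), 0 ≤ C ∧ ∀ ψ, ∫ p, ‖A ψ p‖ ≤
      C * ((Finset.Iic (K, N)).sup (schwartzSeminormFamily ℝ Mink ℂ)) ψ := by
  let T : 𝓢(Mink, ℂ) →L[ℝ] Lp ℂ 1 (volume : Measure Mink) :=
    (SchwartzMap.toLpCLM ℝ ℂ 1 volume).comp A
  let q : Seminorm ℝ 𝓢(Mink, ℂ) := (normSeminorm ℝ (Lp ℂ 1 (volume : Measure Mink))).comp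
    T.toLinearMap
  have hq : Continuous q := continuous_norm.comp T.continuous
  obtain ⟨s, C, -, hC⟩ := Seminorm.bound_of_continuous (schwartz_withSeminorms ℝ Mink ℂ) q hq
  refine ⟨(s.sup id).1, (s.sup id).2, C, C.2, fun ψ => ?_⟩
  have h1 : ∫ p, ‖A ψ p‖ = q ψ := by
    rw [← SchwartzMap.norm_toLp_one]; rfl
  rw [h1]
  refine (hC ψ).trans ?_
  rw [smul_apply]
  change (C : ℝ) * _ ≤ _
  gcongr
  refine Seminorm.le_def.mp (Finset.sup_mono fun i hi => ?_) ψ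
  rw [Finset.mem_Iic]
  exact Finset.le_sup (f := id) hi

/-- The regularised scalar kernels are equicontinuous on Schwartz functions, uniformly in the mass
and in the regularisation. -/
theorem exists_norm_scalarReg_le : ∃ (K N : ℕ) (C : ℝ), 0 ≤ C ∧ ∀ (m δ : ℝ), 0 < δ → ∀ ψ,
    ‖scalarReg m δ ψ‖ ≤
      C * ((Finset.Iic (K, N)).sup (schwartzSeminormFamily ℝ Mink ℂ)) ψ := by
  obtain ⟨K₁, N₁, C₁, h₁, H₁⟩ := exists_integral_norm_le (ContinuousLinearMap.id ℝ _)
  obtain ⟨K₂, N₂, C₂, h₂, H₂⟩ := exists_integral_norm_le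
    ((invF.symm : 𝓢(Mink, ℂ) →L[ℂ] 𝓢(Mink, ℂ)).restrictScalars ℝ)
  refine ⟨max K₁ K₂, max N₁ N₂, 2 * Real.pi * (C₁ + C₂), by positivity, fun m δ hδ ψ => ?_⟩
  refine (norm_scalarReg_le_fresnelNorm hδ ψ).trans ?_
  rw [mul_assoc (2 * Real.pi)]
  gcongr
  unfold fresnelNorm
  rw [add_mul]
  refine add_le_add ((H₁ ψ).trans ?_) ((H₂ ψ).trans ?_)
  · gcongr
    refine Seminorm.le_def.mp (Finset.sup_mono (Finset.Iic_subset_Iic.mpr ?_)) ψ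
    exact ⟨le_max_left _ _, le_max_left _ _⟩
  · gcongr
    refine Seminorm.le_def.mp (Finset.sup_mono (Finset.Iic_subset_Iic.mpr ?_)) ψ
    exact ⟨le_max_right _ _, le_max_right _ _⟩

theorem norm_scalarLim_invF_le (m : ℝ) (φ : 𝓢(Mink, ℂ)) {b : ℝ → ℝ}
    (hb : IntegrableOn b (Set.Ioi 0))
    (h : ∀ τ : ℝ, 0 < τ → (τ ^ 2)⁻¹ *
      ‖∫ x : Mink, Complex.exp (-Complex.I * (mdot x x / (4 * τ) : ℝ)) * φ x‖ ≤ b τ) :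
    ‖scalarLim m (invF φ)‖ ≤ ∫ τ in Set.Ioi (0 : ℝ), b τ := by
  rw [scalarLim, norm_mul, norm_neg, Complex.norm_I, one_mul]
  refine norm_integral_le_of_norm_le hb ?_
  filter_upwards [ae_restrict_mem measurableSet_Ioi] with τ hτ
  rw [norm_mul, norm_exp_I_mul, one_mul]
  exact (norm_fresnel_invF_le hτ φ).trans (h τ hτ)

/-! ### Non-stationary phase -/

/-- The derivative of the phase `(kx) - s(xx)/2` along `reflect n`. -/
def phaseSlope (n k : Mink) (s : ℝ) (x : Mink) : ℝ := inner ℝ n k - s * inner ℝ n x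

/-- The oscillatory factor `exp i((kx) - s(xx)/2)`. -/
def quadWave (k : Mink) (s : ℝ) (x : Mink) : ℂ :=
  Complex.exp (Complex.I * (mdot k x - s * mdot x x / 2 : ℝ))

theorem norm_quadWave (k : Mink) (s : ℝ) (x : Mink) : ‖quadWave k s x‖ = 1 := norm_exp_I_mul _

theorem contDiff_quadWave (k : Mink) (s : ℝ) : ContDiff ℝ ∞ (quadWave k s) := by
  have h : ContDiff ℝ ∞ (fun x : Mink => mdot k x - s * mdot x x / 2) := by fun_prop
  exact (contDiff_const.mul (Complex.ofRealCLM.contDiff.comp h)).cexp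

theorem contDiff_phaseSlope (n k : Mink) (s : ℝ) : ContDiff ℝ ∞ (phaseSlope n k s) := by
  exact contDiff_const.sub (contDiff_const.mul (contDiff_const.inner ℝ contDiff_id))

theorem fderiv_phaseSlope (n k v : Mink) (s : ℝ) (x : Mink) :
    fderiv ℝ (phaseSlope n k s) x v = -(s * inner ℝ n v) := by
  have h : HasFDerivAt (phaseSlope n k s) (-(s • innerSL ℝ n)) x := by
    unfold phaseSlope
    simpa using (((innerSL ℝ n).hasFDerivAt (x := x)).const_smul s).const_sub (inner ℝ n k)
  rw [h.fderiv]; simp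

theorem fderiv_quadWave (n k : Mink) (s : ℝ) (x : Mink) :
    fderiv ℝ (quadWave k s) x (reflect n) =
      Complex.I * (phaseSlope n k s x : ℂ) * quadWave k s x := by
  have h1 : HasFDerivAt (fun x : Mink => mdot k x - s * mdot x x / 2)
      (mdotL k - s • mdotL x) x := by
    have h2 : HasFDerivAt (fun x : Mink => mdotL x x) (mdotL x + mdotL.flip x) x := by
      simpa using (mdotL.hasFDerivAt (x := x)).clm_apply (hasFDerivAt_id x)
    have h3 := ((mdotL k).hasFDerivAt (x := x)).sub ((h2.const_mul s).mul_const (1 / 2 : ℝ))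
    simp only [mdotL_apply] at h3
    have h4 : HasFDerivAt (fun x : Mink => mdot k x - s * mdot x x / 2) _ x :=
      h3.congr_of_eventuallyEq (Eventually.of_forall fun y => by
        simp only [Pi.sub_apply, mdotL_apply]; ring)
    refine h4.congr_fderiv (ContinuousLinearMap.ext fun v => ?_)
    simp [mdotL_apply, mdot_comm v x]
    ring
  have h5 : HasFDerivAt (quadWave k s) _ x :=
    ((Complex.ofRealCLM.hasFDerivAt.comp x h1).const_mul Complex.I).cexp
  rw [h5.fderiv]
  simp only [smul_apply, ContinuousLinearMap.comp_apply, Function.comp,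
    Complex.ofRealCLM_apply, smul_eq_mul, sub_apply, mdotL_apply, mdot_reflect]
  rw [phaseSlope, quadWave, real_inner_comm k n, real_inner_comm x n]
  ring

/-- The weighted amplitude `ψ / ξ^j` with `ξ` the slope of the phase. -/
def slopeQuot (n k : Mink) (s : ℝ) (ψ : Mink → ℂ) (j : ℕ) (x : Mink) : ℂ :=
  ψ x * ((phaseSlope n k s x : ℂ) ^ j)⁻¹

section
variable {n k : Mink} {s c : ℝ} {ψ : Mink → ℂ}

theorem le_phaseSlope (hs : 0 ≤ s) (hk : c * ‖k‖ ≤ inner ℝ n k) {x : Mink}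
    (hx : inner ℝ n x ≤ -c) : c * (‖k‖ + s) ≤ phaseSlope n k s x := by
  unfold phaseSlope; nlinarith

theorem hasFDerivAt_slopeQuot (hc : 0 < c) (hψ : ContDiff ℝ ∞ ψ)
    (hsupp : ∀ x ∈ tsupport ψ, inner ℝ n x ≤ -c) (hs : 0 ≤ s)
    (hk : c * ‖k‖ ≤ inner ℝ n k) (hks : 0 < ‖k‖ + s) (j : ℕ) (x : Mink) :
    DifferentiableAt ℝ (slopeQuot n k s ψ j) x ∧ ∀ v, fderiv ℝ (slopeQuot n k s ψ j) x v =
      slopeQuot n k s (fun x => fderiv ℝ ψ x v) j x +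
        (j * s * inner ℝ n v : ℝ) * slopeQuot n k s ψ (j + 1) x := by
  by_cases hx : x ∈ tsupport ψ
  · have hξ : (phaseSlope n k s x : ℂ) ≠ 0 := by
      have := le_phaseSlope hs hk (hsupp x hx)
      have h2 : 0 < c * (‖k‖ + s) := by positivity
      exact_mod_cast (h2.trans_le this).ne'
    have h1 : HasFDerivAt (fun x => (phaseSlope n k s x : ℂ))
        (Complex.ofRealCLM.comp (fderiv ℝ (phaseSlope n k s) x)) x :=
      Complex.ofRealCLM.hasFDerivAt.comp x
        ((contDiff_phaseSlope n k s).differentiable (by simp) x).hasFDerivAt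
    have h2 := (hψ.differentiable (by simp) x).hasFDerivAt
    have h3 : HasFDerivAt (slopeQuot n k s ψ j) _ x :=
      h2.mul ((hasFDerivAt_inv (pow_ne_zero j hξ)).restrictScalars ℝ |>.comp x (h1.pow j))
    refine ⟨h3.differentiableAt, fun v => ?_⟩
    rw [h3.fderiv]
    simp [slopeQuot, fderiv_phaseSlope]
    rcases j with _ | j
    · simp
    · simp
      field_simp
      ring
  · have h0 : ψ =ᶠ[𝓝 x] 0 := notMem_tsupport_iff_eventuallyEq.mp hx
    have h1 : slopeQuot n k s ψ j =ᶠ[𝓝 x] 0 := by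
      filter_upwards [h0] with y hy
      simp [slopeQuot, hy]
    refine ⟨(differentiableAt_const 0).congr_of_eventuallyEq h1, fun v => ?_⟩
    rw [h1.fderiv_eq]
    simp [slopeQuot, h0.fderiv_eq, h0.eq_of_nhds]

theorem continuous_slopeQuot (hc : 0 < c) (hψ : ContDiff ℝ ∞ ψ)
    (hsupp : ∀ x ∈ tsupport ψ, inner ℝ n x ≤ -c) (hs : 0 ≤ s)
    (hk : c * ‖k‖ ≤ inner ℝ n k) (hks : 0 < ‖k‖ + s) (j : ℕ) :
    Continuous (slopeQuot n k s ψ j) :=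
  continuous_iff_continuousAt.mpr fun x =>
    (hasFDerivAt_slopeQuot hc hψ hsupp hs hk hks j x).1.continuousAt

theorem tsupport_fderiv_apply_subset (v : Mink) :
    tsupport (fun x => fderiv ℝ ψ x v) ⊆ tsupport ψ := by
  refine (closure_mono ?_).trans (tsupport_fderiv_subset ℝ (f := ψ))
  intro x hx
  rw [Function.mem_support] at hx ⊢
  contrapose! hx
  simp [hx]

theorem contDiff_fderiv_apply (hψ : ContDiff ℝ ∞ ψ) (v : Mink) :
    ContDiff ℝ ∞ (fun x => fderiv ℝ ψ x v) :=
  (hψ.fderiv_right (m := ∞) (by simp)).clm_apply contDiff_const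

theorem integrable_quadWave_mul_slopeQuot (hc : 0 < c) (hψ : ContDiff ℝ ∞ ψ)
    (hψc : HasCompactSupport ψ)
    (hsupp : ∀ x ∈ tsupport ψ, inner ℝ n x ≤ -c) (hs : 0 ≤ s)
    (hk : c * ‖k‖ ≤ inner ℝ n k) (hks : 0 < ‖k‖ + s) (j : ℕ) :
    Integrable (fun x => slopeQuot n k s ψ j x * quadWave k s x) :=
  ((continuous_slopeQuot hc hψ hsupp hs hk hks j).mul
    (contDiff_quadWave k s).continuous).integrable_of_hasCompactSupport
    (hψc.mul_right.mul_right)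

/-- One integration by parts along `reflect n`, from `∂ quadWave = i ξ quadWave` with `ξ` the slope.
The slope is affine, so differentiating `ξ⁻⁽ʲ⁺¹⁾` costs a factor `s` and gains another `ξ⁻¹`. -/
theorem integral_slopeQuot_eq (hc : 0 < c) (hψ : ContDiff ℝ ∞ ψ) (hψc : HasCompactSupport ψ)
    (hsupp : ∀ x ∈ tsupport ψ, inner ℝ n x ≤ -c) (hs : 0 ≤ s)
    (hk : c * ‖k‖ ≤ inner ℝ n k) (hks : 0 < ‖k‖ + s) (j : ℕ) :
    ∫ x, slopeQuot n k s ψ j x * quadWave k s x =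
      Complex.I * ((∫ x, slopeQuot n k s (fun x => fderiv ℝ ψ x (reflect n)) (j + 1) x *
          quadWave k s x) +
        ((j + 1 : ℕ) * s * inner ℝ n (reflect n) : ℝ) *
          ∫ x, slopeQuot n k s ψ (j + 2) x * quadWave k s x) := by
  have hψ' := contDiff_fderiv_apply hψ (reflect n)
  have hψc' : HasCompactSupport (fun x => fderiv ℝ ψ x (reflect n)) :=
    hψc.of_isClosed_subset (isClosed_tsupport _) (tsupport_fderiv_apply_subset _)
  have hsupp' : ∀ x ∈ tsupport (fun x => fderiv ℝ ψ x (reflect n)), inner ℝ n x ≤ -c :=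
    fun x hx => hsupp x (tsupport_fderiv_apply_subset _ hx)
  have i1 := integrable_quadWave_mul_slopeQuot hc hψ' hψc' hsupp' hs hk hks (j + 1)
  have i2 := integrable_quadWave_mul_slopeQuot hc hψ hψc hsupp hs hk hks (j + 2)
  have i0 := integrable_quadWave_mul_slopeQuot hc hψ hψc hsupp hs hk hks j
  have i3 := integrable_quadWave_mul_slopeQuot hc hψ hψc hsupp hs hk hks (j + 1)
  have eL : ∀ x, fderiv ℝ (slopeQuot n k s ψ (j + 1)) x (reflect n) * quadWave k s x =
      slopeQuot n k s (fun x => fderiv ℝ ψ x (reflect n)) (j + 1) x * quadWave k s x +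
      ((j + 1 : ℕ) * s * inner ℝ n (reflect n) : ℝ) *
        (slopeQuot n k s ψ (j + 2) x * quadWave k s x) := by
    intro x
    rw [(hasFDerivAt_slopeQuot hc hψ hsupp hs hk hks (j + 1) x).2 (reflect n)]
    ring
  have eR : ∀ x, slopeQuot n k s ψ (j + 1) x * fderiv ℝ (quadWave k s) x (reflect n) =
      Complex.I * (slopeQuot n k s ψ j x * quadWave k s x) := by
    intro x
    rw [fderiv_quadWave]
    by_cases hx : x ∈ tsupport ψ
    · have hξ : (phaseSlope n k s x : ℂ) ≠ 0 := by
        have := le_phaseSlope hs hk (hsupp x hx)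
        have h2 : 0 < c * (‖k‖ + s) := by positivity
        exact_mod_cast (h2.trans_le this).ne'
      simp only [slopeQuot]
      field_simp
      ring
    · have := image_eq_zero_of_notMem_tsupport hx
      simp [slopeQuot, this]
  have h := integral_mul_fderiv_eq_neg_fderiv_mul_of_integrable (μ := (volume : Measure Mink))
    (f := slopeQuot n k s ψ (j + 1)) (g := quadWave k s) (v := reflect n)
    (by simp only [eL]; exact i1.add (i2.const_mul _))
    (by simp only [eR]; exact i0.const_mul _) i3
    (fun x _ => (hasFDerivAt_slopeQuot hc hψ hsupp hs hk hks (j + 1) x).1)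
    (fun x _ => (contDiff_quadWave k s).differentiable (by simp) x)
  simp only [eL, eR] at h
  rw [integral_const_mul, integral_add i1 (i2.const_mul _), integral_const_mul] at h
  have hI : ∀ z w : ℂ, Complex.I * z = -w → z = Complex.I * w := by
    intro z w hzw
    have : Complex.I * (Complex.I * z) = Complex.I * (-w) := by rw [hzw]
    rw [← mul_assoc, Complex.I_mul_I] at this
    linear_combination -this
  exact hI _ _ h

end

/-- If the slope of the phase is at least `c(‖k‖ + s)` on the support of the amplitude, the
oscillatory integral decays faster than any power of `‖k‖ + s`. -/
theorem exists_norm_integral_slopeQuot_le {n : Mink} {c : ℝ} (hc : 0 < c) (N : ℕ) :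
    ∀ (ψ : Mink → ℂ) (j : ℕ), ContDiff ℝ ∞ ψ → HasCompactSupport ψ →
    (∀ x ∈ tsupport ψ, inner ℝ n x ≤ -c) →
    ∃ C : ℝ, 0 ≤ C ∧ ∀ (k : Mink) (s : ℝ), 0 ≤ s → c * ‖k‖ ≤ inner ℝ n k → 0 < ‖k‖ + s →
      ‖∫ x, slopeQuot n k s ψ j x * quadWave k s x‖ ≤ C / (‖k‖ + s) ^ (j + N) := by
  induction N with
  | zero =>
    intro ψ j hψ hψc hsupp
    have hi : Integrable ψ := hψ.continuous.integrable_of_hasCompactSupport hψc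
    refine ⟨(c ^ j)⁻¹ * ∫ x, ‖ψ x‖, by positivity, fun k s hs hk hks => ?_⟩
    have e : (c ^ j)⁻¹ * (∫ x, ‖ψ x‖) / (‖k‖ + s) ^ (j + 0) =
        ∫ x, ((c * (‖k‖ + s)) ^ j)⁻¹ * ‖ψ x‖ := by
      rw [integral_const_mul, mul_pow, mul_inv, add_zero, div_eq_mul_inv]; ring
    rw [e]
    refine norm_integral_le_of_norm_le (hi.norm.const_mul _) (Eventually.of_forall fun x => ?_)
    rw [norm_mul, norm_quadWave, mul_one, slopeQuot, norm_mul, mul_comm]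
    by_cases hx : x ∈ tsupport ψ
    · gcongr
      have h1 := le_phaseSlope hs hk (hsupp x hx)
      have h2 : 0 < c * (‖k‖ + s) := by positivity
      rw [norm_inv, norm_pow, Complex.norm_real, Real.norm_of_nonneg (h2.le.trans h1)]
      gcongr
    · simp [image_eq_zero_of_notMem_tsupport hx]
  | succ N ih =>
    intro ψ j hψ hψc hsupp
    obtain ⟨C₁, hC₁, H₁⟩ := ih (fun x => fderiv ℝ ψ x (reflect n)) (j + 1)
      (contDiff_fderiv_apply hψ _)
      (hψc.of_isClosed_subset (isClosed_tsupport _) (tsupport_fderiv_apply_subset _))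
      (fun x hx => hsupp x (tsupport_fderiv_apply_subset _ hx))
    obtain ⟨C₂, hC₂, H₂⟩ := ih ψ (j + 2) hψ hψc hsupp
    refine ⟨C₁ + (j + 1) * |inner ℝ n (reflect n)| * C₂, by positivity,
      fun k s hs hk hks => ?_⟩
    rw [integral_slopeQuot_eq hc hψ hψc hsupp hs hk hks, norm_mul, Complex.norm_I, one_mul]
    refine (norm_add_le _ _).trans ?_
    rw [add_div]
    refine add_le_add ((H₁ k s hs hk hks).trans (le_of_eq (by congr 2; ring))) ?_
    rw [norm_mul, Complex.norm_real, Real.norm_eq_abs, abs_mul, abs_mul, abs_of_nonneg hs]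
    have hk0 := norm_nonneg k
    calc |((j + 1 : ℕ) : ℝ)| * s * |inner ℝ n (reflect n)| *
          ‖∫ x, slopeQuot n k s ψ (j + 2) x * quadWave k s x‖
        ≤ |((j + 1 : ℕ) : ℝ)| * (‖k‖ + s) * |inner ℝ n (reflect n)| *
          (C₂ / (‖k‖ + s) ^ (j + 2 + N)) := by
          gcongr
          · linarith
          · exact H₂ k s hs hk hks
      _ = _ := by
          rw [Nat.abs_cast]
          push_cast
          -- the factor `s` produced by the derivative of the slope uses up one of the two powers gained
          have e : (‖k‖ + s) ^ (j + 2 + N) = (‖k‖ + s) * (‖k‖ + s) ^ (j + (N + 1)) := by ring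
          rw [e]
          field_simp

/-- Rapid decrease of the Fourier transform of the localised scalar propagator in the momenta
`k` with `n·k ≥ c‖k‖`, for test functions supported where `n·x ≤ -c`. -/
theorem exists_norm_scalarLim_modulate_le {n : Mink} {c : ℝ} (hc : 0 < c) (m : ℝ)
    {φ : Mink → ℂ} (hφ : ContDiff ℝ ∞ φ) (hφc : HasCompactSupport φ)
    (hsupp : ∀ x ∈ tsupport φ, inner ℝ n x ≤ -c) (N : ℕ) :
    ∃ C : ℝ, 0 ≤ C ∧ ∀ (k : Mink) (φ' : 𝓢(Mink, ℂ)), (∀ x, φ' x = φ x * planeWave k x) →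
      c * ‖k‖ ≤ inner ℝ n k → 1 ≤ ‖k‖ → ‖scalarLim m (invF φ')‖ ≤ C / ‖k‖ ^ N := by
  obtain ⟨C, hC, H⟩ := exists_norm_integral_slopeQuot_le hc (N + 2) φ 0 hφ hφc hsupp
  refine ⟨4 * C * Real.pi, by positivity, fun k φ' hφ' hk hk1 => ?_⟩
  have hk0 : 0 < ‖k‖ := by linarith
  have hb := integrable_fresnelBound (4 * C / ‖k‖ ^ N)
  refine (norm_scalarLim_invF_le m φ' hb fun τ hτ => ?_).trans
    ((integral_fresnelBound_le (by positivity)).trans (le_of_eq (by ring)))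
  have h := H k (1 / (2 * τ)) (by positivity) hk (by positivity)
  -- the proper time `τ` corresponds to the coefficient `s = 1/(2τ)` of the quadratic phase
  have e : ∀ x, Complex.exp (-Complex.I * (mdot x x / (4 * τ) : ℝ)) * φ' x =
      slopeQuot n k (1 / (2 * τ)) φ 0 x * quadWave k (1 / (2 * τ)) x := by
    intro x
    rw [hφ', slopeQuot, pow_zero, inv_one, mul_one, quadWave, planeWave, mul_left_comm,
      ← Complex.exp_add]
    congr 2
    push_cast
    field_simp
    ring
  simp only [e]
  -- two of the powers gained are kept to compensate `τ⁻²` near `τ = 0`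
  have h2 : ‖k‖ ^ N * (1 + 1 / (2 * τ)) ^ 2 ≤ (‖k‖ + 1 / (2 * τ)) ^ (0 + (N + 2)) := by
    rw [zero_add, pow_add]
    have : 0 < 1 / (2 * τ) := by positivity
    gcongr
    linarith
  calc (τ ^ 2)⁻¹ * ‖∫ x, slopeQuot n k (1 / (2 * τ)) φ 0 x * quadWave k (1 / (2 * τ)) x‖
      ≤ (τ ^ 2)⁻¹ * (C / (‖k‖ ^ N * (1 + 1 / (2 * τ)) ^ 2)) := by
        gcongr
        exact h.trans (div_le_div_of_nonneg_left hC (by positivity) h2)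
    _ = 4 * C / ‖k‖ ^ N * ((2 * τ + 1) ^ 2)⁻¹ := by field_simp; ring
    _ ≤ 4 * C / ‖k‖ ^ N * (1 + τ ^ 2)⁻¹ := by
        gcongr
        nlinarith

/-! ### Homogeneous symbol bounds and the smeared string kernels -/

/-- `a` is smooth away from the origin and its derivatives satisfy the bounds
`‖Dⁿa(p)‖ ≤ C n ‖p‖^(d-n)` of a homogeneous function of degree `d`. -/
structure HomBound (d : ℤ) (C : ℕ → ℝ) (a : Mink → ℂ) : Prop where
  contDiffOn : ContDiffOn ℝ ∞ a {0}ᶜ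
  nonneg : ∀ n, 0 ≤ C n
  bound : ∀ (n : ℕ) (p : Mink), p ≠ 0 → ‖iteratedFDeriv ℝ n a p‖ ≤ C n * ‖p‖ ^ (d - n)

theorem isOpen_compl_zero : IsOpen ({0}ᶜ : Set Mink) := isOpen_compl_singleton

theorem HomBound.add {d : ℤ} {C C' : ℕ → ℝ} {a b : Mink → ℂ} (ha : HomBound d C a)
    (hb : HomBound d C' b) : HomBound d (fun n => C n + C' n) (fun p => a p + b p) where
  contDiffOn := ha.contDiffOn.add hb.contDiffOn
  nonneg n := add_nonneg (ha.nonneg n) (hb.nonneg n)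
  bound n p hp := by
    have hp' : p ∈ ({0}ᶜ : Set Mink) := hp
    have h := iteratedFDerivWithin_add_apply
      ((ha.contDiffOn.contDiffWithinAt hp').of_le (m := n) (by exact_mod_cast le_top))
      ((hb.contDiffOn.contDiffWithinAt hp').of_le (m := n) (by exact_mod_cast le_top))
      isOpen_compl_zero.uniqueDiffOn hp'
    rw [iteratedFDerivWithin_of_isOpen n isOpen_compl_zero hp',
      iteratedFDerivWithin_of_isOpen n isOpen_compl_zero hp',
      iteratedFDerivWithin_of_isOpen n isOpen_compl_zero hp'] at h
    change iteratedFDeriv ℝ n (fun p => a p + b p) p = _ at h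
    rw [h, add_mul]
    exact (norm_add_le _ _).trans (add_le_add (ha.bound n p hp) (hb.bound n p hp))

/-- The constants of a product. -/
def mulConst (C C' : ℕ → ℝ) (n : ℕ) : ℝ :=
  2 ^ n * (∑ i ∈ Finset.range (n + 1), C i) * ∑ i ∈ Finset.range (n + 1), C' i

theorem le_sum_range {C : ℕ → ℝ} (hC : ∀ n, 0 ≤ C n) {i n : ℕ} (hi : i ≤ n) :
    C i ≤ ∑ i ∈ Finset.range (n + 1), C i :=
  Finset.single_le_sum (fun j _ => hC j) (Finset.mem_range.mpr (Nat.lt_succ_of_le hi))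

theorem HomBound.mul {d e : ℤ} {C C' : ℕ → ℝ} {a b : Mink → ℂ} (ha : HomBound d C a)
    (hb : HomBound e C' b) : HomBound (d + e) (mulConst C C') (fun p => a p * b p) where
  contDiffOn := ha.contDiffOn.mul hb.contDiffOn
  nonneg n := mul_nonneg (mul_nonneg (by positivity) (Finset.sum_nonneg fun i _ => ha.nonneg i))
    (Finset.sum_nonneg fun i _ => hb.nonneg i)
  bound n p hp := by
    refine norm_iteratedFDeriv_mul_le_weighted isOpen_compl_zero ha.contDiffOn hb.contDiffOn
      (Set.mem_compl_singleton_iff.mpr hp) (norm_pos_iff.mpr hp)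
      (Finset.sum_nonneg fun i _ => ha.nonneg i) d e n (fun i hi => ?_) (fun i hi => ?_)
    · refine (ha.bound i p hp).trans ?_
      gcongr
      exact le_sum_range ha.nonneg hi
    · refine (hb.bound i p hp).trans ?_
      gcongr
      exact le_sum_range hb.nonneg hi

theorem HomBound.mono {d : ℤ} {C C' : ℕ → ℝ} {a : Mink → ℂ} (ha : HomBound d C a)
    (h : ∀ n, C n ≤ C' n) : HomBound d C' a where
  contDiffOn := ha.contDiffOn
  nonneg n := (ha.nonneg n).trans (h n)
  bound n p hp := (ha.bound n p hp).trans (by gcongr; exact h n)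

theorem homBound_const (c : ℂ) : ∃ C, HomBound 0 C (fun _ => c) := by
  refine ⟨fun _ => ‖c‖, contDiffOn_const, fun _ => norm_nonneg _, fun n p hp => ?_⟩
  rcases n with _ | n
  · simp
  · rw [iteratedFDeriv_const_of_ne (by simp)]
    simp only [Pi.zero_apply, norm_zero]
    positivity

theorem iteratedFDeriv_clm_two_add (L : Mink →L[ℝ] ℂ) (n : ℕ) :
    iteratedFDeriv ℝ (n + 2) L = 0 := by
  ext p m
  rw [iteratedFDeriv_succ_apply_right]
  have : (fun y => fderiv ℝ L y) = fun _ => L := by ext1 y; exact L.fderiv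
  rw [this, iteratedFDeriv_const_of_ne (by simp)]
  simp

theorem homBound_linear (L : Mink →L[ℝ] ℂ) : ∃ C, HomBound 1 C L := by
  refine ⟨fun _ => ‖L‖, L.contDiff.contDiffOn, fun _ => norm_nonneg _, fun n p hp => ?_⟩
  match n with
  | 0 => simpa using L.le_opNorm p
  | 1 => simp [norm_iteratedFDeriv_one]
  | n + 2 =>
    rw [iteratedFDeriv_clm_two_add]
    simp only [Pi.zero_apply, norm_zero]
    positivity

/-- A family of symbols of degree `d`, with bounds uniform in the regularisation parameters and
converging to `A₀` linearly in them, at the expense of one power of `‖p‖`. -/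
def IsSymbolFamily (d : ℤ) (A : ℝ → ℝ → Mink → ℂ) (A₀ : Mink → ℂ) : Prop :=
  ∃ C : ℕ → ℝ, HomBound d C A₀ ∧ ∀ ε ε' : ℝ, 0 < ε → 0 < ε' →
    HomBound d C (A ε ε') ∧
      HomBound (d - 1) (fun n => (ε + ε') * C n) (fun p => A ε ε' p - A₀ p)

theorem IsSymbolFamily.add {d : ℤ} {A B : ℝ → ℝ → Mink → ℂ} {A₀ B₀ : Mink → ℂ}
    (hA : IsSymbolFamily d A A₀) (hB : IsSymbolFamily d B B₀) :
    IsSymbolFamily d (fun ε ε' p => A ε ε' p + B ε ε' p) (fun p => A₀ p + B₀ p) := by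
  obtain ⟨C, h0, h⟩ := hA
  obtain ⟨C', h0', h'⟩ := hB
  refine ⟨fun n => C n + C' n, h0.add h0', fun ε ε' hε hε' => ⟨(h ε ε' hε hε').1.add
    (h' ε ε' hε hε').1, ?_⟩⟩
  have := (h ε ε' hε hε').2.add (h' ε ε' hε hε').2
  convert this using 2
  · ring
  · ring

theorem IsSymbolFamily.mul {d e : ℤ} {A B : ℝ → ℝ → Mink → ℂ} {A₀ B₀ : Mink → ℂ}
    (hA : IsSymbolFamily d A A₀) (hB : IsSymbolFamily e B B₀) :
    IsSymbolFamily (d + e) (fun ε ε' p => A ε ε' p * B ε ε' p) (fun p => A₀ p * B₀ p) := by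
  obtain ⟨C, h0, h⟩ := hA
  obtain ⟨C', h0', h'⟩ := hB
  have hm := h0.mul h0'
  refine ⟨fun n => mulConst C C' n + mulConst C C' n, hm.mono fun n => ?_, fun ε ε' hε hε' =>
    ⟨((h ε ε' hε hε').1.mul (h' ε ε' hε hε').1).mono fun n => ?_, ?_⟩⟩
  · linarith [hm.nonneg n]
  · linarith [hm.nonneg n]
  · have h1 := (h ε ε' hε hε').2.mul (h' ε ε' hε hε').1
    have h2 := h0.mul (h' ε ε' hε hε').2
    rw [show d - 1 + e = d + e - 1 by ring] at h1
    rw [show d + (e - 1) = d + e - 1 by ring] at h2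
    convert h1.add h2 using 2
    · simp only [mulConst, ← Finset.mul_sum]; ring
    · ring

theorem isSymbolFamily_of_homBound {d : ℤ} {C : ℕ → ℝ} {a : Mink → ℂ} (ha : HomBound d C a) :
    IsSymbolFamily d (fun _ _ => a) a := by
  refine ⟨C, ha, fun ε ε' hε hε' => ⟨ha, ?_, ?_, ?_⟩⟩
  · simp only [sub_self]; exact contDiffOn_const
  · exact fun n => mul_nonneg (by positivity) (ha.nonneg n)
  · intro n p hp
    simp only [sub_self]
    have : iteratedFDeriv ℝ n (fun _ : Mink => (0 : ℂ)) = 0 := iteratedFDeriv_fun_zero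
    rw [this]
    have := ha.nonneg n
    simp only [Pi.zero_apply, norm_zero]
    positivity

/-- `∫₀^∞ w(t) F(tp) dt`, a Mellin-type superposition of dilations of `F`. -/
def rayIntegral (w : ℝ → ℂ) (F : 𝓢(Mink, ℂ)) (p : Mink) : ℂ :=
  ∫ t in Set.Ioi (0 : ℝ), w t * F (t • p)

theorem integrable_inv_one_add_mul_sq {ρ : ℝ} (hρ : 0 < ρ) :
    Integrable (fun t : ℝ => (1 + (t * ρ) ^ 2)⁻¹) :=
  integrable_inv_one_add_sq.comp_mul_right' hρ.ne'

theorem integral_inv_one_add_mul_sq_le {ρ : ℝ} (hρ : 0 < ρ) :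
    ∫ t in Set.Ioi (0 : ℝ), (1 + (t * ρ) ^ 2)⁻¹ ≤ Real.pi * ρ⁻¹ := by
  refine (setIntegral_le_integral (integrable_inv_one_add_mul_sq hρ)
    (Eventually.of_forall fun τ => by positivity)).trans (le_of_eq ?_)
  rw [Measure.integral_comp_mul_right (fun t : ℝ => (1 + t ^ 2)⁻¹) ρ,
    integral_univ_inv_one_add_sq, abs_of_pos (inv_pos.mpr hρ), smul_eq_mul, mul_comm]

theorem iteratedFDeriv_ray (z : ℂ) (F : 𝓢(Mink, ℂ)) (t : ℝ) (r : ℕ) (p : Mink) :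
    iteratedFDeriv ℝ r (fun p => z * F (t • p)) p = z • t ^ r • iteratedFDeriv ℝ r F (t • p) := by
  have h1 : ContDiff ℝ r (fun p => F (t • p)) :=
    (F.smooth r).comp (contDiff_const_smul t)
  have h2 := iteratedFDeriv_const_smul_apply (𝕜 := ℝ) (a := z) (x := p) (i := r) h1.contDiffAt
  have h3 := iteratedFDeriv_comp_const_smul (𝕜 := ℝ) t (F.smooth r)
  change iteratedFDeriv ℝ r (z • fun p => F (t • p)) p = _
  rw [h2, h3]

/-- Superpositions of dilations with a weight of size `t ^ n` are symbols of degree `-(n+1)`. -/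
theorem exists_homBound_rayIntegral (F : 𝓢(Mink, ℂ)) (n : ℕ) : ∃ C : ℕ → ℝ, ∀ (w : ℝ → ℂ) (K : ℝ),
    0 ≤ K → Measurable w → (∀ t, 0 < t → ‖w t‖ ≤ K * t ^ n) →
    HomBound (-(n + 1)) (fun r => K * C r) (rayIntegral w F) := by
  set S : ℕ → ℝ := fun r => 2 ^ (n + r + 2) *
    ((Finset.Iic (n + r + 2, r)).sup (schwartzSeminormFamily ℝ Mink ℂ)) F with hS
  have hS0 : ∀ r, 0 ≤ S r := fun r => by positivity
  have hF : ∀ r x, (1 + ‖x‖) ^ (n + r + 2) * ‖iteratedFDeriv ℝ r F x‖ ≤ S r := fun r x =>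
    SchwartzMap.one_add_le_sup_seminorm_apply (𝕜 := ℝ) (m := (n + r + 2, r)) le_rfl le_rfl F x
  refine ⟨fun r => Real.pi * S r, fun w K hK hw hwK => ?_⟩
  have hb : ∀ (r : ℕ) (ρ : ℝ), 0 < ρ → ∀ t, 0 < t → ∀ y : Mink, ρ ≤ ‖y‖ →
      ‖iteratedFDeriv ℝ r (fun p => w t * F (t • p)) y‖ ≤
        K * S r * (ρ ^ (n + r))⁻¹ * (1 + (t * ρ) ^ 2)⁻¹ := by
    intro r ρ hρ t ht y hy
    rw [iteratedFDeriv_ray, norm_smul, norm_smul, norm_pow, Real.norm_of_nonneg ht.le]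
    have h1 : ‖iteratedFDeriv ℝ r F (t • y)‖ ≤ S r * ((1 + t * ρ) ^ (n + r + 2))⁻¹ := by
      rw [← div_eq_mul_inv, le_div_iff₀ (by positivity), mul_comm]
      refine le_trans ?_ (hF r (t • y))
      gcongr
      rw [norm_smul, Real.norm_of_nonneg ht.le]
      gcongr
    have h2 : t ^ (n + r) ≤ (ρ ^ (n + r))⁻¹ * (1 + t * ρ) ^ (n + r) := by
      rw [inv_mul_eq_div, le_div_iff₀ (by positivity), ← mul_pow]
      gcongr
      linarith
    calc ‖w t‖ * (t ^ r * ‖iteratedFDeriv ℝ r F (t • y)‖)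
        ≤ (K * t ^ n) * (t ^ r * (S r * ((1 + t * ρ) ^ (n + r + 2))⁻¹)) := by
          gcongr
          exact hwK t ht
      _ = K * S r * (t ^ (n + r) * ((1 + t * ρ) ^ (n + r + 2))⁻¹) := by ring
      _ ≤ K * S r * (((ρ ^ (n + r))⁻¹ * (1 + t * ρ) ^ (n + r)) *
            ((1 + t * ρ) ^ (n + r + 2))⁻¹) := by
          have := hS0 r
          gcongr
      _ = K * S r * (ρ ^ (n + r))⁻¹ * ((1 + t * ρ) ^ 2)⁻¹ := by
          rw [pow_add (1 + t * ρ) (n + r) 2, mul_inv]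
          have : (1 + t * ρ) ^ (n + r) ≠ 0 := by positivity
          field_simp
      _ ≤ _ := by
          have := hS0 r
          gcongr
          nlinarith [mul_pos ht hρ]
  -- near `p` the integrand is dominated by its bound at the radius `ρ = ‖p‖/2`
  have key := iteratedFDeriv_integral_eq_of_dominated (μ := volume.restrict (Set.Ioi (0 : ℝ)))
    (f := fun (t : ℝ) (p : Mink) => w t * F (t • p)) isOpen_compl_zero
    (fun t => contDiff_const.mul ((F.smooth ⊤).comp (contDiff_const_smul t)))
    (fun r x => by
      simp only [iteratedFDeriv_ray]
      refine hw.aestronglyMeasurable.smul (Continuous.aestronglyMeasurable ?_)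
      have : Continuous (iteratedFDeriv ℝ r F) :=
        (F.smooth ⊤).continuous_iteratedFDeriv (by exact_mod_cast le_top)
      fun_prop)
    (fun r p hp => by
      have hp0 : 0 < ‖p‖ := norm_pos_iff.mpr hp
      refine ⟨Metric.ball p (‖p‖ / 2), Metric.ball_mem_nhds p (by positivity),
        fun t => K * S r * ((‖p‖ / 2) ^ (n + r))⁻¹ * (1 + (t * (‖p‖ / 2)) ^ 2)⁻¹,
        ((integrable_inv_one_add_mul_sq (by positivity)).const_mul _).restrict, ?_⟩
      filter_upwards [ae_restrict_mem measurableSet_Ioi] with t ht y hy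
      refine hb r _ (by positivity) t ht y ?_
      have h1 : ‖p‖ ≤ ‖y‖ + ‖y - p‖ := by
        calc ‖p‖ = ‖y - (y - p)‖ := by rw [sub_sub_cancel]
          _ ≤ _ := norm_sub_le _ _
      rw [Metric.mem_ball, dist_eq_norm] at hy
      linarith)
  refine ⟨key.1, fun r => by have := hS0 r; positivity, fun r p hp => ?_⟩
  have hp0 : 0 < ‖p‖ := norm_pos_iff.mpr hp
  change ‖iteratedFDeriv ℝ r (fun p => ∫ t in Set.Ioi (0 : ℝ), w t * F (t • p)) p‖ ≤ _
  rw [key.2 r p hp]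
  refine (norm_integral_le_of_norm_le (((integrable_inv_one_add_mul_sq hp0).const_mul
    (K * S r * (‖p‖ ^ (n + r))⁻¹)).restrict) ?_).trans ?_
  · filter_upwards [ae_restrict_mem measurableSet_Ioi] with t ht
    exact hb r _ hp0 t ht p le_rfl
  · rw [integral_const_mul]
    refine (mul_le_mul_of_nonneg_left (integral_inv_one_add_mul_sq_le hp0)
      (by have := hS0 r; positivity)).trans (le_of_eq ?_)
    have e : ‖p‖ ^ (-((n : ℤ) + 1) - r) = (‖p‖ ^ (n + r))⁻¹ * ‖p‖⁻¹ := by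
      rw [← mul_inv, ← pow_succ, ← zpow_natCast, ← zpow_neg]
      congr 1
      push_cast; ring
    rw [e]; ring

theorem integrableOn_pow_mul_exp_neg_mul {r : ℂ} (hr : 0 < r.re) (n : ℕ) :
    IntegrableOn (fun t : ℝ => (t : ℂ) ^ n * Complex.exp (-r * t)) (Set.Ioi 0) := by
  have h := integrableOn_rpow_mul_exp_neg_mul_rpow (s := n) (p := 1) (b := r.re)
    (by have : (0 : ℝ) ≤ n := n.cast_nonneg
        linarith) one_pos hr
  refine Integrable.mono' h (by fun_prop) ?_
  filter_upwards [ae_restrict_mem measurableSet_Ioi] with t ht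
  have ht0 : (0 : ℝ) < t := ht
  rw [norm_mul, norm_pow, Complex.norm_real, Real.norm_of_nonneg ht0.le, Complex.norm_exp,
    Real.rpow_natCast, Real.rpow_one]
  simp

/-- The Gamma integral with a complex rate. -/
theorem integral_pow_mul_exp_neg_mul {r : ℂ} (hr : 0 < r.re) (n : ℕ) :
    ∫ t in Set.Ioi (0 : ℝ), (t : ℂ) ^ n * Complex.exp (-r * t) = n.factorial / r ^ (n + 1) := by
  have hr0 : r ≠ 0 := fun h => by simp [h] at hr
  induction n with
  | zero =>
    have := integral_exp_mul_complex_Ioi (a := -r) (by simpa using hr) 0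
    simpa [neg_div_neg_eq] using this
  | succ n ih =>
    have hd : ∀ t ∈ Set.Ioi (0 : ℝ), HasDerivAt
        (fun t : ℝ => -((t : ℂ) ^ (n + 1) * Complex.exp (-r * t)) / r)
        ((t : ℂ) ^ (n + 1) * Complex.exp (-r * t) -
          ((n + 1) / r) * ((t : ℂ) ^ n * Complex.exp (-r * t))) t := by
      intro t _
      have h1 : HasDerivAt (fun t : ℝ => (t : ℂ)) 1 t := Complex.ofRealCLM.hasDerivAt
      have h2 := ((h1.pow (n + 1)).mul ((h1.const_mul (-r)).cexp)).neg.div_const r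
      refine h2.congr_deriv ?_
      field_simp
      simp
      ring
    have hi := (integrableOn_pow_mul_exp_neg_mul hr (n + 1))
    have hi' := (integrableOn_pow_mul_exp_neg_mul hr n).const_mul ((n + 1) / r)
    have hlim : Tendsto (fun t : ℝ => -((t : ℂ) ^ (n + 1) * Complex.exp (-r * t)) / r) atTop
        (𝓝 0) := by
      rw [tendsto_zero_iff_norm_tendsto_zero]
      have h := (tendsto_rpow_mul_exp_neg_mul_atTop_nhds_zero (n + 1 : ℕ) r.re hr).div_const ‖r‖
      rw [zero_div] at h
      refine h.congr' ?_
      filter_upwards [eventually_gt_atTop 0] with t ht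
      rw [norm_div, norm_neg, norm_mul, norm_pow, Complex.norm_real, Real.norm_of_nonneg ht.le,
        Complex.norm_exp, Real.rpow_natCast]
      simp
    have h := integral_Ioi_of_hasDerivAt_of_tendsto
      (by apply Continuous.continuousWithinAt; fun_prop) hd (hi.sub hi') hlim
    rw [integral_sub hi hi', integral_const_mul, ih] at h
    have h3 : ∫ t in Set.Ioi (0 : ℝ), (t : ℂ) ^ (n + 1) * Complex.exp (-r * t) =
        (n + 1) / r * (n.factorial / r ^ (n + 1)) := by
      rw [← sub_eq_zero, h]; simp
    rw [h3, Nat.factorial_succ]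
    push_cast
    field_simp
    ring

/-- `(pe) - iε`. -/
def stringDenom (ε : ℝ) (p e : Mink) : ℂ := (mdot p e : ℂ) - Complex.I * ε

theorem stringDenom_ne_zero {ε : ℝ} (hε : 0 < ε) (p e : Mink) : stringDenom ε p e ≠ 0 := by
  intro h
  have := congrArg Complex.im h
  simp [stringDenom] at this
  exact hε.ne' this

theorem continuous_stringDenom (ε : ℝ) (p : Mink) : Continuous (stringDenom ε p) := by
  unfold stringDenom mdot; fun_prop

/-- Powers of `1/((pe) - iε)` as superpositions of plane waves in `e`. -/
theorem inv_stringDenom_pow {ε : ℝ} (hε : 0 < ε) (p e : Mink) (n : ℕ) :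
    (stringDenom ε p e ^ (n + 1))⁻¹ = (Complex.I ^ (n + 1) / n.factorial) *
      ∫ t in Set.Ioi (0 : ℝ), (t : ℂ) ^ n * Complex.exp (-(ε * t : ℝ)) * planeWave (-(t • p)) e := by
  set r : ℂ := Complex.I * stringDenom ε p e with hr
  have hre : r.re = ε := by simp [hr, stringDenom]
  have h := integral_pow_mul_exp_neg_mul (r := r) (by rw [hre]; exact hε) n
  have e1 : ∀ t : ℝ, (t : ℂ) ^ n * Complex.exp (-(ε * t : ℝ)) * planeWave (-(t • p)) e =
      (t : ℂ) ^ n * Complex.exp (-r * t) := by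
    intro t
    rw [planeWave, mdot_neg_left, mdot_smul_left, mul_assoc, ← Complex.exp_add]
    congr 2
    simp only [hr, stringDenom]
    push_cast
    ring_nf
    simp only [Complex.I_sq]
    ring
  simp_rw [e1]
  rw [h, hr]
  have h0 := stringDenom_ne_zero hε p e
  have hf : (n.factorial : ℂ) ≠ 0 := by exact_mod_cast n.factorial_ne_zero
  rw [mul_pow]
  have hI : (Complex.I : ℂ) ^ (n + 1) ≠ 0 := pow_ne_zero _ Complex.I_ne_zero
  field_simp

/-- The weight `t ^ n e^{-εt}` of the superposition. -/
def stringWeight (n : ℕ) (ε : ℝ) (t : ℝ) : ℂ := (t : ℂ) ^ n * Complex.exp (-(ε * t : ℝ))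

/-- `∫ c(e)/((pe) - iε)^(n+1) de` as an integral along the ray through `p` of the Fourier
transform of `c`. -/
theorem integral_div_stringDenom (c : 𝓢(Mink, ℂ)) {ε : ℝ} (hε : 0 < ε)
    (p : Mink) (n : ℕ) :
    ∫ e, c e / stringDenom ε p e ^ (n + 1) =
      (Complex.I ^ (n + 1) / n.factorial * ((2 * Real.pi : ℝ) ^ 4 : ℂ)) *
        rayIntegral (stringWeight n ε) (invF c) p := by
  have h1 : ∀ e, c e / stringDenom ε p e ^ (n + 1) = (Complex.I ^ (n + 1) / n.factorial) *
      ∫ t in Set.Ioi (0 : ℝ), c e * (stringWeight n ε t * planeWave (-(t • p)) e) := by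
    intro e
    rw [div_eq_mul_inv, inv_stringDenom_pow hε, integral_const_mul]
    simp only [stringWeight]
    ring
  simp_rw [h1]
  rw [integral_const_mul, integral_integral_swap, rayIntegral, mul_assoc,
    ← integral_const_mul ((2 * Real.pi : ℝ) ^ 4 : ℂ)]
  · refine congrArg _ (integral_congr_ae (Eventually.of_forall fun t => ?_))
    simp only
    rw [invF_apply, inverseFourier]
    have h2 := two_pi_ne_zero
    have h3 : ∀ e, c e * (stringWeight n ε t * planeWave (-(t • p)) e) =
        stringWeight n ε t * (planeWave (-(t • p)) e * c e) := fun e => by ring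
    simp_rw [h3]
    rw [integral_const_mul]
    field_simp
  · have hw : Integrable (stringWeight n ε) (volume.restrict (Set.Ioi 0)) := by
      have := integrableOn_pow_mul_exp_neg_mul (r := ε) (by simpa using hε) n
      refine this.congr (Eventually.of_forall fun t => ?_)
      simp [stringWeight]
    have hp := Integrable.mul_prod (c.integrable (μ := volume)) hw
    refine (hp.mul_bdd (c := 1) (g := fun z : Mink × ℝ => planeWave (-(z.2 • p)) z.1)
      ?_ (Eventually.of_forall fun z => ?_)).congr (Eventually.of_forall fun z => ?_)
    · refine Continuous.aestronglyMeasurable ?_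
      unfold planeWave mdot; fun_prop
    · simp [norm_planeWave]
    · simp only [Function.uncurry]; ring

theorem norm_stringWeight_le {n : ℕ} {ε t : ℝ} (hε : 0 ≤ ε) (ht : 0 < t) :
    ‖stringWeight n ε t‖ ≤ t ^ n := by
  rw [stringWeight, norm_mul, norm_pow, Complex.norm_real, Real.norm_of_nonneg ht.le,
    Complex.norm_exp]
  refine mul_le_of_le_one_right (by positivity) (Real.exp_le_one_iff.mpr ?_)
  simp; positivity

theorem norm_stringWeight_sub_le {n : ℕ} {ε t : ℝ} (hε : 0 ≤ ε) (ht : 0 < t) :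
    ‖stringWeight n ε t - stringWeight n 0 t‖ ≤ ε * t ^ (n + 1) := by
  have h : stringWeight n ε t - stringWeight n 0 t =
      (((t ^ n * (Real.exp (-(ε * t)) - 1) : ℝ)) : ℂ) := by
    simp [stringWeight]; ring
  rw [h, Complex.norm_real, Real.norm_eq_abs, abs_mul, abs_of_pos (pow_pos ht n), pow_succ]
  have h1 : |Real.exp (-(ε * t)) - 1| ≤ ε * t := by
    rw [abs_sub_comm, abs_of_nonneg]
    · linarith [Real.add_one_le_exp (-(ε * t))]
    · rw [sub_nonneg, Real.exp_le_one_iff]; nlinarith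
  nlinarith [pow_pos ht n]

theorem measurable_stringWeight (n : ℕ) (ε : ℝ) : Measurable (stringWeight n ε) := by
  unfold stringWeight; fun_prop

theorem integrable_weight_ray (F : 𝓢(Mink, ℂ)) {n : ℕ} {w : ℝ → ℂ} {p : Mink} (hp : p ≠ 0)
    (hw : Measurable w) (hb : ∀ t, 0 < t → ‖w t‖ ≤ t ^ n) :
    IntegrableOn (fun t => w t * F (t • p)) (Set.Ioi (0 : ℝ)) := by
  have hp0 : 0 < ‖p‖ := norm_pos_iff.mpr hp
  set S := 2 ^ (n + 2) *
    ((Finset.Iic (n + 2, 0)).sup (schwartzSeminormFamily ℝ Mink ℂ)) F with hS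
  have hS0 : 0 ≤ S := by positivity
  have hF : ∀ x, (1 + ‖x‖) ^ (n + 2) * ‖F x‖ ≤ S := fun x => by
    have := SchwartzMap.one_add_le_sup_seminorm_apply (𝕜 := ℝ) (m := (n + 2, 0)) le_rfl le_rfl F x
    rwa [norm_iteratedFDeriv_zero] at this
  refine Integrable.mono' (((integrable_inv_one_add_mul_sq hp0).const_mul
    ((‖p‖ ^ n)⁻¹ * S)).restrict) ?_ ?_
  · refine hw.aestronglyMeasurable.mul (Continuous.aestronglyMeasurable ?_)
    exact F.continuous.comp (by fun_prop)
  · filter_upwards [ae_restrict_mem measurableSet_Ioi] with t ht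
    have ht0 : (0 : ℝ) < t := ht
    have h1 := hF (t • p)
    rw [norm_smul, Real.norm_of_nonneg ht0.le, pow_add] at h1
    have h2 : (t * ‖p‖) ^ n ≤ (1 + t * ‖p‖) ^ n := by gcongr; linarith
    have h3 : 1 + (t * ‖p‖) ^ 2 ≤ (1 + t * ‖p‖) ^ 2 := by nlinarith [mul_pos ht0 hp0]
    rw [norm_mul, mul_assoc, inv_mul_eq_div, le_div_iff₀ (by positivity), ← div_eq_mul_inv,
      le_div_iff₀ (by positivity)]
    calc ‖w t‖ * ‖F (t • p)‖ * ‖p‖ ^ n * (1 + (t * ‖p‖) ^ 2)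
        ≤ t ^ n * ‖F (t • p)‖ * ‖p‖ ^ n * (1 + (t * ‖p‖) ^ 2) := by gcongr; exact hb t ht0
      _ = (t * ‖p‖) ^ n * (1 + (t * ‖p‖) ^ 2) * ‖F (t • p)‖ := by ring
      _ ≤ (1 + t * ‖p‖) ^ n * (1 + t * ‖p‖) ^ 2 * ‖F (t • p)‖ := by gcongr
      _ ≤ S := h1

theorem HomBound.const_mul {d : ℤ} {C : ℕ → ℝ} {a : Mink → ℂ} (ha : HomBound d C a) (z : ℂ) :
    HomBound d (fun n => ‖z‖ * C n) (fun p => z * a p) where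
  contDiffOn := contDiffOn_const.mul ha.contDiffOn
  nonneg n := mul_nonneg (norm_nonneg _) (ha.nonneg n)
  bound n p hp := by
    have h : ContDiffAt ℝ n a p := ((ha.contDiffOn.contDiffAt
      (isOpen_compl_zero.mem_nhds hp))).of_le (by exact_mod_cast le_top)
    have h2 := iteratedFDeriv_const_smul_apply (𝕜 := ℝ) (a := z) h
    change iteratedFDeriv ℝ n (fun p => z * a p) p = _ at h2
    rw [h2, norm_smul, mul_assoc]
    exact mul_le_mul_of_nonneg_left (ha.bound n p hp) (norm_nonneg _)

theorem HomBound.comp_neg {d : ℤ} {C : ℕ → ℝ} {a : Mink → ℂ} (ha : HomBound d C a) :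
    HomBound d C (fun p => a (-p)) where
  contDiffOn := ha.contDiffOn.comp contDiff_neg.contDiffOn (fun p hp => by simpa using hp)
  nonneg := ha.nonneg
  bound n p hp := by
    have h := (LinearIsometryEquiv.neg ℝ (E := Mink)).norm_iteratedFDeriv_comp_right (𝕜 := ℝ) a p n
    change ‖iteratedFDeriv ℝ n (fun p => a (-p)) p‖ = ‖iteratedFDeriv ℝ n a (-p)‖ at h
    rw [h]
    simpa using ha.bound n (-p) (neg_ne_zero.mpr hp)

theorem IsSymbolFamily.const_mul {d : ℤ} {A : ℝ → ℝ → Mink → ℂ} {A₀ : Mink → ℂ}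
    (hA : IsSymbolFamily d A A₀) (z : ℂ) :
    IsSymbolFamily d (fun ε ε' p => z * A ε ε' p) (fun p => z * A₀ p) := by
  obtain ⟨C, h0, h⟩ := hA
  refine ⟨fun n => ‖z‖ * C n, h0.const_mul z, fun ε ε' hε hε' =>
    ⟨(h ε ε' hε hε').1.const_mul z, ?_⟩⟩
  convert (h ε ε' hε hε').2.const_mul z using 2
  · ring
  · ring

theorem IsSymbolFamily.comp_neg_swap {d : ℤ} {A : ℝ → ℝ → Mink → ℂ} {A₀ : Mink → ℂ}
    (hA : IsSymbolFamily d A A₀) :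
    IsSymbolFamily d (fun ε ε' p => A ε' ε (-p)) (fun p => A₀ (-p)) := by
  obtain ⟨C, h0, h⟩ := hA
  refine ⟨C, h0.comp_neg, fun ε ε' hε hε' => ⟨(h ε' ε hε' hε).1.comp_neg, ?_⟩⟩
  convert (h ε' ε hε' hε).2.comp_neg using 2
  ring

theorem HomBound.congr {d : ℤ} {C : ℕ → ℝ} {a b : Mink → ℂ} (ha : HomBound d C a)
    (h : ∀ p, p ≠ 0 → a p = b p) : HomBound d C b where
  contDiffOn := ha.contDiffOn.congr fun p hp => (h p hp).symm
  nonneg := ha.nonneg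
  bound n p hp := by
    have : a =ᶠ[𝓝 p] b := by
      filter_upwards [isOpen_compl_zero.mem_nhds hp] with q hq using h q hq
    rw [← (this.iteratedFDeriv ℝ n).eq_of_nhds]
    exact ha.bound n p hp

theorem IsSymbolFamily.congr {d : ℤ} {A B : ℝ → ℝ → Mink → ℂ} {A₀ : Mink → ℂ}
    (hA : IsSymbolFamily d A A₀) (h : ∀ ε ε' p, 0 < ε → 0 < ε' → A ε ε' p = B ε ε' p) :
    IsSymbolFamily d B A₀ := by
  obtain ⟨C, h0, hC⟩ := hA
  refine ⟨C, h0, fun ε ε' hε hε' => ⟨(hC ε ε' hε hε').1.congr fun p _ => h ε ε' p hε hε',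
    (hC ε ε' hε hε').2.congr fun p _ => by rw [h ε ε' p hε hε']⟩⟩

theorem isSymbolFamily_rayIntegral (F : 𝓢(Mink, ℂ)) (n : ℕ) :
    IsSymbolFamily (-(n + 1)) (fun ε _ => rayIntegral (stringWeight n ε) F)
      (rayIntegral (stringWeight n 0) F) := by
  obtain ⟨C, hC⟩ := exists_homBound_rayIntegral F n
  obtain ⟨C', hC'⟩ := exists_homBound_rayIntegral F (n + 1)
  have hb : ∀ ε, 0 ≤ ε → HomBound (-(n + 1)) (fun r => 1 * C r)
      (rayIntegral (stringWeight n ε) F) := fun ε hε =>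
    hC _ 1 zero_le_one (measurable_stringWeight n ε) fun t ht => by
      rw [one_mul]; exact norm_stringWeight_le hε ht
  have h1 := hC' (fun _ => 0) 1 zero_le_one measurable_const (fun t ht => by
    simp only [norm_zero]; positivity)
  have hC0 : ∀ r, 0 ≤ C r := fun r => by simpa using (hb 0 le_rfl).nonneg r
  have hC0' : ∀ r, 0 ≤ C' r := fun r => by simpa using h1.nonneg r
  refine ⟨fun r => C r + C' r, (hb 0 le_rfl).mono fun r => by linarith [hC0' r],
    fun ε ε' hε hε' => ⟨(hb ε hε.le).mono fun r => by linarith [hC0' r], ?_⟩⟩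
  have h2 := hC' (fun t => stringWeight n ε t - stringWeight n 0 t) ε hε.le
    ((measurable_stringWeight n ε).sub (measurable_stringWeight n 0))
    (fun t ht => norm_stringWeight_sub_le hε.le ht)
  have h3 := h2.congr (b := fun p => rayIntegral (stringWeight n ε) F p -
      rayIntegral (stringWeight n 0) F p) fun p hp => by
    rw [rayIntegral, rayIntegral, rayIntegral, ← integral_sub
      (integrable_weight_ray F hp (measurable_stringWeight n ε)
        fun t ht => norm_stringWeight_le hε.le ht)
      (integrable_weight_ray F hp (measurable_stringWeight n 0)
        fun t ht => norm_stringWeight_le le_rfl ht)]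
    simp only [sub_mul]
  have h4 := h3.mono (C' := fun r => (ε + ε') * (C r + C' r)) fun r => by
    nlinarith [hC0 r, hC0' r, mul_nonneg hε.le (hC0 r), mul_nonneg hε'.le (hC0 r),
      mul_nonneg hε'.le (hC0' r)]
  convert h4 using 1
  push_cast
  ring

/-- Smearing powers of `1/((pe) - iε)` with a test function gives a symbol family. -/
theorem exists_isSymbolFamily_integral_div (c : 𝓢(Mink, ℂ)) (i : ℕ) : ∃ A₀,
    IsSymbolFamily (-i) (fun ε _ p => ∫ e, c e / stringDenom ε p e ^ i) A₀ := by
  rcases i with _ | n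
  · obtain ⟨C, hC⟩ := homBound_const (∫ e, c e)
    exact ⟨_, by simpa using isSymbolFamily_of_homBound hC⟩
  · refine ⟨_, ((isSymbolFamily_rayIntegral (invF c) n).const_mul
      (Complex.I ^ (n + 1) / n.factorial * ((2 * Real.pi : ℝ) ^ 4 : ℂ))).congr
      fun ε ε' p hε _ => (integral_div_stringDenom c hε p n).symm⟩

/-- `(pe') + iε'`. -/
def stringDenom' (ε' : ℝ) (p e' : Mink) : ℂ := (mdot p e' : ℂ) + Complex.I * ε'

theorem stringDenom'_eq (ε' : ℝ) (p e' : Mink) :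
    stringDenom' ε' p e' = -stringDenom ε' (-p) e' := by
  simp [stringDenom', stringDenom, mdot_neg_left, add_comm]

theorem stringDenom'_ne_zero {ε' : ℝ} (hε : 0 < ε') (p e' : Mink) : stringDenom' ε' p e' ≠ 0 := by
  rw [stringDenom'_eq]; exact neg_ne_zero.mpr (stringDenom_ne_zero hε _ _)

theorem continuous_stringDenom' (ε' : ℝ) (p : Mink) : Continuous (stringDenom' ε' p) := by
  unfold stringDenom' mdot; fun_prop

theorem exists_isSymbolFamily_integral_div' (c : 𝓢(Mink, ℂ)) (i : ℕ) : ∃ A₀,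
    IsSymbolFamily (-i) (fun _ ε' p => ∫ e, c e / stringDenom' ε' p e ^ i) A₀ := by
  obtain ⟨A₀, h⟩ := exists_isSymbolFamily_integral_div c i
  refine ⟨_, (h.comp_neg_swap.const_mul (((-1) ^ i)⁻¹)).congr fun ε ε' p _ _ => ?_⟩
  rw [← integral_const_mul]
  refine integral_congr_ae (Eventually.of_forall fun e => ?_)
  simp only
  rw [stringDenom'_eq, neg_pow, div_eq_mul_inv, div_eq_mul_inv, mul_inv]
  ring

/-- Finite sums of functions `a(p) g(e) g'(e') / (((pe) - iε)^i ((pe') + iε')^i')` with `a` of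
degree `i + i'`. -/
inductive IsStringFun : (ℝ → ℝ → Mink → Mink → Mink → ℂ) → Prop
  | term {i i' : ℕ} {a g g' : Mink → ℂ} {C : ℕ → ℝ} (ha : HomBound (i + i') C a)
      (hg : ContDiff ℝ ∞ g) (hg' : ContDiff ℝ ∞ g') :
      IsStringFun fun ε ε' p e e' =>
        a p * (g e / stringDenom ε p e ^ i) * (g' e' / stringDenom' ε' p e' ^ i')
  | add {F G : ℝ → ℝ → Mink → Mink → Mink → ℂ} : IsStringFun F → IsStringFun G →
      IsStringFun fun ε ε' p e e' => F ε ε' p e e' + G ε ε' p e e'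

theorem IsStringFun.congr {F G : ℝ → ℝ → Mink → Mink → Mink → ℂ} (hF : IsStringFun F)
    (h : ∀ ε ε' p e e', G ε ε' p e e' = F ε ε' p e e') : IsStringFun G := by
  have : G = F := by funext ε ε' p e e'; exact h ε ε' p e e'
  rwa [this]

theorem isStringFun_const (z : ℂ) : IsStringFun fun _ _ _ _ _ => z := by
  obtain ⟨C, hC⟩ := homBound_const z
  have := IsStringFun.term (i := 0) (i' := 0) (by simpa using hC)
    (contDiff_const (c := (1 : ℂ))) (contDiff_const (c := (1 : ℂ)))
  simpa using this

theorem IsStringFun.mul {F G : ℝ → ℝ → Mink → Mink → Mink → ℂ} (hF : IsStringFun F)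
    (hG : IsStringFun G) : IsStringFun fun ε ε' p e e' => F ε ε' p e e' * G ε ε' p e e' := by
  induction hF with
  | @term i i' a g g' C ha hg hg' =>
    induction hG with
    | @term j j' b h h' C' hb hh hh' =>
      have := IsStringFun.term (i := i + j) (i' := i' + j') (a := fun p => a p * b p)
        (C := mulConst C C')
        (by convert ha.mul hb using 1; push_cast; ring) (hg.mul hh) (hg'.mul hh')
      convert this using 6
      simp only [div_eq_mul_inv, pow_add, mul_inv]
      ring
    | add _ _ h1 h2 => simpa only [mul_add] using h1.add h2
  | add _ _ h1 h2 => simpa only [add_mul] using h1.add h2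

theorem IsStringFun.pow {F : ℝ → ℝ → Mink → Mink → Mink → ℂ} (hF : IsStringFun F) (n : ℕ) :
    IsStringFun fun ε ε' p e e' => F ε ε' p e e' ^ n := by
  induction n with
  | zero => simpa using isStringFun_const 1
  | succ n ih => simpa only [pow_succ] using ih.mul hF

theorem IsStringFun.sum {ι : Type*} (s : Finset ι) {F : ι → ℝ → ℝ → Mink → Mink → Mink → ℂ}
    (hF : ∀ i ∈ s, IsStringFun (F i)) :
    IsStringFun fun ε ε' p e e' => ∑ i ∈ s, F i ε ε' p e e' := by
  classical
  induction s using Finset.induction_on with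
  | empty => simpa using isStringFun_const 0
  | insert i s hi ih =>
    simp only [Finset.sum_insert hi]
    exact (hF i (Finset.mem_insert_self _ _)).add
      (ih fun j hj => hF j (Finset.mem_insert_of_mem hj))

theorem contDiff_ofReal_mdot_left (f : Mink) : ContDiff ℝ ∞ fun p => (mdot f p : ℂ) :=
  Complex.ofRealCLM.contDiff.comp (contDiff_mdot_right f)

theorem homBound_mdot (f : Mink) : ∃ C, HomBound 1 C fun p => (mdot f p : ℂ) := by
  obtain ⟨C, hC⟩ := homBound_linear (Complex.ofRealCLM.comp (mdotL f))
  exact ⟨C, hC.congr fun p _ => by simp [mdotL_apply]⟩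

/-- The factor `(fp) g(e) / ((pe) - iε)`. -/
theorem isStringFun_mdot_div (f : Mink) {g : Mink → ℂ} (hg : ContDiff ℝ ∞ g) :
    IsStringFun fun ε _ p e _ => (mdot f p : ℂ) * g e / stringDenom ε p e := by
  obtain ⟨C, hC⟩ := homBound_mdot f
  have := IsStringFun.term (i := 1) (i' := 0) (C := C) (by simpa using hC) hg
    (contDiff_const (c := (1 : ℂ)))
  simpa [mul_div_assoc] using this

/-- The factor `(fp) g(e') / ((pe') + iε')`. -/
theorem isStringFun_mdot_div' (f : Mink) {g : Mink → ℂ} (hg : ContDiff ℝ ∞ g) :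
    IsStringFun fun _ ε' p _ e' => (mdot f p : ℂ) * g e' / stringDenom' ε' p e' := by
  obtain ⟨C, hC⟩ := homBound_mdot f
  have := IsStringFun.term (i := 0) (i' := 1) (C := C) (by simpa using hC)
    (contDiff_const (c := (1 : ℂ))) hg
  simpa [mul_div_assoc] using this

theorem contDiff_ofReal_mdot_self : ContDiff ℝ ∞ fun e : Mink => (mdot e e : ℂ) := by
  have h : ContDiff ℝ ∞ fun e : Mink => mdot e e := by unfold mdot; fun_prop
  exact Complex.ofRealCLM.contDiff.comp h

theorem isStringFun_stringE_left (f : Mink) :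
    IsStringFun fun ε _ p e _ => stringE ε ε p e (-e) f f := by
  have h1 := isStringFun_mdot_div f (contDiff_ofReal_mdot_left f)
  have h2 := (isStringFun_mdot_div f contDiff_ofReal_mdot_self).mul
    (isStringFun_mdot_div f (contDiff_const (c := (1 : ℂ))))
  refine (((isStringFun_const (mdot f f : ℂ)).add ((isStringFun_const (-2)).mul h1)).add
    h2).congr fun ε _ p e _ => ?_
  have h3 : stringDenom ε p e = (mdot p e : ℂ) - Complex.I * ε := rfl
  have h4 : ((mdot p (-e) : ℝ) : ℂ) + Complex.I * ε = -stringDenom ε p e := by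
    rw [h3, mdot_neg_right]; push_cast; ring
  rw [stringE, h4, ← h3]
  simp only [mdot_neg_right, mdot_comm p f, mdot_comm e f, Complex.ofReal_neg,
    mul_neg, neg_mul, div_eq_mul_inv, mul_inv, inv_neg]
  ring

theorem isStringFun_stringE_right (f : Mink) :
    IsStringFun fun _ ε' p _ e' => stringE ε' ε' p (-e') e' f f := by
  have h1 := isStringFun_mdot_div' f (contDiff_ofReal_mdot_left f)
  have h2 := (isStringFun_mdot_div' f contDiff_ofReal_mdot_self).mul
    (isStringFun_mdot_div' f (contDiff_const (c := (1 : ℂ))))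
  refine (((isStringFun_const (mdot f f : ℂ)).add ((isStringFun_const (-2)).mul h1)).add
    h2).congr fun _ ε' p _ e' => ?_
  have h3 : stringDenom' ε' p e' = (mdot p e' : ℂ) + Complex.I * ε' := rfl
  have h4 : ((mdot p (-e') : ℝ) : ℂ) - Complex.I * ε' = -stringDenom' ε' p e' := by
    rw [h3, mdot_neg_right]; push_cast; ring
  rw [stringE, h4, ← h3]
  simp only [mdot_neg_left, mdot_comm p f, mdot_comm e' f, Complex.ofReal_neg,
    mul_neg, neg_mul, div_eq_mul_inv, mul_inv, inv_neg]
  ring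

theorem contDiff_ofReal_coord (i : Fin 4) : ContDiff ℝ ∞ fun e : Mink => ((e i : ℝ) : ℂ) :=
  Complex.ofRealCLM.contDiff.comp (by fun_prop)

theorem isStringFun_stringE (f f' : Mink) :
    IsStringFun fun ε ε' p e e' => stringE ε ε' p e e' f f' := by
  have h1 := isStringFun_mdot_div f (contDiff_ofReal_mdot_left f')
  have h2 := isStringFun_mdot_div' f' (contDiff_ofReal_mdot_left f)
  have h3 : ∀ i, IsStringFun fun ε ε' p e e' =>
      ((mdot f p : ℂ) * ((e i : ℝ) : ℂ) / stringDenom ε p e) *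
        ((mdot f' p : ℂ) * ((e' i : ℝ) : ℂ) / stringDenom' ε' p e') := fun i =>
    (isStringFun_mdot_div f (contDiff_ofReal_coord i)).mul
      (isStringFun_mdot_div' f' (contDiff_ofReal_coord i))
  have hm := isStringFun_const (-1)
  refine (((((((isStringFun_const (mdot f f' : ℂ)).add (hm.mul h1)).add (hm.mul h2)).add
    (h3 0)).add (hm.mul (h3 1))).add (hm.mul (h3 2))).add (hm.mul (h3 3))).congr
    fun ε ε' p e e' => ?_
  have h4 : (mdot p e : ℂ) - Complex.I * ε = stringDenom ε p e := rfl
  have h5 : (mdot p e' : ℂ) + Complex.I * ε' = stringDenom' ε' p e' := rfl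
  have h6 : (mdot e e' : ℂ) = e 0 * e' 0 - e 1 * e' 1 - e 2 * e' 2 - e 3 * e' 3 := by
    simp [mdot]
  rw [stringE, h4, h5, h6, mdot_comm p f', mdot_comm e f']
  simp only [div_eq_mul_inv, mul_inv]
  ring

theorem isStringFun_stringKernel (s : ℕ) (β : ℕ → ℂ) (f f' : Mink) :
    IsStringFun fun ε ε' p e e' => stringKernel s β f f' ε ε' p e e' := by
  unfold stringKernel
  exact (isStringFun_const _).mul (IsStringFun.sum _ fun n _ =>
    (((isStringFun_const (β n)).mul ((isStringFun_stringE_left f).pow n)).mul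
      ((isStringFun_stringE_right f').pow n)).mul ((isStringFun_stringE f f').pow (s - 2 * n)))

/-- Smearing in `e` and `e'` turns the string functions into symbol families of order zero. -/
theorem IsStringFun.smear {F : ℝ → ℝ → Mink → Mink → Mink → ℂ} (hF : IsStringFun F)
    {c : Mink → ℂ} (hc : ContDiff ℝ ∞ c) (hcc : HasCompactSupport c) :
    (∀ ε ε' p, 0 < ε → 0 < ε' → (∀ e, Integrable fun e' => c e * c e' * F ε ε' p e e') ∧
      Integrable fun e => ∫ e', c e * c e' * F ε ε' p e e') ∧
    ∃ A₀, IsSymbolFamily 0 (fun ε ε' p => ∫ e, ∫ e', c e * c e' * F ε ε' p e e') A₀ := by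
  induction hF with
  | @term i i' a g g' C ha hg hg' =>
    set b : 𝓢(Mink, ℂ) := (hcc.mul_right (f' := g)).toSchwartzMap (hc.mul hg)
    set b' : 𝓢(Mink, ℂ) := (hcc.mul_right (f' := g')).toSchwartzMap (hc.mul hg')
    have hb : ∀ e, b e = c e * g e := fun e => rfl
    have hb' : ∀ e, b' e = c e * g' e := fun e => rfl
    have e1 : ∀ ε ε' p e e',
        c e * c e' * (a p * (g e / stringDenom ε p e ^ i) * (g' e' / stringDenom' ε' p e' ^ i')) =
        a p * ((b e / stringDenom ε p e ^ i) * (b' e' / stringDenom' ε' p e' ^ i')) := by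
      intro ε ε' p e e'
      rw [hb, hb']; ring
    have i1 : ∀ ε p, 0 < ε → Integrable fun e => b e / stringDenom ε p e ^ i := fun ε p hε => by
      refine Continuous.integrable_of_hasCompactSupport ?_ ?_
      · exact b.continuous.div ((continuous_stringDenom ε p).pow i)
          fun e => pow_ne_zero _ (stringDenom_ne_zero hε p e)
      · simp only [div_eq_mul_inv]
        exact (hcc.mul_right (f' := g)).mul_right
    have i2 : ∀ ε p, 0 < ε → Integrable fun e => b' e / stringDenom' ε p e ^ i' := fun ε p hε => by
      refine Continuous.integrable_of_hasCompactSupport ?_ ?_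
      · exact b'.continuous.div ((continuous_stringDenom' ε p).pow i')
          fun e => pow_ne_zero _ (stringDenom'_ne_zero hε p e)
      · simp only [div_eq_mul_inv]
        exact (hcc.mul_right (f' := g')).mul_right
    -- the integrand factorises, so the double integral is a product of two single ones
    simp only [e1, integral_const_mul, integral_mul_const]
    refine ⟨fun ε ε' p hε hε' => ⟨fun e => ((i2 ε' p hε').const_mul _).const_mul _,
      ((i1 ε p hε).mul_const _).const_mul _⟩, ?_⟩
    obtain ⟨A, hA⟩ := exists_isSymbolFamily_integral_div b i
    obtain ⟨A', hA'⟩ := exists_isSymbolFamily_integral_div' b' i'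
    have h := (isSymbolFamily_of_homBound ha).mul (hA.mul hA')
    rw [show (i + i' + (-i + -i') : ℤ) = 0 by ring] at h
    exact ⟨_, h⟩
  | @add F G _ _ h1 h2 =>
    have e1 : ∀ ε ε' p, 0 < ε → 0 < ε' → ∀ e,
        ∫ e', c e * c e' * (F ε ε' p e e' + G ε ε' p e e') =
        (∫ e', c e * c e' * F ε ε' p e e') + ∫ e', c e * c e' * G ε ε' p e e' := by
      intro ε ε' p hε hε' e
      simp only [mul_add]
      exact integral_add ((h1.1 ε ε' p hε hε').1 e) ((h2.1 ε ε' p hε hε').1 e)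
    refine ⟨fun ε ε' p hε hε' => ⟨fun e => ?_, ?_⟩, ?_⟩
    · simp only [mul_add]
      exact ((h1.1 ε ε' p hε hε').1 e).add ((h2.1 ε ε' p hε hε').1 e)
    · simp only [e1 ε ε' p hε hε']
      exact (h1.1 ε ε' p hε hε').2.add (h2.1 ε ε' p hε hε').2
    · obtain ⟨A, hA⟩ := h1.2
      obtain ⟨B, hB⟩ := h2.2
      refine ⟨_, (hA.add hB).congr fun ε ε' p hε hε' => ?_⟩
      simp only [e1 ε ε' p hε hε']
      exact (integral_add (h1.1 ε ε' p hε hε').2 (h2.1 ε ε' p hε hε').2).symm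

/-- The smeared string kernels are a symbol family of order zero. -/
theorem exists_isSymbolFamily_smearedKernel (s : ℕ) (β : ℕ → ℂ) (f f' : Mink)
    (c : 𝓓(spacelike, ℂ)) : ∃ A₀, IsSymbolFamily 0 (smearedKernel s β f f' c) A₀ :=
  ((isStringFun_stringKernel s β f f').smear c.contDiff c.hasCompactSupport).2

/-! ### Existence of the propagators -/

theorem integrable_div_massShell {f : Mink → ℂ} (hf : Integrable f) (m : ℝ) {δ : ℝ} (hδ : 0 < δ) :
    Integrable (fun p => f p / massShell m δ p) := by
  simp only [div_eq_mul_inv]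
  refine hf.mul_bdd (c := δ⁻¹) ?_ (Eventually.of_forall fun p => ?_)
  · exact ((continuous_massShell m δ).inv₀ (massShell_ne_zero hδ)).aestronglyMeasurable
  · rw [norm_inv]
    exact inv_anti₀ hδ (le_norm_massShell p)

theorem scalarReg_add {δ : ℝ} (hδ : 0 < δ) (m : ℝ) (ψ χ : 𝓢(Mink, ℂ)) :
    scalarReg m δ (ψ + χ) = scalarReg m δ ψ + scalarReg m δ χ := by
  rw [scalarReg, scalarReg, scalarReg, ← integral_add
    (integrable_div_massShell ψ.integrable m hδ) (integrable_div_massShell χ.integrable m hδ)]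
  simp [add_div]

theorem scalarReg_smul (δ m : ℝ) (z : ℂ) (ψ : 𝓢(Mink, ℂ)) :
    scalarReg m δ (z • ψ) = z * scalarReg m δ ψ := by
  rw [scalarReg, scalarReg, ← integral_const_mul]
  simp [mul_div_assoc]

theorem scalarLim_add (m : ℝ) (ψ χ : 𝓢(Mink, ℂ)) :
    scalarLim m (ψ + χ) = scalarLim m ψ + scalarLim m χ := by
  refine tendsto_nhds_unique (tendsto_scalarReg m (ψ + χ)) ?_
  refine ((tendsto_scalarReg m ψ).add (tendsto_scalarReg m χ)).congr' ?_
  filter_upwards [self_mem_nhdsWithin] with δ hδ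
  exact (scalarReg_add hδ m ψ χ).symm

theorem scalarLim_smul (m : ℝ) (z : ℂ) (ψ : 𝓢(Mink, ℂ)) :
    scalarLim m (z • ψ) = z * scalarLim m ψ := by
  refine tendsto_nhds_unique (tendsto_scalarReg m (z • ψ)) ?_
  refine ((tendsto_scalarReg m ψ).const_mul z).congr fun δ => (scalarReg_smul δ m z ψ).symm

theorem exists_norm_scalarLim_le : ∃ (K N : ℕ) (C : ℝ), 0 ≤ C ∧ ∀ m ψ,
    ‖scalarLim m ψ‖ ≤ C * ((Finset.Iic (K, N)).sup (schwartzSeminormFamily ℝ Mink ℂ)) ψ := by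
  obtain ⟨K, N, C, hC, h⟩ := exists_norm_scalarReg_le
  refine ⟨K, N, C, hC, fun m ψ => ?_⟩
  refine le_of_tendsto (tendsto_scalarReg m ψ).norm ?_
  filter_upwards [self_mem_nhdsWithin] with δ hδ using h m δ hδ ψ

theorem sup_seminorm_eq (s : Finset (ℕ × ℕ)) (ψ : 𝓢(Mink, ℂ)) :
    (s.sup (schwartzSeminormFamily ℝ Mink ℂ)) ψ = (s.sup (schwartzSeminormFamily ℂ Mink ℂ)) ψ := by
  rw [Seminorm.finset_sup_apply, Seminorm.finset_sup_apply]
  rfl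

/-- The functional `ψ ↦ ∫ ψ(p)/(p² - m² + i0)`. -/
def scalarLimCLM (m : ℝ) : 𝓢(Mink, ℂ) →L[ℂ] ℂ :=
  SchwartzMap.mkCLMtoNormedSpace (scalarLim m) (scalarLim_add m) (scalarLim_smul m) (by
    obtain ⟨K, N, C, hC, h⟩ := exists_norm_scalarLim_le
    exact ⟨Finset.Iic (K, N), C, hC, fun ψ => sup_seminorm_eq _ ψ ▸ h m ψ⟩)

theorem scalarLimCLM_apply (m : ℝ) (ψ : 𝓢(Mink, ℂ)) : scalarLimCLM m ψ = scalarLim m ψ := rfl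

/-- `b` is smooth and its derivatives of order `n` are bounded by `B n`. -/
structure SmoothBound (B : ℕ → ℝ) (b : Mink → ℂ) : Prop where
  contDiff : ContDiff ℝ ∞ b
  bound : ∀ (n : ℕ) (p : Mink), ‖iteratedFDeriv ℝ n b p‖ ≤ B n

theorem SmoothBound.nonneg {B : ℕ → ℝ} {b : Mink → ℂ} (h : SmoothBound B b) (n : ℕ) : 0 ≤ B n :=
  (norm_nonneg _).trans (h.bound n 0)

theorem SmoothBound.hasTemperateGrowth {B : ℕ → ℝ} {b : Mink → ℂ} (h : SmoothBound B b) :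
    b.HasTemperateGrowth :=
  ⟨h.contDiff, fun n => ⟨0, B n, fun p => by simpa using h.bound n p⟩⟩

theorem exists_smoothBound_of_hasCompactSupport {b : Mink → ℂ} (hb : ContDiff ℝ ∞ b)
    (hc : HasCompactSupport b) : ∃ B, SmoothBound B b := by
  have h : ∀ n : ℕ, ∃ B, ∀ p, ‖iteratedFDeriv ℝ n b p‖ ≤ B := fun n =>
    (hb.continuous_iteratedFDeriv (by exact_mod_cast le_top)).bounded_above_of_compact_support
      (hc.iteratedFDeriv n)
  choose B hB using h
  exact ⟨B, hb, hB⟩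

/-- Cutting off a symbol of degree `d ≤ 0` near the origin gives a smooth function with bounded
derivatives. -/
theorem HomBound.smoothBound_mul {d : ℤ} {C B : ℕ → ℝ} {a κ : Mink → ℂ} {ρ : ℝ} (ha : HomBound d C a)
    (hd : d ≤ 0) (hκ : SmoothBound B κ) (hρ : 0 < ρ) (hz : ∀ p, ‖p‖ < ρ → κ p = 0) :
    SmoothBound (fun n => 2 ^ n * (∑ i ∈ Finset.range (n + 1), B i) *
      (∑ i ∈ Finset.range (n + 1), C i * ρ ^ (d - i))) (fun p => κ p * a p) := by
  have h0 : ∀ p : Mink, ‖p‖ < ρ → (fun p => κ p * a p) =ᶠ[𝓝 p] fun _ => 0 := by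
    intro p hp
    filter_upwards [(isOpen_lt continuous_norm continuous_const).mem_nhds hp] with q hq
    rw [hz q hq, zero_mul]
  have hne : ∀ p : Mink, ¬ ‖p‖ < ρ → p ∈ ({0}ᶜ : Set Mink) := by
    rintro p hp rfl
    exact hp (by simpa using hρ)
  refine ⟨contDiff_iff_contDiffAt.mpr fun p => ?_, fun n p => ?_⟩
  · by_cases hp : ‖p‖ < ρ
    · exact contDiffAt_const.congr_of_eventuallyEq (h0 p hp)
    · exact hκ.contDiff.contDiffAt.mul
        (ha.contDiffOn.contDiffAt (isOpen_compl_zero.mem_nhds (hne p hp)))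
  · have hB : ∀ i, 0 ≤ B i := hκ.nonneg
    have hC : ∀ i, 0 ≤ C i * ρ ^ (d - i) := fun i => mul_nonneg (ha.nonneg i) (by positivity)
    by_cases hp : ‖p‖ < ρ
    · rw [((h0 p hp).iteratedFDeriv ℝ n).eq_of_nhds, iteratedFDeriv_fun_zero]
      simp only [Pi.zero_apply, norm_zero]
      have := Finset.sum_nonneg fun i (_ : i ∈ Finset.range (n + 1)) => hB i
      have := Finset.sum_nonneg fun i (_ : i ∈ Finset.range (n + 1)) => hC i
      positivity
    · refine norm_iteratedFDeriv_mul_le_of_le isOpen_compl_zero hκ.contDiff.contDiffOn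
        ha.contDiffOn (hne p hp) (Finset.sum_nonneg fun i _ => hB i) n (fun i hi => ?_)
        fun i hi => ?_
      · exact (hκ.bound i p).trans (le_sum_range hB hi)
      · refine (ha.bound i p (hne p hp)).trans (le_trans ?_
          (le_sum_range (C := fun i => C i * ρ ^ (d - i)) hC hi))
        refine mul_le_mul_of_nonneg_left ?_ (ha.nonneg i)
        have hp' : ρ ≤ ‖p‖ := not_lt.mp hp
        have e : ∀ x : ℝ, 0 < x → x ^ (d - i) = (x ^ ((i : ℤ) - d).toNat)⁻¹ := by
          intro x hx
          rw [← zpow_natCast, ← zpow_neg]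
          congr 1
          omega
        rw [e _ hρ, e _ (hρ.trans_le hp')]
        gcongr

theorem sup_seminorm_le {K N : ℕ} {ψ : 𝓢(Mink, ℂ)} {A : ℝ} (hA : 0 ≤ A)
    (h : ∀ k ≤ K, ∀ n ≤ N, ∀ p, ‖p‖ ^ k * ‖iteratedFDeriv ℝ n ψ p‖ ≤ A) :
    ((Finset.Iic (K, N)).sup (schwartzSeminormFamily ℝ Mink ℂ)) ψ ≤ A := by
  refine Seminorm.finset_sup_apply_le hA fun i hi => ?_
  rw [Finset.mem_Iic] at hi
  exact SchwartzMap.seminorm_le_bound ℝ i.1 i.2 ψ hA (h i.1 hi.1 i.2 hi.2)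

theorem sup_seminorm_smulLeft_le {B : ℕ → ℝ} {b : Mink → ℂ} (hb : SmoothBound B b) (K N : ℕ)
    (ψ : 𝓢(Mink, ℂ)) :
    ((Finset.Iic (K, N)).sup (schwartzSeminormFamily ℝ Mink ℂ)) (SchwartzMap.smulLeftCLM ℂ b ψ) ≤
      (∑ i ∈ Finset.range (N + 1), B i) * (2 ^ (N + K) *
        ((Finset.Iic (K, N)).sup (schwartzSeminormFamily ℝ Mink ℂ)) ψ) := by
  have hS : 0 ≤ ∑ i ∈ Finset.range (N + 1), B i := Finset.sum_nonneg fun i _ => hb.nonneg i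
  refine sup_seminorm_le (by positivity) fun k hk n hn p => ?_
  have h := pow_mul_norm_iteratedFDeriv_mul_le hb.contDiff hS 0 N (fun n hn p => by
    rw [pow_zero, mul_one]
    exact (hb.bound n p).trans (le_sum_range hb.nonneg hn)) ψ K n hn p
  have e : (SchwartzMap.smulLeftCLM ℂ b ψ : Mink → ℂ) = fun y => b y * ψ y := by
    rw [SchwartzMap.smulLeftCLM_apply hb.hasTemperateGrowth]
    simp [smul_eq_mul]
  rw [e]
  refine le_trans ?_ h
  refine mul_le_mul_of_nonneg_right ?_ (norm_nonneg _)
  calc ‖p‖ ^ k ≤ (1 + ‖p‖) ^ k := by gcongr; linarith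
    _ ≤ (1 + ‖p‖) ^ K := by gcongr; linarith [norm_nonneg p]

/-- Joint continuity of the regularised functional in the symbol and in `δ`. -/
theorem tendsto_scalarReg_smulLeft {ι : Type*} {l : Filter ι} {δ η : ι → ℝ} {b : ι → Mink → ℂ}
    {b₀ : Mink → ℂ} {B B₀ : ℕ → ℝ} (m : ℝ) (hδ : Tendsto δ l (𝓝[>] 0)) (hη : Tendsto η l (𝓝 0))
    (hb₀ : SmoothBound B₀ b₀)
    (hb : ∀ᶠ t in l, SmoothBound (fun n => η t * B n) (fun p => b t p - b₀ p)) (ψ : 𝓢(Mink, ℂ)) :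
    Tendsto (fun t => scalarReg m (δ t) (SchwartzMap.smulLeftCLM ℂ (b t) ψ)) l
      (𝓝 (scalarLim m (SchwartzMap.smulLeftCLM ℂ b₀ ψ))) := by
  obtain ⟨K, N, C, hC, H⟩ := exists_norm_scalarReg_le
  have h1 := (tendsto_scalarReg m (SchwartzMap.smulLeftCLM ℂ b₀ ψ)).comp hδ
  set S := ((Finset.Iic (K, N)).sup (schwartzSeminormFamily ℝ Mink ℂ)) ψ
  have h2 : Tendsto (fun t => scalarReg m (δ t)
      (SchwartzMap.smulLeftCLM ℂ (fun p => b t p - b₀ p) ψ)) l (𝓝 0) := by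
    have h3 := hη.mul_const (C * ((∑ i ∈ Finset.range (N + 1), B i) * (2 ^ (N + K) * S)))
    rw [zero_mul] at h3
    refine squeeze_zero_norm' ?_ h3
    filter_upwards [hb, hδ self_mem_nhdsWithin] with t ht hδt
    refine (H m (δ t) hδt _).trans ?_
    have h4 := sup_seminorm_smulLeft_le ht K N ψ
    rw [← Finset.mul_sum] at h4
    refine (mul_le_mul_of_nonneg_left h4 hC).trans (le_of_eq ?_)
    ring
  have h5 := h1.add h2
  rw [add_zero] at h5
  refine h5.congr' ?_
  filter_upwards [hb, hδ self_mem_nhdsWithin] with t ht hδt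
  simp only [Function.comp]
  rw [← scalarReg_add hδt]
  congr 1
  ext p
  have e : (b t).HasTemperateGrowth := by
    have := hb₀.hasTemperateGrowth.add ht.hasTemperateGrowth
    convert this using 1
    funext p; simp
  rw [SchwartzMap.smulLeftCLM_apply_apply e, add_apply,
    SchwartzMap.smulLeftCLM_apply_apply hb₀.hasTemperateGrowth,
    SchwartzMap.smulLeftCLM_apply_apply ht.hasTemperateGrowth]
  simp only [smul_eq_mul]; ring

/-- Scaling of the regularised propagator. -/
theorem scalarReg_scale (m δ : ℝ) {r : ℝ} (hr : 0 < r) {f g : 𝓢(Mink, ℂ)}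
    (h : ∀ y, g y = f (r • y)) :
    scalarReg m δ f = (r : ℂ) ^ 2 * scalarReg (m / r) (δ / r ^ 2) g := by
  have h1 : ∀ y, f (r • y) / massShell m δ (r • y) =
      ((r : ℂ) ^ 2)⁻¹ * (g y / massShell (m / r) (δ / r ^ 2) y) := by
    intro y
    have hr' : (r : ℂ) ≠ 0 := by exact_mod_cast hr.ne'
    have : massShell m δ (r • y) = (r : ℂ) ^ 2 * massShell (m / r) (δ / r ^ 2) y := by
      simp only [massShell, mdot_smul_left, mdot_smul_right]
      push_cast
      field_simp
    rw [this, h, div_eq_mul_inv, div_eq_mul_inv, mul_inv]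
    ring
  have h2 := Measure.integral_comp_smul (volume : Measure Mink)
    (fun p => f p / massShell m δ p) r
  rw [finrank_euclideanSpace_fin, abs_of_pos (by positivity)] at h2
  simp only [h1, integral_const_mul] at h2
  have hr' : (r : ℂ) ≠ 0 := by exact_mod_cast hr.ne'
  rw [scalarReg, scalarReg]
  have h3 : ∫ p, f p / massShell m δ p = (r : ℂ) ^ 4 * (((r : ℂ) ^ 2)⁻¹ *
      ∫ y, g y / massShell (m / r) (δ / r ^ 2) y) := by
    rw [h2, Complex.real_smul]
    push_cast
    field_simp
  rw [h3]
  field_simp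

theorem HomBound.comp_smul {C : ℕ → ℝ} {a : Mink → ℂ} (ha : HomBound 0 C a) {r : ℝ} (hr : 0 < r) :
    HomBound 0 C (fun p => a (r • p)) where
  contDiffOn := ha.contDiffOn.comp (contDiff_const_smul r).contDiffOn fun p hp => by
    simpa [hr.ne'] using hp
  nonneg := ha.nonneg
  bound n p hp := by
    let g : Mink ≃L[ℝ] Mink := ContinuousLinearEquiv.smulLeft (Units.mk0 r hr.ne')
    have hg : ‖(g : Mink →L[ℝ] Mink)‖ ≤ r := ContinuousLinearMap.opNorm_le_bound _ hr.le fun x => by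
      change ‖r • x‖ ≤ _
      rw [norm_smul, Real.norm_of_nonneg hr.le]
    have h := g.iteratedFDerivWithin_comp_right a uniqueDiffOn_univ (x := p) (Set.mem_univ _) n
    rw [Set.preimage_univ, iteratedFDerivWithin_univ, iteratedFDerivWithin_univ] at h
    change iteratedFDeriv ℝ n (fun p => a (r • p)) p = (iteratedFDeriv ℝ n a (r • p)).compContinuousLinearMap
      (fun _ => (g : Mink →L[ℝ] Mink)) at h
    rw [h]
    have hp0 : 0 < ‖p‖ := norm_pos_iff.mpr hp
    have hrp : r • p ≠ 0 := smul_ne_zero hr.ne' hp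
    calc _ ≤ ‖iteratedFDeriv ℝ n a (r • p)‖ * ∏ _i : Fin n, ‖(g : Mink →L[ℝ] Mink)‖ :=
          ContinuousMultilinearMap.norm_compContinuousLinearMap_le _ _
      _ ≤ C n * ‖r • p‖ ^ (0 - n : ℤ) * r ^ n := by
          rw [Finset.prod_const, Finset.card_univ, Fintype.card_fin]
          have := ha.bound n _ hrp
          have := (norm_nonneg _).trans this
          gcongr
      _ = C n * ‖p‖ ^ (0 - n : ℤ) := by
          rw [norm_smul, Real.norm_of_nonneg hr.le, zero_sub, zpow_neg, zpow_neg, zpow_natCast,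
            zpow_natCast, mul_pow]
          field_simp

/-- A smooth cutoff equal to one on the unit ball and supported in the ball of radius two. -/
def cutoff (p : Mink) : ℂ :=
  (((⟨1, 2, one_pos, one_lt_two⟩ : ContDiffBump (0 : Mink)) p : ℝ) : ℂ)

theorem cutoff_eq_one {p : Mink} (hp : ‖p‖ ≤ 1) : cutoff p = 1 := by
  rw [cutoff, ContDiffBump.one_of_mem_closedBall _ (by simpa using hp), Complex.ofReal_one]

theorem cutoff_eq_zero {p : Mink} (hp : 2 ≤ ‖p‖) : cutoff p = 0 := by
  rw [cutoff, ContDiffBump.zero_of_le_dist _ (by simpa using hp), Complex.ofReal_zero]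

theorem norm_one_sub_cutoff_le_one (p : Mink) : ‖1 - cutoff p‖ ≤ 1 := by
  rw [cutoff, ← Complex.ofReal_one, ← Complex.ofReal_sub, Complex.norm_real,
    Real.norm_of_nonneg (sub_nonneg.mpr (ContDiffBump.le_one _))]
  linarith [ContDiffBump.nonneg (⟨1, 2, one_pos, one_lt_two⟩ : ContDiffBump (0 : Mink)) (x := p)]

theorem contDiff_cutoff : ContDiff ℝ ∞ cutoff :=
  Complex.ofRealCLM.contDiff.comp (ContDiffBump.contDiff _)

theorem hasCompactSupport_cutoff : HasCompactSupport cutoff :=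
  HasCompactSupport.intro (isCompact_closedBall (0 : Mink) 2) fun p hp => cutoff_eq_zero (by
    rw [Metric.mem_closedBall, dist_zero_right, not_le] at hp
    exact hp.le)

/-- The dyadic shell `χ(2ʲp) - χ(2ʲ⁺¹p)`, with `χ` the cutoff. -/
def shell (j : ℕ) (p : Mink) : ℂ := cutoff ((2 : ℝ) ^ j • p) - cutoff ((2 : ℝ) ^ (j + 1) • p)

theorem contDiff_shell (j : ℕ) : ContDiff ℝ ∞ (shell j) :=
  (contDiff_cutoff.comp (contDiff_const_smul _)).sub (contDiff_cutoff.comp (contDiff_const_smul _))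

theorem norm_two_pow_smul (j : ℕ) (p : Mink) : ‖(2 : ℝ) ^ j • p‖ = 2 ^ j * ‖p‖ := by
  rw [norm_smul, norm_pow, Real.norm_ofNat]

theorem shell_eq_zero {j : ℕ} {p : Mink} (hp : 2 ≤ 2 ^ j * ‖p‖) : shell j p = 0 := by
  rw [shell, cutoff_eq_zero, cutoff_eq_zero, sub_zero]
  · rw [norm_two_pow_smul, pow_succ]
    have : (0 : ℝ) ≤ 2 ^ j * ‖p‖ := by positivity
    linarith
  · rwa [norm_two_pow_smul]

theorem shell_eq_zero_of_lt {j : ℕ} {p : Mink} (hp : ‖p‖ < (2 ^ (j + 1))⁻¹) : shell j p = 0 := by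
  rw [← one_div, lt_div_iff₀ (by positivity), mul_comm] at hp
  rw [shell, cutoff_eq_one, cutoff_eq_one, sub_self]
  · rw [norm_two_pow_smul]; exact hp.le
  · rw [norm_two_pow_smul]
    rw [pow_succ] at hp
    have : (0 : ℝ) ≤ 2 ^ j * ‖p‖ := by positivity
    linarith

theorem shell_smul (j : ℕ) (p : Mink) : shell j (((2 : ℝ) ^ j)⁻¹ • p) = shell 0 p := by
  simp only [shell, pow_succ, pow_zero, one_mul, smul_smul, one_smul]
  have : (2 : ℝ) ^ j ≠ 0 := by positivity
  rw [mul_inv_cancel₀ this, one_smul, mul_comm ((2 : ℝ) ^ j) 2, mul_assoc, mul_inv_cancel₀ this,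
    mul_one]

theorem sum_shell (J : ℕ) (p : Mink) :
    ∑ j ∈ Finset.range J, shell j p = cutoff p - cutoff ((2 : ℝ) ^ J • p) := by
  simp only [shell]
  rw [Finset.sum_range_sub' (fun j => cutoff ((2 : ℝ) ^ j • p))]
  simp

theorem exists_smoothBound_shell (j : ℕ) : ∃ B, SmoothBound B (shell j) :=
  exists_smoothBound_of_hasCompactSupport (contDiff_shell j)
    (HasCompactSupport.intro (isCompact_closedBall (0 : Mink) 2) fun p hp => shell_eq_zero (by
      rw [Metric.mem_closedBall, dist_zero_right, not_le] at hp
      have : (1 : ℝ) ≤ 2 ^ j := one_le_pow₀ one_le_two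
      nlinarith [norm_nonneg p]))

theorem exists_smoothBound_one_sub_cutoff : ∃ B, SmoothBound B (fun p => 1 - cutoff p) := by
  obtain ⟨B, hB⟩ := exists_smoothBound_of_hasCompactSupport contDiff_cutoff hasCompactSupport_cutoff
  refine ⟨fun n => 1 + B n, contDiff_const.sub hB.contDiff, fun n p => ?_⟩
  have h := iteratedFDeriv_sub_apply (𝕜 := ℝ) (f := fun _ : Mink => (1 : ℂ)) (g := cutoff) (x := p)
    (i := n) contDiffAt_const (hB.contDiff.of_le (by exact_mod_cast le_top)).contDiffAt
  change iteratedFDeriv ℝ n (fun p => 1 - cutoff p) p = _ at h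
  rw [h]
  refine (norm_sub_le _ _).trans (add_le_add ?_ (hB.bound n p))
  rcases n with _ | n
  · simp
  · rw [iteratedFDeriv_const_of_ne (by simp)]
    simp

/-- Cutting off a symbol family of order zero near the origin gives bounded smooth functions which
converge together with all derivatives. -/
theorem IsSymbolFamily.exists_smoothBound {A : ℝ → ℝ → Mink → ℂ} {A₀ κ : Mink → ℂ} {B : ℕ → ℝ}
    {ρ : ℝ} (hA : IsSymbolFamily 0 A A₀) (hκ : SmoothBound B κ) (hρ : 0 < ρ)
    (hz : ∀ p, ‖p‖ < ρ → κ p = 0) :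
    ∃ B₀ B₁ : ℕ → ℝ, SmoothBound B₀ (fun p => κ p * A₀ p) ∧ ∀ ε ε' : ℝ, 0 < ε → 0 < ε' →
      SmoothBound (fun n => (ε + ε') * B₁ n) (fun p => κ p * A ε ε' p - κ p * A₀ p) := by
  obtain ⟨C, h0, h⟩ := hA
  refine ⟨_, fun n => 2 ^ n * (∑ i ∈ Finset.range (n + 1), B i) *
      (∑ i ∈ Finset.range (n + 1), C i * ρ ^ ((0 - 1 : ℤ) - i)), h0.smoothBound_mul le_rfl hκ hρ hz,
    fun ε ε' hε hε' => ?_⟩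
  have := (h ε ε' hε hε').2.smoothBound_mul (by norm_num) hκ hρ hz
  convert this using 2
  · simp only [mul_assoc, ← Finset.mul_sum]
    ring
  · ring

/-- Uniform bound on the contribution of a dyadic shell. The substitution `p = ry`, `r = 2⁻ʲ`, maps
the shell to the unit one and produces the factor `r⁴/r² = 4⁻ʲ`; it changes the mass to `m/r`, which
is why the bounds on the scalar kernel have to be uniform in the mass. -/
theorem exists_norm_scalarReg_shell_le : ∃ N : ℕ, ∀ C : ℕ → ℝ, (∀ n, 0 ≤ C n) → ∃ D : ℝ, 0 ≤ D ∧
    ∀ A : Mink → ℂ, HomBound 0 C A → ∀ (m δ : ℝ), 0 < δ → ∀ (j : ℕ) (ψ : 𝓢(Mink, ℂ)) (P : ℝ),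
      (∀ n ≤ N, ∀ p, ‖p‖ ≤ 2 → ‖iteratedFDeriv ℝ n ψ p‖ ≤ P) →
      ‖scalarReg m δ (SchwartzMap.smulLeftCLM ℂ (fun p => shell j p * A p) ψ)‖ ≤
        (1 / 4) ^ j * (D * P) := by
  obtain ⟨K, N, C₀, hC₀, H⟩ := exists_norm_scalarReg_le
  obtain ⟨B, hB⟩ := exists_smoothBound_shell 0
  refine ⟨N, fun C hC => ?_⟩
  set B' : ℕ → ℝ := fun n => 2 ^ n * (∑ i ∈ Finset.range (n + 1), B i) *
      (∑ i ∈ Finset.range (n + 1), C i * (1 / 2 : ℝ) ^ ((0 : ℤ) - i)) with hB'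
  have hB'0 : ∀ n, 0 ≤ B' n := fun n => mul_nonneg (mul_nonneg (by positivity)
    (Finset.sum_nonneg fun i _ => hB.nonneg i))
      (Finset.sum_nonneg fun i _ => mul_nonneg (hC i) (by positivity))
  set S := ∑ i ∈ Finset.range (N + 1), B' i with hS
  have hS0 : 0 ≤ S := Finset.sum_nonneg fun i _ => hB'0 i
  refine ⟨C₀ * (2 ^ K * (2 ^ N * S)), by positivity, fun A hA m δ hδ j ψ P hP => ?_⟩
  have hP0 : 0 ≤ P := (norm_nonneg _).trans (hP 0 (Nat.zero_le _) 0 (by simp))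
  set r : ℝ := ((2 : ℝ) ^ j)⁻¹ with hr
  have hr0 : 0 < r := by positivity
  have hr1 : r ≤ 1 := inv_le_one_of_one_le₀ (one_le_pow₀ one_le_two)
  have hb : SmoothBound B' (fun p => shell 0 p * A (r • p)) :=
    (hA.comp_smul hr0).smoothBound_mul le_rfl hB (ρ := 1 / 2) (by norm_num) fun p hp =>
      shell_eq_zero_of_lt (by simpa using hp)
  obtain ⟨Bj, hBj⟩ := exists_smoothBound_shell j
  have hbj := hA.smoothBound_mul le_rfl hBj (ρ := (2 ^ (j + 1))⁻¹) (by positivity)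
    fun p hp => shell_eq_zero_of_lt hp
  set ψr : 𝓢(Mink, ℂ) := SchwartzMap.compCLMOfContinuousLinearEquiv ℂ
    (ContinuousLinearEquiv.smulLeft (Units.mk0 r hr0.ne')) ψ with hψr
  have eψ : (ψr : Mink → ℂ) = fun y => ψ (r • y) := rfl
  have hs := scalarReg_scale m δ hr0 (f := SchwartzMap.smulLeftCLM ℂ (fun p => shell j p * A p) ψ)
    (g := SchwartzMap.smulLeftCLM ℂ (fun p => shell 0 p * A (r • p)) ψr) fun y => by
      rw [SchwartzMap.smulLeftCLM_apply_apply hb.hasTemperateGrowth,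
        SchwartzMap.smulLeftCLM_apply_apply hbj.hasTemperateGrowth, eψ, hr, shell_smul]
  have hr4 : r ^ 2 = (1 / 4) ^ j := by
    rw [hr, ← inv_pow, ← pow_mul, mul_comm, pow_mul]
    norm_num
  rw [hs, norm_mul, norm_pow, Complex.norm_real, Real.norm_of_nonneg hr0.le, hr4]
  refine mul_le_mul_of_nonneg_left ?_ (by positivity)
  refine (H _ _ (by positivity) _).trans ?_
  rw [mul_assoc]
  refine mul_le_mul_of_nonneg_left ?_ hC₀
  have eg : (SchwartzMap.smulLeftCLM ℂ (fun p => shell 0 p * A (r • p)) ψr : Mink → ℂ) =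
      fun y => (shell 0 y * A (r • y)) * ψr y := by
    rw [SchwartzMap.smulLeftCLM_apply hb.hasTemperateGrowth]
    simp [smul_eq_mul]
  refine sup_seminorm_le (by positivity) fun k hk n hn y => ?_
  rw [eg]
  by_cases hy : ‖y‖ ≤ 2
  · have h1 : ‖y‖ ^ k ≤ 2 ^ K :=
      (pow_le_pow_left₀ (norm_nonneg y) hy k).trans (pow_le_pow_right₀ one_le_two hk)
    have h2 := norm_iteratedFDeriv_mul_le_of_le isOpen_univ hb.contDiff.contDiffOn
      (ψr.smooth ⊤).contDiffOn (Set.mem_univ y) hS0 n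
      (fun i hi => (hb.bound i y).trans (le_sum_range hB'0 (hi.trans hn))) (B := P)
      (fun i hi => by
        rw [eψ, iteratedFDeriv_comp_const_smul r (ψ.smooth i), norm_smul, norm_pow,
          Real.norm_of_nonneg hr0.le]
        have h3 : ‖r • y‖ ≤ 2 := by
          rw [norm_smul, Real.norm_of_nonneg hr0.le]
          nlinarith [norm_nonneg y]
        have h4 := hP i (hi.trans hn) _ h3
        have h5 : r ^ i ≤ 1 := pow_le_one₀ hr0.le hr1
        nlinarith [norm_nonneg (iteratedFDeriv ℝ i ψ (r • y))])
    rw [mul_assoc]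
    refine mul_le_mul h1 (h2.trans ?_) (norm_nonneg _) (by positivity)
    have : (2 : ℝ) ^ n ≤ 2 ^ N := pow_le_pow_right₀ one_le_two hn
    gcongr
  · have h0 : (fun y => (shell 0 y * A (r • y)) * ψr y) =ᶠ[𝓝 y] fun _ => 0 := by
      filter_upwards [(isOpen_lt continuous_const continuous_norm).mem_nhds (not_le.mp hy)] with q hq
      have : (2 : ℝ) < ‖q‖ := hq
      rw [shell_eq_zero (by simpa using this.le), zero_mul, zero_mul]
    rw [(h0.iteratedFDeriv ℝ n).eq_of_nhds, iteratedFDeriv_fun_zero]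
    simp only [Pi.zero_apply, norm_zero, mul_zero]
    positivity

/-- The regularised integral with a symbol of order zero, as the sum of the contributions of the
region away from the origin and of the dyadic shells. -/
theorem integral_symbol_eq {C : ℕ → ℝ} {A : Mink → ℂ} (hA : HomBound 0 C A) (m : ℝ) {δ : ℝ}
    (hδ : 0 < δ) (ψ : 𝓢(Mink, ℂ))
    (hs : Summable fun j => scalarReg m δ
      (SchwartzMap.smulLeftCLM ℂ (fun p => shell j p * A p) ψ)) :
    ∫ p, A p / massShell m δ p * ψ p =
      scalarReg m δ (SchwartzMap.smulLeftCLM ℂ (fun p => (1 - cutoff p) * A p) ψ) +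
        ∑' j, scalarReg m δ (SchwartzMap.smulLeftCLM ℂ (fun p => shell j p * A p) ψ) := by
  obtain ⟨B, hB⟩ := exists_smoothBound_one_sub_cutoff
  have hb := hA.smoothBound_mul le_rfl hB one_pos fun p hp => by
    rw [cutoff_eq_one hp.le, sub_self]
  have hbj : ∀ j, ∃ B, SmoothBound B (fun p => shell j p * A p) := fun j => by
    obtain ⟨Bj, hBj⟩ := exists_smoothBound_shell j
    exact ⟨_, hA.smoothBound_mul le_rfl hBj (ρ := (2 ^ (j + 1))⁻¹) (by positivity)
      fun p hp => shell_eq_zero_of_lt hp⟩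
  refine tendsto_nhds_unique ?_ (hs.hasSum.tendsto_sum_nat.const_add _)
  -- the partial sums telescope to the cutoff `1 - χ(2ᴶp)`, which tends to one off the origin
  have e : ∀ J : ℕ, scalarReg m δ (SchwartzMap.smulLeftCLM ℂ (fun p => (1 - cutoff p) * A p) ψ) +
      ∑ j ∈ Finset.range J, scalarReg m δ
        (SchwartzMap.smulLeftCLM ℂ (fun p => shell j p * A p) ψ) =
      ∫ p, (1 - cutoff ((2 : ℝ) ^ J • p)) * (A p / massShell m δ p * ψ p) := by
    intro J
    simp only [scalarReg]
    rw [← integral_finsetSum, ← integral_add]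
    · refine integral_congr_ae (Eventually.of_forall fun p => ?_)
      simp only
      have e2 : ∀ j, (SchwartzMap.smulLeftCLM ℂ (fun p => shell j p * A p) ψ) p =
          shell j p * A p * ψ p := fun j => by
        obtain ⟨Bj, hBj⟩ := hbj j
        rw [SchwartzMap.smulLeftCLM_apply_apply hBj.hasTemperateGrowth, smul_eq_mul]
      simp only [e2]
      rw [SchwartzMap.smulLeftCLM_apply_apply hb.hasTemperateGrowth, smul_eq_mul]
      have e3 : ∑ j ∈ Finset.range J, shell j p * A p * ψ p / massShell m δ p =
          (∑ j ∈ Finset.range J, shell j p) * (A p * ψ p / massShell m δ p) := by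
        rw [Finset.sum_mul]
        exact Finset.sum_congr rfl fun j _ => by ring
      rw [e3, sum_shell]
      ring
    · exact integrable_div_massShell (SchwartzMap.integrable _) m hδ
    · exact integrable_finsetSum _ fun j _ =>
        integrable_div_massShell (SchwartzMap.integrable _) m hδ
    · exact fun j _ => integrable_div_massShell (SchwartzMap.integrable _) m hδ
  simp only [e]
  have hAm : AEStronglyMeasurable A volume := by
    have h1 : (volume : Measure Mink).restrict {0}ᶜ = volume :=
      Measure.restrict_eq_self_of_ae_mem (by
        filter_upwards [Measure.ae_ne (volume : Measure Mink) 0] with p hp using hp)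
    rw [← h1]
    exact hA.contDiffOn.continuousOn.aestronglyMeasurable isOpen_compl_zero.measurableSet
  have hms := ((continuous_massShell m δ).inv₀ (massShell_ne_zero hδ))
  refine tendsto_integral_of_dominated_convergence (fun p => C 0 * δ⁻¹ * ‖ψ p‖) (fun J => ?_)
    (ψ.integrable.norm.const_mul _) (fun J => ?_) ?_
  · refine AEStronglyMeasurable.mul ?_ (AEStronglyMeasurable.mul ?_ ψ.continuous.aestronglyMeasurable)
    · exact (continuous_const.sub (contDiff_cutoff.continuous.comp
        (continuous_const_smul _))).aestronglyMeasurable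
    · simp only [div_eq_mul_inv]
      exact hAm.mul hms.aestronglyMeasurable
  · filter_upwards [Measure.ae_ne (volume : Measure Mink) 0] with p hp
    rw [norm_mul, norm_mul, norm_div]
    have h1 : ‖A p‖ ≤ C 0 := by simpa using hA.bound 0 p hp
    have h2 : ‖massShell m δ p‖⁻¹ ≤ δ⁻¹ := inv_anti₀ hδ (le_norm_massShell p)
    have h3 := hA.nonneg 0
    calc _ ≤ 1 * (‖A p‖ / ‖massShell m δ p‖ * ‖ψ p‖) := by
          gcongr; exact norm_one_sub_cutoff_le_one _
      _ ≤ _ := by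
          rw [one_mul, div_eq_mul_inv]
          gcongr
  · filter_upwards [Measure.ae_ne (volume : Measure Mink) 0] with p hp
    have hp0 : 0 < ‖p‖ := norm_pos_iff.mpr hp
    refine tendsto_const_nhds.congr' ?_
    obtain ⟨J₀, hJ₀⟩ := pow_unbounded_of_one_lt (2 / ‖p‖) (one_lt_two (α := ℝ))
    filter_upwards [eventually_ge_atTop J₀] with J hJ
    rw [cutoff_eq_zero, sub_zero, one_mul]
    rw [norm_two_pow_smul]
    rw [div_lt_iff₀ hp0] at hJ₀
    refine hJ₀.le.trans ?_
    have : (2 : ℝ) ^ J₀ ≤ 2 ^ J := pow_le_pow_right₀ one_le_two hJ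
    gcongr

/-- `b` is a symbol of order `d`: a smooth function with `‖Dⁿb(p)‖ = O((1 + ‖p‖)^(d-n))`. -/
def IsSymbol (d : ℕ) (b : Mink → ℂ) : Prop :=
  ContDiff ℝ ∞ b ∧ ∀ n : ℕ, ∃ C : ℝ, ∀ p,
    ‖iteratedFDeriv ℝ n b p‖ ≤ C * (1 + ‖p‖) ^ ((d : ℤ) - n)

theorem IsSymbol.hasTemperateGrowth {d : ℕ} {b : Mink → ℂ} (h : IsSymbol d b) :
    b.HasTemperateGrowth := by
  refine ⟨h.1, fun n => ?_⟩
  obtain ⟨C, hC⟩ := h.2 n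
  refine ⟨d, |C|, fun p => (hC p).trans ?_⟩
  have h1 : (1 + ‖p‖) ^ ((d : ℤ) - n) ≤ (1 + ‖p‖) ^ d := by
    rw [← zpow_natCast]
    exact zpow_le_zpow_right₀ (by linarith [norm_nonneg p]) (by omega)
  have h2 := le_abs_self C
  gcongr

/-- The bounds of a symbol for finitely many derivatives with a common constant. -/
theorem IsSymbol.exists_bound {d : ℕ} {b : Mink → ℂ} (h : IsSymbol d b) (N : ℕ) :
    ∃ C, 0 ≤ C ∧ ∀ n ≤ N, ∀ p, ‖iteratedFDeriv ℝ n b p‖ ≤ C * (1 + ‖p‖) ^ ((d : ℤ) - n) := by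
  choose C hC using h.2
  have h0 : ∀ n, 0 ≤ |C n| := fun n => abs_nonneg _
  refine ⟨∑ i ∈ Finset.range (N + 1), |C i|, Finset.sum_nonneg fun i _ => h0 i,
    fun n hn p => (hC n p).trans ?_⟩
  gcongr
  exact (le_abs_self _).trans (le_sum_range (C := fun i => |C i|) h0 hn)

theorem IsSymbol.mono {d e : ℕ} {b : Mink → ℂ} (h : IsSymbol d b) (hde : d ≤ e) :
    IsSymbol e b := by
  refine ⟨h.1, fun n => ?_⟩
  obtain ⟨C, hC⟩ := h.2 n
  refine ⟨|C|, fun p => (hC p).trans ?_⟩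
  have h1 : (1 + ‖p‖) ^ ((d : ℤ) - n) ≤ (1 + ‖p‖) ^ ((e : ℤ) - n) :=
    zpow_le_zpow_right₀ (by linarith [norm_nonneg p]) (by omega)
  have h2 := le_abs_self C
  gcongr

theorem IsSymbol.add {d : ℕ} {a b : Mink → ℂ} (ha : IsSymbol d a) (hb : IsSymbol d b) :
    IsSymbol d (fun p => a p + b p) := by
  refine ⟨ha.1.add hb.1, fun n => ?_⟩
  obtain ⟨C, hC⟩ := ha.2 n
  obtain ⟨C', hC'⟩ := hb.2 n
  refine ⟨C + C', fun p => ?_⟩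
  have h := iteratedFDeriv_add_apply (𝕜 := ℝ) (f := a) (g := b) (x := p) (i := n)
    (ha.1.of_le (by exact_mod_cast le_top)).contDiffAt (hb.1.of_le (by exact_mod_cast le_top)).contDiffAt
  change iteratedFDeriv ℝ n (fun p => a p + b p) p = _ at h
  rw [h, add_mul]
  exact (norm_add_le _ _).trans (add_le_add (hC p) (hC' p))

theorem IsSymbol.mul {d e : ℕ} {a b : Mink → ℂ} (ha : IsSymbol d a) (hb : IsSymbol e b) :
    IsSymbol (d + e) (fun p => a p * b p) := by
  refine ⟨ha.1.mul hb.1, fun n => ?_⟩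
  obtain ⟨C, hC0, hC⟩ := ha.exists_bound n
  obtain ⟨C', hC0', hC'⟩ := hb.exists_bound n
  refine ⟨2 ^ n * C * C', fun p => ?_⟩
  have := norm_iteratedFDeriv_mul_le_weighted isOpen_univ ha.1.contDiffOn hb.1.contDiffOn
    (Set.mem_univ p) (ρ := 1 + ‖p‖) (by positivity) hC0 d e n (fun i hi => hC i hi p)
    (fun i hi => hC' i hi p)
  simpa using this

theorem isSymbol_const (z : ℂ) : IsSymbol 0 (fun _ => z) := by
  refine ⟨contDiff_const, fun n => ⟨‖z‖, fun p => ?_⟩⟩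
  rcases n with _ | n
  · simp
  · rw [iteratedFDeriv_const_of_ne (by simp)]
    simp only [Pi.zero_apply, norm_zero]
    positivity

theorem isSymbol_linear (L : Mink →L[ℝ] ℂ) : IsSymbol 1 L := by
  refine ⟨L.contDiff, fun n => ⟨‖L‖, fun p => ?_⟩⟩
  match n with
  | 0 =>
    simp only [norm_iteratedFDeriv_zero]
    refine (L.le_opNorm p).trans ?_
    simp only [Nat.cast_one, CharP.cast_eq_zero, sub_zero, zpow_one]
    gcongr
    linarith
  | 1 => simp [norm_iteratedFDeriv_one]
  | n + 2 =>
    rw [iteratedFDeriv_clm_two_add]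
    simp only [Pi.zero_apply, norm_zero]
    positivity

theorem isSymbol_coord (i : Fin 4) : IsSymbol 1 (fun p : Mink => ((p i : ℝ) : ℂ)) :=
  isSymbol_linear (Complex.ofRealCLM.comp (EuclideanSpace.proj i))

theorem exists_isSymbol_evalPoly (M : MvPolynomial (Fin 4) ℂ) : ∃ d, IsSymbol d (evalPoly M) := by
  induction M using MvPolynomial.induction_on with
  | C z =>
    refine ⟨0, ?_⟩
    have e : evalPoly (MvPolynomial.C z) = fun _ => z := by funext p; simp [evalPoly]
    exact e ▸ isSymbol_const z
  | add M N hM hN =>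
    obtain ⟨d, hd⟩ := hM
    obtain ⟨e, he⟩ := hN
    refine ⟨d + e, ?_⟩
    have := (hd.mono (Nat.le_add_right d e)).add (he.mono (Nat.le_add_left e d))
    have e' : evalPoly (M + N) = fun p => evalPoly M p + evalPoly N p := by
      funext p; simp [evalPoly]
    exact e' ▸ this
  | mul_X M i hM =>
    obtain ⟨d, hd⟩ := hM
    have e : evalPoly (M * MvPolynomial.X i) = fun p => evalPoly M p * ((p i : ℝ) : ℂ) := by
      funext p; simp [evalPoly]
    exact ⟨d + 1, e ▸ hd.mul (isSymbol_coord i)⟩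

/-- Cutting off a symbol of homogeneity zero near the origin gives a symbol of order zero. -/
theorem HomBound.isSymbol_one_sub_cutoff_mul {C : ℕ → ℝ} {a : Mink → ℂ} (ha : HomBound 0 C a) :
    IsSymbol 0 (fun p => (1 - cutoff p) * a p) := by
  obtain ⟨B, hB⟩ := exists_smoothBound_one_sub_cutoff
  have hb := ha.smoothBound_mul le_rfl hB one_pos fun p hp => by
    rw [cutoff_eq_one hp.le, sub_self]
  refine ⟨hb.contDiff, fun n => ?_⟩
  set B' := 2 ^ n * (∑ i ∈ Finset.range (n + 1), B i) *
    (∑ i ∈ Finset.range (n + 1), C i * 1 ^ ((0 : ℤ) - i)) with hB'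
  have hB'0 : 0 ≤ B' := hb.nonneg n
  have hC0 := ha.nonneg n
  refine ⟨3 ^ n * B' + 2 ^ n * C n, fun p => ?_⟩
  have e : ∀ x : ℝ, x ^ (((0 : ℕ) : ℤ) - n) = (x ^ n)⁻¹ := fun x => by
    rw [Nat.cast_zero, zero_sub, zpow_neg, zpow_natCast]
  rw [e, ← div_eq_mul_inv, le_div_iff₀ (by positivity)]
  by_cases hp : ‖p‖ ≤ 2
  · calc ‖iteratedFDeriv ℝ n (fun p => (1 - cutoff p) * a p) p‖ * (1 + ‖p‖) ^ n
        ≤ B' * 3 ^ n := by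
          gcongr
          · exact hb.bound n p
          · linarith
      _ ≤ _ := by nlinarith [mul_nonneg (pow_nonneg (zero_le_two (α := ℝ)) n) hC0]
  · have hp' : 2 < ‖p‖ := not_le.mp hp
    have h0 : (fun p => (1 - cutoff p) * a p) =ᶠ[𝓝 p] a := by
      filter_upwards [(isOpen_lt continuous_const continuous_norm).mem_nhds hp'] with q hq
      have : (2 : ℝ) < ‖q‖ := hq
      rw [cutoff_eq_zero this.le, sub_zero, one_mul]
    have hp0 : p ≠ 0 := norm_pos_iff.mp (by linarith)
    rw [(h0.iteratedFDeriv ℝ n).eq_of_nhds]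
    have h1 := ha.bound n p hp0
    rw [zero_sub, zpow_neg, zpow_natCast, ← div_eq_mul_inv, le_div_iff₀ (by positivity)] at h1
    calc ‖iteratedFDeriv ℝ n a p‖ * (1 + ‖p‖) ^ n
        ≤ ‖iteratedFDeriv ℝ n a p‖ * (2 * ‖p‖) ^ n := by gcongr; linarith
      _ = 2 ^ n * (‖iteratedFDeriv ℝ n a p‖ * ‖p‖ ^ n) := by rw [mul_pow]; ring
      _ ≤ 2 ^ n * C n := by gcongr
      _ ≤ _ := by nlinarith [mul_nonneg (pow_nonneg (zero_le_three (α := ℝ)) n) hB'0]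

/-- `u` is, up to a functional of the low frequencies, the scalar propagator of mass `m` multiplied
by `b` in momentum space. -/
def HasSymbol (m : ℝ) (b : Mink → ℂ) (u : 𝓢'(Mink, ℂ)) : Prop :=
  ∃ (N : ℕ) (D : ℝ), 0 ≤ D ∧ ∀ (φ : 𝓢(Mink, ℂ)) (P : ℝ),
    (∀ n ≤ N, ∀ p, ‖p‖ ≤ 2 → ‖iteratedFDeriv ℝ n (invF φ) p‖ ≤ P) →
    ‖u φ - scalarLim m (SchwartzMap.smulLeftCLM ℂ b (invF φ))‖ ≤ D * P

/-- The joint limit of the three regularisation parameters: each dyadic shell and the part away from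
the origin converge separately, and the sum over the shells is dominated by a geometric series. -/
theorem exists_limit_of_isSymbolFamily {A : ℝ → ℝ → Mink → ℂ} {A₀ : Mink → ℂ}
    (hA : IsSymbolFamily 0 A A₀) (m : ℝ) : ∃ u : 𝓢'(Mink, ℂ),
    IsFourierLimit (𝓝[>] (0 : ℝ) ×ˢ 𝓝[>] (0 : ℝ) ×ˢ 𝓝[>] (0 : ℝ))
      (fun t p => A t.1 t.2.1 p / massShell m t.2.2 p) u ∧
    HasSymbol m (fun p => (1 - cutoff p) * A₀ p) u := by
  obtain ⟨N, HN⟩ := exists_norm_scalarReg_shell_le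
  obtain ⟨C, hA0, hAC⟩ := id hA
  obtain ⟨D, hD, H⟩ := HN C hA0.nonneg
  set l : Filter (ℝ × ℝ × ℝ) := 𝓝[>] (0 : ℝ) ×ˢ 𝓝[>] (0 : ℝ) ×ˢ 𝓝[>] (0 : ℝ) with hl
  have hl1 : Tendsto (fun t : ℝ × ℝ × ℝ => t.1) l (𝓝[>] 0) := tendsto_fst
  have hl2 : Tendsto (fun t : ℝ × ℝ × ℝ => t.2.1) l (𝓝[>] 0) := tendsto_fst.comp tendsto_snd
  have hl3 : Tendsto (fun t : ℝ × ℝ × ℝ => t.2.2) l (𝓝[>] 0) := tendsto_snd.comp tendsto_snd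
  have hη : Tendsto (fun t : ℝ × ℝ × ℝ => t.1 + t.2.1) l (𝓝 0) := by
    simpa using (hl1.mono_right nhdsWithin_le_nhds).add (hl2.mono_right nhdsWithin_le_nhds)
  have hev : ∀ᶠ t : ℝ × ℝ × ℝ in l, 0 < t.1 ∧ 0 < t.2.1 ∧ 0 < t.2.2 := by
    filter_upwards [hl1 self_mem_nhdsWithin, hl2 self_mem_nhdsWithin, hl3 self_mem_nhdsWithin]
      with t h1 h2 h3 using ⟨h1, h2, h3⟩
  obtain ⟨B, hB⟩ := exists_smoothBound_one_sub_cutoff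
  obtain ⟨Bh, Bh', hbh, hbh'⟩ := hA.exists_smoothBound hB one_pos fun p hp => by
    rw [cutoff_eq_one hp.le, sub_self]
  have hshell : ∀ j, ∃ B₀ B₁ : ℕ → ℝ, SmoothBound B₀ (fun p => shell j p * A₀ p) ∧
      ∀ ε ε' : ℝ, 0 < ε → 0 < ε' →
      SmoothBound (fun n => (ε + ε') * B₁ n) (fun p => shell j p * A ε ε' p - shell j p * A₀ p) :=
    fun j => by
      obtain ⟨Bj, hBj⟩ := exists_smoothBound_shell j
      exact hA.exists_smoothBound hBj (ρ := (2 ^ (j + 1))⁻¹) (by positivity)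
        fun p hp => shell_eq_zero_of_lt hp
  choose B₀ B₁ hB₀ hB₁ using hshell
  -- the limits of the two parts
  have limh : ∀ ψ, Tendsto (fun t : ℝ × ℝ × ℝ => scalarReg m t.2.2
      (SchwartzMap.smulLeftCLM ℂ (fun p => (1 - cutoff p) * A t.1 t.2.1 p) ψ)) l
      (𝓝 (scalarLim m (SchwartzMap.smulLeftCLM ℂ (fun p => (1 - cutoff p) * A₀ p) ψ))) := fun ψ =>
    tendsto_scalarReg_smulLeft m hl3 hη hbh (by
      filter_upwards [hev] with t ht using hbh' t.1 t.2.1 ht.1 ht.2.1) ψ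
  have limj : ∀ j ψ, Tendsto (fun t : ℝ × ℝ × ℝ => scalarReg m t.2.2
      (SchwartzMap.smulLeftCLM ℂ (fun p => shell j p * A t.1 t.2.1 p) ψ)) l
      (𝓝 (scalarLim m (SchwartzMap.smulLeftCLM ℂ (fun p => shell j p * A₀ p) ψ))) := fun j ψ =>
    tendsto_scalarReg_smulLeft m hl3 hη (hB₀ j) (by
      filter_upwards [hev] with t ht using hB₁ j t.1 t.2.1 ht.1 ht.2.1) ψ
  have hsum : Summable fun j : ℕ => (1 / 4 : ℝ) ^ j :=
    summable_geometric_of_lt_one (by norm_num) (by norm_num)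
  have bndj : ∀ ψ : 𝓢(Mink, ℂ), ∀ P, (∀ n ≤ N, ∀ p, ‖p‖ ≤ 2 → ‖iteratedFDeriv ℝ n ψ p‖ ≤ P) → ∀ j,
      ‖scalarLim m (SchwartzMap.smulLeftCLM ℂ (fun p => shell j p * A₀ p) ψ)‖ ≤
        (1 / 4) ^ j * (D * P) := fun ψ P hP j => by
    refine le_of_tendsto (tendsto_scalarReg m _).norm ?_
    filter_upwards [self_mem_nhdsWithin] with δ hδ using H A₀ hA0 m δ hδ j ψ P hP
  have hP : ∀ ψ : 𝓢(Mink, ℂ), ∀ n ≤ N, ∀ p : Mink, ‖p‖ ≤ 2 → ‖iteratedFDeriv ℝ n ψ p‖ ≤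
      ((Finset.Iic (0, N)).sup (schwartzSeminormFamily ℝ Mink ℂ)) ψ := fun ψ n hn p _ => by
    have := SchwartzMap.one_add_le_sup_seminorm_apply (𝕜 := ℝ) (m := (0, N)) (k := 0) (n := n)
      le_rfl hn ψ p
    rw [pow_zero, pow_zero, one_mul, one_mul] at this
    exact this
  have sumj : ∀ ψ, Summable fun j =>
      scalarLim m (SchwartzMap.smulLeftCLM ℂ (fun p => shell j p * A₀ p) ψ) := fun ψ =>
    Summable.of_norm_bounded (hsum.mul_right _) (bndj ψ _ (hP ψ))
  have bnd : ∀ ψ : 𝓢(Mink, ℂ), ∀ P, (∀ n ≤ N, ∀ p, ‖p‖ ≤ 2 → ‖iteratedFDeriv ℝ n ψ p‖ ≤ P) →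
      ‖∑' j, scalarLim m (SchwartzMap.smulLeftCLM ℂ (fun p => shell j p * A₀ p) ψ)‖ ≤
        (2 * D) * P := fun ψ P hψ => by
    refine (tsum_of_norm_bounded (hsum.mul_right (D * P)).hasSum (bndj ψ P hψ)).trans ?_
    have hP0 : 0 ≤ P := (norm_nonneg _).trans (hψ 0 (Nat.zero_le _) 0 (by simp))
    rw [tsum_mul_right, tsum_geometric_of_lt_one (by norm_num) (by norm_num)]
    norm_num
    nlinarith [mul_nonneg hD hP0]
  let low : 𝓢(Mink, ℂ) →L[ℂ] ℂ := SchwartzMap.mkCLMtoNormedSpace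
    (fun ψ => ∑' j, scalarLim m (SchwartzMap.smulLeftCLM ℂ (fun p => shell j p * A₀ p) ψ))
    (fun ψ χ => by
      simp only [map_add, scalarLim_add]
      exact (sumj ψ).tsum_add (sumj χ))
    (fun z ψ => by
      simp only [map_smul, scalarLim_smul, RingHom.id_apply, smul_eq_mul]
      exact tsum_mul_left)
    ⟨Finset.Iic (0, N), 2 * D, by positivity, fun ψ => sup_seminorm_eq _ ψ ▸ bnd ψ _ (hP ψ)⟩
  have low_apply : ∀ ψ, low ψ =
    ∑' j, scalarLim m (SchwartzMap.smulLeftCLM ℂ (fun p => shell j p * A₀ p) ψ) := fun ψ => rfl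
  let u₀ : 𝓢(Mink, ℂ) →L[ℂ] ℂ :=
    ((scalarLimCLM m).comp (SchwartzMap.smulLeftCLM ℂ (fun p => (1 - cutoff p) * A₀ p)) + low).comp
      (invF : 𝓢(Mink, ℂ) →L[ℂ] 𝓢(Mink, ℂ))
  let u : 𝓢'(Mink, ℂ) := ContinuousLinearMap.toPointwiseConvergenceCLM _ _ _ _ u₀
  have u_apply : ∀ φ, u φ =
      scalarLim m (SchwartzMap.smulLeftCLM ℂ (fun p => (1 - cutoff p) * A₀ p) (invF φ)) +
        ∑' j, scalarLim m (SchwartzMap.smulLeftCLM ℂ (fun p => shell j p * A₀ p) (invF φ)) :=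
    fun φ => rfl
  refine ⟨u, fun φ => ?_,
    N, 2 * D, by positivity, fun φ P hφ => ?_⟩
  · rw [u_apply]
    have h1 := (limh (invF φ)).add (tendsto_tsum_of_dominated_convergence
      (hsum.mul_right (D * ((Finset.Iic (0, N)).sup (schwartzSeminormFamily ℝ Mink ℂ)) (invF φ)))
      (fun j => limj j (invF φ)) (by
        filter_upwards [hev] with t ht j
        exact H _ (hAC _ _ ht.1 ht.2.1).1 m _ ht.2.2 j (invF φ) _ (hP _)))
    refine h1.congr' ?_
    filter_upwards [hev] with t ht
    simp only [← invF_apply]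
    rw [integral_symbol_eq (hAC _ _ ht.1 ht.2.1).1 m ht.2.2 (invF φ)]
    exact Summable.of_norm_bounded (hsum.mul_right _) fun j =>
      H _ (hAC _ _ ht.1 ht.2.1).1 m _ ht.2.2 j (invF φ) _ (hP _)
  · rw [u_apply, add_sub_cancel_left]
    exact bnd (invF φ) P hφ

theorem exists_isStringPropagator (m : ℝ) (s : ℕ) (β : ℕ → ℂ) (f f' : Mink)
    (c : 𝓓(spacelike, ℂ)) : ∃ u, IsStringPropagator m s β f f' c u ∧
      ∃ d b, IsSymbol d b ∧ HasSymbol m b u := by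
  obtain ⟨A₀, hA⟩ := exists_isSymbolFamily_smearedKernel s β f f' c
  obtain ⟨u, hu, hu'⟩ := exists_limit_of_isSymbolFamily hA m
  obtain ⟨C, hC, _⟩ := hA
  exact ⟨u, hu, 0, _, hC.isSymbol_one_sub_cutoff_mul, hu'⟩

/-- The contact term is absorbed in the symbol: `N = (p² - m² + iδ)N/(p² - m² + iδ)`, so that the
symbol is `M + (p² - m²)N`, and the remaining term with `iδN` vanishes in the limit. -/
theorem exists_isPointPropagator (m : ℝ) (M N : MvPolynomial (Fin 4) ℂ) :
    ∃ u, IsPointPropagator m M N u ∧ ∃ d b, IsSymbol d b ∧ HasSymbol m b u := by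
  obtain ⟨dM, hM⟩ := exists_isSymbol_evalPoly M
  obtain ⟨dN, hN⟩ := exists_isSymbol_evalPoly N
  have hK : IsSymbol 2 (fun p => massShell m 0 p) := by
    have h1 : ∀ i, IsSymbol 2 (fun p : Mink => ((p i : ℝ) : ℂ) * ((p i : ℝ) : ℂ)) := fun i =>
      (isSymbol_coord i).mul (isSymbol_coord i)
    have hm := isSymbol_const (-1)
    have h2 : ∀ i, IsSymbol 2 (fun p : Mink => (-1) * (((p i : ℝ) : ℂ) * ((p i : ℝ) : ℂ))) :=
      fun i => by simpa using hm.mul (h1 i)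
    have := ((((h1 0).add (h2 1)).add (h2 2)).add (h2 3)).add
      ((isSymbol_const (-(m : ℂ) ^ 2)).mono (Nat.zero_le 2))
    convert this using 2 with p
    simp only [massShell, mdot]
    push_cast
    ring
  have hb := (hM.mono (Nat.le_add_right dM (2 + dN))).add
    ((hK.mul hN).mono (Nat.le_add_left (2 + dN) dM))
  let u₀ : 𝓢(Mink, ℂ) →L[ℂ] ℂ := ((scalarLimCLM m).comp (SchwartzMap.smulLeftCLM ℂ
    (fun p => evalPoly M p + massShell m 0 p * evalPoly N p))).comp
      (invF : 𝓢(Mink, ℂ) →L[ℂ] 𝓢(Mink, ℂ))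
  let u : 𝓢'(Mink, ℂ) := ContinuousLinearMap.toPointwiseConvergenceCLM _ _ _ _ u₀
  have u_apply : ∀ φ, u φ = scalarLim m (SchwartzMap.smulLeftCLM ℂ
    (fun p => evalPoly M p + massShell m 0 p * evalPoly N p) (invF φ)) := fun φ => rfl
  refine ⟨u, fun φ => ?_,
    _, _, hb, 0, 0, le_rfl, fun φ P _ => ?_⟩
  · rw [u_apply]
    have h1 := tendsto_scalarReg m (SchwartzMap.smulLeftCLM ℂ
      (fun p => evalPoly M p + massShell m 0 p * evalPoly N p) (invF φ))
    have h2 := tendsto_scalarReg m (SchwartzMap.smulLeftCLM ℂ (evalPoly N) (invF φ))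
    have hδ : Tendsto (fun δ : ℝ => Complex.I * (δ : ℂ)) (𝓝[>] 0) (𝓝 0) := by
      have : Continuous fun δ : ℝ => Complex.I * (δ : ℂ) := by fun_prop
      have := this.tendsto 0
      simp only [Complex.ofReal_zero, mul_zero] at this
      exact this.mono_left nhdsWithin_le_nhds
    have h3 := h1.add (hδ.mul h2)
    rw [zero_mul, add_zero] at h3
    refine h3.congr' ?_
    filter_upwards [self_mem_nhdsWithin] with δ hδ
    rw [scalarReg, scalarReg, ← integral_const_mul, ← integral_add
      (integrable_div_massShell (SchwartzMap.integrable _) m hδ)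
      ((integrable_div_massShell (SchwartzMap.integrable _) m hδ).const_mul _)]
    refine integral_congr_ae (Eventually.of_forall fun p => ?_)
    simp only
    rw [SchwartzMap.smulLeftCLM_apply_apply hb.hasTemperateGrowth,
      SchwartzMap.smulLeftCLM_apply_apply hN.hasTemperateGrowth, invF_apply, smul_eq_mul,
      smul_eq_mul]
    have hne := massShell_ne_zero (m := m) hδ p
    have e : massShell m δ p = massShell m 0 p + Complex.I * δ := by simp [massShell]
    field_simp
    rw [e]
    ring
  · rw [u_apply, sub_self, norm_zero, zero_mul]

theorem IsFourierLimit.unique {ι : Type} {l : Filter ι} [l.NeBot] {K : ι → Mink → ℂ}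
    {u v : 𝓢'(Mink, ℂ)} (hu : IsFourierLimit l K u) (hv : IsFourierLimit l K v) : u = v :=
  ContinuousLinearMap.ext fun φ => tendsto_nhds_unique (hu φ) (hv φ)

theorem IsPropagator.exists_hasSymbol {u : 𝓢'(Mink, ℂ)} (hu : IsPropagator u) :
    ∃ m d b, IsSymbol d b ∧ HasSymbol m b u := by
  rcases hu with ⟨m, s, β, f, f', c, _, hu⟩ | ⟨m, M, N, _, hu⟩
  · obtain ⟨v, hv, d, b, hb, hvb⟩ := exists_isStringPropagator m s β f f' c
    rw [hu.unique hv]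
    exact ⟨m, d, b, hb, hvb⟩
  · obtain ⟨v, hv, d, b, hb, hvb⟩ := exists_isPointPropagator m M N
    rw [hu.unique hv]
    exact ⟨m, d, b, hb, hvb⟩

/-! ### Distributions and superpositions of plane waves -/

theorem iteratedDeriv_cexp_I_mul (n : ℕ) :
    iteratedDeriv n (fun t : ℝ => Complex.exp (Complex.I * t)) =
      fun t : ℝ => Complex.I ^ n * Complex.exp (Complex.I * t) := by
  induction n with
  | zero => simp
  | succ n ih =>
    rw [iteratedDeriv_succ, ih]
    funext t
    have h : HasDerivAt (fun t : ℝ => Complex.exp (Complex.I * t))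
        (Complex.exp (Complex.I * t) * (Complex.I * 1)) t :=
      ((Complex.ofRealCLM.hasDerivAt (x := t)).const_mul Complex.I).cexp
    rw [(h.const_mul (Complex.I ^ n)).deriv, pow_succ]
    ring

theorem norm_mdotL_le (q : Mink) : ‖mdotL q‖ ≤ ‖q‖ :=
  ContinuousLinearMap.opNorm_le_bound _ (norm_nonneg q) fun x => by
    rw [mdotL_apply, Real.norm_eq_abs]; exact abs_mdot_le q x

theorem norm_iteratedFDeriv_planeWave_le (n : ℕ) (q x : Mink) :
    ‖iteratedFDeriv ℝ n (planeWave q) x‖ ≤ ‖q‖ ^ n := by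
  have hf : ContDiff ℝ ∞ (fun t : ℝ => Complex.exp (Complex.I * t)) :=
    (contDiff_const.mul Complex.ofRealCLM.contDiff).cexp
  have h := (mdotL q).iteratedFDeriv_comp_right hf x (i := n) (by exact_mod_cast le_top)
  have e : (fun t : ℝ => Complex.exp (Complex.I * t)) ∘ (mdotL q) = planeWave q := by
    funext x; simp [planeWave, mdotL_apply]
  rw [e] at h
  rw [h]
  refine (ContinuousMultilinearMap.norm_compContinuousLinearMap_le _ _).trans ?_
  rw [norm_iteratedFDeriv_eq_norm_iteratedDeriv, iteratedDeriv_cexp_I_mul, norm_mul, norm_pow,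
    Complex.norm_I, one_pow, one_mul, norm_exp_I_mul, one_mul, Finset.prod_const, Finset.card_univ,
    Fintype.card_fin]
  exact pow_le_pow_left₀ (norm_nonneg _) (norm_mdotL_le q) n

/-- A joint-smoothness criterion for the joint continuity of partial iterated derivatives. -/
theorem continuous_iteratedFDeriv_right {G : Mink → Mink → ℂ}
    (hG : ContDiff ℝ ∞ fun z : Mink × Mink => G z.1 z.2) (n : ℕ) :
    Continuous fun z : Mink × Mink => iteratedFDeriv ℝ n (G z.1) z.2 := by
  have e : ∀ q x, iteratedFDeriv ℝ n (G q) x =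
      (iteratedFDeriv ℝ n (fun z : Mink × Mink => G z.1 z.2) (q, x)).compContinuousLinearMap
        fun _ => ContinuousLinearMap.inr ℝ Mink Mink := by
    intro q x
    have h1 := (ContinuousLinearMap.inr ℝ Mink Mink).iteratedFDeriv_comp_right
      (f := fun z : Mink × Mink => G ((q, 0) + z).1 ((q, 0) + z).2)
      (hG.comp (contDiff_const.add contDiff_id)) x (i := n) (by exact_mod_cast le_top)
    have h2 := iteratedFDeriv_comp_add_left (𝕜 := ℝ) (f := fun z : Mink × Mink => G z.1 z.2) n
      ((q, 0) : Mink × Mink) (ContinuousLinearMap.inr ℝ Mink Mink x)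
    have h3 : (fun z : Mink × Mink => G ((q, 0) + z).1 ((q, 0) + z).2) ∘
        (ContinuousLinearMap.inr ℝ Mink Mink) = G q := by
      funext y; simp
    rw [h3] at h1
    rw [h1, h2]
    simp
  simp only [e]
  exact (ContinuousMultilinearMap.compContinuousLinearMapL (F := ℂ)
    fun _ : Fin n => ContinuousLinearMap.inr ℝ Mink Mink).continuous.comp
      (hG.continuous_iteratedFDeriv (by exact_mod_cast le_top))

/-- A functional on the test functions supported in a compact set has finite order. -/
theorem exists_norm_le_of_continuous {K : Compacts Mink} (T : 𝓓^{⊤}_{K}(Mink, ℂ) →L[ℝ] ℂ) :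
    ∃ (N : ℕ) (C : ℝ), 0 ≤ C ∧ ∀ (f : 𝓓^{⊤}_{K}(Mink, ℂ)) (P : ℝ), 0 ≤ P →
      (∀ n ≤ N, ∀ x ∈ K, ‖iteratedFDeriv ℝ n f x‖ ≤ P) → ‖T f‖ ≤ C * P := by
  let p : Seminorm ℝ 𝓓^{⊤}_{K}(Mink, ℂ) := (normSeminorm ℝ ℂ).comp T.toLinearMap
  have hp : Continuous p := continuous_norm.comp T.continuous
  obtain ⟨s, C, hC, h⟩ := Seminorm.bound_of_continuous
    (ContDiffMapSupportedIn.withSeminorms ℝ Mink ℂ ⊤ K) p hp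
  refine ⟨s.sup id, C, C.2, fun f P hP0 hP => ?_⟩
  refine (h f).trans ?_
  change (C : ℝ) * _ ≤ _
  refine mul_le_mul_of_nonneg_left (Seminorm.finset_sup_apply_le hP0 fun i hi => ?_) C.2
  refine (ContDiffMapSupportedIn.seminorm_top_le_iff ℝ hP0 i f).mpr fun x hx => ?_
  exact hP i (Finset.le_sup (f := id) hi) x hx

/-- Continuous functions on `K` with values in the `i`-linear forms. -/
def JetComp (K : Compacts Mink) (i : ℕ) : Type := C(K, Mink [×i]→L[ℝ] ℂ)

instance (K : Compacts Mink) (i : ℕ) : NormedAddCommGroup (JetComp K i) :=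
  inferInstanceAs (NormedAddCommGroup C(K, Mink [×i]→L[ℝ] ℂ))

instance (K : Compacts Mink) (i : ℕ) : NormedSpace ℝ (JetComp K i) :=
  inferInstanceAs (NormedSpace ℝ C(K, Mink [×i]→L[ℝ] ℂ))

instance (K : Compacts Mink) (i : ℕ) : CompleteSpace (JetComp K i) :=
  inferInstanceAs (CompleteSpace C(K, Mink [×i]→L[ℝ] ℂ))

/-- The Banach space of the derivatives up to order `N` on `K`. -/
abbrev JetSpace (K : Compacts Mink) (N : ℕ) : Type := (i : Fin (N + 1)) → JetComp K i

/-- Evaluation of a component of a jet at a point. -/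
def jetEval {K : Compacts Mink} {N : ℕ} (i : Fin (N + 1)) (x : K) :
    JetSpace K N →L[ℝ] (Mink [×(i : ℕ)]→L[ℝ] ℂ) :=
  ContinuousLinearMap.comp
    (ContinuousMap.evalCLM ℝ x : C(K, Mink [×(i : ℕ)]→L[ℝ] ℂ) →L[ℝ] (Mink [×(i : ℕ)]→L[ℝ] ℂ))
    (ContinuousLinearMap.proj (R := ℝ) (φ := fun i : Fin (N + 1) => JetComp K i) i)

theorem jet_ext {K : Compacts Mink} {N : ℕ} {a b : JetSpace K N}
    (h : ∀ i x, jetEval i x a = jetEval i x b) : a = b :=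
  funext fun i => ContinuousMap.ext fun x => h i x

/-- The derivatives up to order `N` on `K` of a smooth function. -/
def jetFun (K : Compacts Mink) (N : ℕ) (f : 𝓓^{⊤}_{K}(Mink, ℂ)) : JetSpace K N :=
  fun i => (⟨fun x => iteratedFDeriv ℝ i f x,
    (f.contDiff.continuous_iteratedFDeriv (by exact_mod_cast le_top)).comp
      continuous_subtype_val⟩ : C(K, Mink [×(i : ℕ)]→L[ℝ] ℂ))

theorem jetEval_jetFun {K : Compacts Mink} {N : ℕ} (f : 𝓓^{⊤}_{K}(Mink, ℂ)) (i : Fin (N + 1))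
    (x : K) : jetEval i x (jetFun K N f) = iteratedFDeriv ℝ i f x := rfl

/-- `jetFun` as a linear map. -/
def jet (K : Compacts Mink) (N : ℕ) : 𝓓^{⊤}_{K}(Mink, ℂ) →ₗ[ℝ] JetSpace K N where
  toFun := jetFun K N
  map_add' f g := by
    refine jet_ext fun i x => ?_
    rw [map_add, jetEval_jetFun, jetEval_jetFun, jetEval_jetFun]
    exact iteratedFDeriv_add_apply (f.contDiff.of_le (by exact_mod_cast le_top)).contDiffAt
      (g.contDiff.of_le (by exact_mod_cast le_top)).contDiffAt
  map_smul' a f := by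
    refine jet_ext fun i x => ?_
    rw [RingHom.id_apply, map_smul, jetEval_jetFun, jetEval_jetFun]
    exact iteratedFDeriv_const_smul_apply (f.contDiff.of_le (by exact_mod_cast le_top)).contDiffAt

theorem jet_apply {K : Compacts Mink} {N : ℕ} (f : 𝓓^{⊤}_{K}(Mink, ℂ)) (i : Fin (N + 1)) (x : K) :
    jetEval i x (jet K N f) = iteratedFDeriv ℝ i f x := rfl

theorem norm_jetEval_le {K : Compacts Mink} {N : ℕ} (a : JetSpace K N) (i : Fin (N + 1)) (x : K) :
    ‖jetEval i x a‖ ≤ ‖a‖ :=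
  (ContinuousMap.norm_coe_le_norm (a i : C(K, Mink [×(i : ℕ)]→L[ℝ] ℂ)) x).trans
    (norm_le_pi_norm a i)

theorem norm_jet_le {K : Compacts Mink} {N : ℕ} {a : JetSpace K N} {P : ℝ} (hP : 0 ≤ P)
    (h : ∀ i x, ‖jetEval i x a‖ ≤ P) : ‖a‖ ≤ P :=
  (pi_norm_le_iff_of_nonneg hP).mpr fun i =>
    (ContinuousMap.norm_le (a i : C(K, Mink [×(i : ℕ)]→L[ℝ] ℂ)) hP).mpr fun x => h i x

theorem jet_injective (K : Compacts Mink) (N : ℕ) : Function.Injective (jet K N) := by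
  intro f g h
  refine ContDiffMapSupportedIn.ext fun x => ?_
  by_cases hx : x ∈ K
  · have h1 : jetEval ⟨0, N.succ_pos⟩ ⟨x, hx⟩ (jet K N f) =
        jetEval ⟨0, N.succ_pos⟩ ⟨x, hx⟩ (jet K N g) := by rw [h]
    rw [jet_apply, jet_apply] at h1
    have h2 := congrArg (fun m => m (fun _ => 0)) h1
    simpa [iteratedFDeriv_zero_apply] using h2
  · rw [f.zero_on_compl hx, g.zero_on_compl hx]

/-- A functional of finite order factors through the derivatives, by the Hahn–Banach theorem. -/
theorem exists_eq_comp_jet {K : Compacts Mink} (T : 𝓓^{⊤}_{K}(Mink, ℂ) →L[ℝ] ℂ) :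
    ∃ (N : ℕ) (L : JetSpace K N →L[ℝ] ℂ),
      ∀ f, T f = L (jet K N f) := by
  obtain ⟨N, C, hC, h⟩ := exists_norm_le_of_continuous T
  let e := LinearEquiv.ofInjective (jet K N) (jet_injective K N)
  let T₀ : LinearMap.range (jet K N) →L[ℝ] ℂ :=
    LinearMap.mkContinuous (T.toLinearMap ∘ₗ e.symm.toLinearMap) C (by
      intro y
      obtain ⟨f, rfl⟩ := e.surjective y
      change ‖T (e.symm (e f))‖ ≤ _
      rw [e.symm_apply_apply]
      refine h f _ (norm_nonneg _) fun n hn x hx => ?_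
      exact norm_jetEval_le (jet K N f) ⟨n, Nat.lt_succ_of_le hn⟩ ⟨x, hx⟩)
  obtain ⟨L, hL⟩ := T₀.exist_extension_of_finiteDimensional_range
  refine ⟨N, L, fun f => ?_⟩
  have h1 : T₀ (e f) = L (jet K N f) := by rw [hL]; rfl
  rw [← h1]
  change T f = T (e.symm (e f))
  rw [e.symm_apply_apply]

theorem continuous_jet {K : Compacts Mink} (N : ℕ) {H : Mink → 𝓓^{⊤}_{K}(Mink, ℂ)}
    (hH : ContDiff ℝ ∞ fun z : Mink × Mink => H z.1 z.2) : Continuous fun q => jet K N (H q) := by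
  refine continuous_pi fun i => ?_
  have hi : Continuous fun z : Mink × K => iteratedFDeriv ℝ i (H z.1) z.2 :=
    (continuous_iteratedFDeriv_right (G := fun q x => H q x) hH i).comp
      (continuous_fst.prodMk (continuous_subtype_val.comp continuous_snd))
  exact (ContinuousMap.curry ⟨_, hi⟩).continuous

/-- Only derivatives of finite order matter, and these depend continuously on the parameter, uniformly
on `K`. -/
theorem continuous_map_testFunction {K : Compacts Mink} (T : 𝓓^{⊤}_{K}(Mink, ℂ) →L[ℝ] ℂ)
    {H : Mink → 𝓓^{⊤}_{K}(Mink, ℂ)} (hH : ContDiff ℝ ∞ fun z : Mink × Mink => H z.1 z.2) :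
    Continuous fun q => T (H q) := by
  obtain ⟨N, L, hL⟩ := exists_eq_comp_jet T
  simp only [hL]
  exact L.continuous.comp (continuous_jet N hH)

/-- Distributions commute with integrals of test functions depending on a parameter. -/
theorem integral_map_testFunction {K : Compacts Mink} (T : 𝓓^{⊤}_{K}(Mink, ℂ) →L[ℝ] ℂ)
    {H : Mink → 𝓓^{⊤}_{K}(Mink, ℂ)} (hH : ContDiff ℝ ∞ fun z : Mink × Mink => H z.1 z.2)
    {b : ℕ → Mink → ℝ} (hb : ∀ n, Integrable (b n))
    (hHb : ∀ n q x, ‖iteratedFDeriv ℝ n (H q) x‖ ≤ b n q)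
    {F : 𝓓^{⊤}_{K}(Mink, ℂ)} (hF : ∀ x, F x = ∫ q, H q x) :
    Integrable (fun q => T (H q)) ∧ T F = ∫ q, T (H q) := by
  obtain ⟨N, L, hL⟩ := exists_eq_comp_jet T
  have hc := fun n => continuous_iteratedFDeriv_right (G := fun q x => H q x) hH n
  have hg := continuous_jet N hH
  have hint : Integrable fun q => jet K N (H q) := by
    refine Integrable.mono' (integrable_finsetSum (Finset.range (N + 1)) fun i _ => hb i)
      hg.aestronglyMeasurable (Eventually.of_forall fun q => ?_)
    have h0 : ∀ n, 0 ≤ b n q := fun n => (norm_nonneg _).trans (hHb n q 0)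
    refine norm_jet_le (Finset.sum_nonneg fun i _ => h0 i) fun i x => ?_
    exact (hHb i q x).trans (le_sum_range (C := fun n => b n q) h0 (Nat.lt_succ_iff.mp i.2))
  have hcd : ∀ q, ContDiff ℝ ∞ (H q) := fun q => (H q).contDiff
  have key := iteratedFDeriv_integral_eq_of_dominated (μ := (volume : Measure Mink))
    (f := fun q x => H q x) isOpen_univ hcd
    (fun n x => ((hc n).comp (continuous_id.prodMk continuous_const)).aestronglyMeasurable)
    (fun n x _ => ⟨Set.univ, univ_mem, b n, hb n, Eventually.of_forall fun q y _ => hHb n q y⟩)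
  -- the integral exists in the Banach space of jets, where `L` commutes with it
  have hJ : ∫ q, jet K N (H q) = jet K N F := by
    refine jet_ext fun i x => ?_
    rw [← (jetEval i x).integral_comp_comm hint, jet_apply]
    have h2 := key.2 i x (Set.mem_univ _)
    have h3 : (F : Mink → ℂ) = fun x => ∫ q, H q x := funext hF
    rw [h3, h2]
    rfl
  refine ⟨?_, ?_⟩
  · simp only [hL]
    exact L.integrable_comp hint
  · rw [hL, ← hJ, ← L.integral_comp_comm hint]
    simp only [hL]

section Eval

variable {Ω : Opens Mink}

/-- The complex-linear extension of a distribution, as a continuous functional. -/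
def evalCLM (u : 𝓓'(Ω, ℂ)) : 𝓓(Ω, ℂ) →L[ℝ] ℂ where
  toFun := evalC u
  map_add' φ ψ := by simp only [evalC, map_add]; ring
  map_smul' a φ := by
    simp only [evalC, map_smul, RingHom.id_apply, Complex.real_smul]
    ring
  cont := (u.continuous.comp (TestFunction.postcompCLM Complex.reCLM).continuous).add
    (continuous_const.mul (u.continuous.comp (TestFunction.postcompCLM Complex.imCLM).continuous))

theorem evalCLM_apply (u : 𝓓'(Ω, ℂ)) (φ : 𝓓(Ω, ℂ)) : evalCLM u φ = evalC u φ := rfl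

theorem evalC_const_mul (u : 𝓓'(Ω, ℂ)) {φ ψ : 𝓓(Ω, ℂ)} {z : ℂ} (h : ∀ x, ψ x = z * φ x) :
    evalC u ψ = z * evalC u φ := by
  have h1 : TestFunction.postcompCLM Complex.reCLM ψ =
      z.re • TestFunction.postcompCLM Complex.reCLM φ -
        z.im • TestFunction.postcompCLM Complex.imCLM φ :=
    TestFunction.ext fun x => by simp [h]
  have h2 : TestFunction.postcompCLM Complex.imCLM ψ =
      z.re • TestFunction.postcompCLM Complex.imCLM φ +
        z.im • TestFunction.postcompCLM Complex.reCLM φ :=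
    TestFunction.ext fun x => by simp [h]
  rw [evalC, evalC, h1, h2, map_sub, map_add, map_smul, map_smul, map_smul, map_smul]
  simp only [Complex.real_smul]
  conv_rhs => rw [← Complex.re_add_im z]
  linear_combination (-(z.im : ℂ) * u (TestFunction.postcompCLM Complex.imCLM φ)) * Complex.I_sq

theorem evalC_add (u : 𝓓'(Ω, ℂ)) (φ ψ : 𝓓(Ω, ℂ)) : evalC u (φ + ψ) = evalC u φ + evalC u ψ :=
  (evalCLM u).map_add φ ψ

end Eval

/-! ### Localized Fourier transforms and wavefront sets -/

section LocalFourier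

variable {Ω : Opens Mink}

/-- The support of a test function, as a compact set. -/
def suppK (φ : 𝓓(Ω, ℂ)) : Compacts Mink := ⟨tsupport φ, φ.hasCompactSupport⟩

theorem suppK_subset (φ : 𝓓(Ω, ℂ)) : (suppK φ : Set Mink) ⊆ Ω := φ.tsupport_subset

/-- A smooth multiple of `φ` as a test function supported in the support of `φ`. -/
def mulSupported (φ : 𝓓(Ω, ℂ)) (g : Mink → ℂ) (hg : ContDiff ℝ ∞ g) :
    𝓓^{⊤}_{suppK φ}(Mink, ℂ) :=
  ContDiffMapSupportedIn.of_support_subset (f := fun x => φ x * g x) (φ.contDiff.mul hg)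
    ((Function.support_mul_subset_left _ _).trans subset_closure)

theorem mulSupported_apply (φ : 𝓓(Ω, ℂ)) (g : Mink → ℂ) (hg : ContDiff ℝ ∞ g) (x : Mink) :
    mulSupported φ g hg x = φ x * g x := rfl

theorem mulSmooth_apply (φ : 𝓓(Ω, ℂ)) (g : Mink → ℂ) (hg : ContDiff ℝ ∞ g) (x : Mink) :
    mulSmooth φ g hg x = φ x * g x := rfl

/-- The functional `f ↦ u(f)` on the test functions supported in the support of `φ`. -/
def evalSupp (u : 𝓓'(Ω, ℂ)) (φ : 𝓓(Ω, ℂ)) : 𝓓^{⊤}_{suppK φ}(Mink, ℂ) →L[ℝ] ℂ :=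
  (evalCLM u).comp (TestFunction.ofSupportedInCLM ℝ (suppK_subset φ))

theorem evalSupp_eq (u : 𝓓'(Ω, ℂ)) (φ : 𝓓(Ω, ℂ)) {f : 𝓓^{⊤}_{suppK φ}(Mink, ℂ)} {ψ : 𝓓(Ω, ℂ)}
    {z : ℂ} (h : ∀ x, f x = z * ψ x) : evalSupp u φ f = z * evalC u ψ :=
  evalC_const_mul u fun x => h x

theorem localFourier_eq_evalSupp (u : 𝓓'(Ω, ℂ)) (φ : 𝓓(Ω, ℂ)) (k : Mink) :
    localFourier u φ k = evalSupp u φ (mulSupported φ (planeWave k) (contDiff_planeWave k)) := by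
  rw [evalSupp_eq u φ (ψ := mulSmooth φ (planeWave k) (contDiff_planeWave k)) (z := 1)
    (fun x => by rw [one_mul]; rfl), one_mul]
  rfl

theorem continuous_localFourier (u : 𝓓'(Ω, ℂ)) (φ : 𝓓(Ω, ℂ)) : Continuous (localFourier u φ) := by
  have h : ContDiff ℝ ∞ fun z : Mink × Mink => φ z.2 * planeWave z.1 z.2 :=
    (φ.contDiff.comp contDiff_snd).mul (by fun_prop)
  have := continuous_map_testFunction (evalSupp u φ)
    (H := fun k => mulSupported φ (planeWave k) (contDiff_planeWave k)) h
  simpa only [← localFourier_eq_evalSupp] using this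

theorem exists_norm_iteratedFDeriv_le (φ : 𝓓(Ω, ℂ)) : ∃ B, SmoothBound B φ :=
  exists_smoothBound_of_hasCompactSupport φ.contDiff φ.hasCompactSupport

/-- Derivatives of a modulated test function. -/
theorem norm_iteratedFDeriv_mul_planeWave_le {B : ℕ → ℝ} {φ : Mink → ℂ} (hB : SmoothBound B φ)
    {n N : ℕ} (hn : n ≤ N) (k x : Mink) :
    ‖iteratedFDeriv ℝ n (fun x => φ x * planeWave k x) x‖ ≤
      2 ^ N * (∑ i ∈ Finset.range (N + 1), B i) * (1 + ‖k‖) ^ N := by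
  have h0 : 0 ≤ ∑ i ∈ Finset.range (N + 1), B i := Finset.sum_nonneg fun i _ => hB.nonneg i
  have h1 : (1 : ℝ) ≤ 1 + ‖k‖ := by linarith [norm_nonneg k]
  refine (norm_iteratedFDeriv_mul_le_of_le isOpen_univ hB.contDiff.contDiffOn
    (contDiff_planeWave k).contDiffOn (Set.mem_univ x) h0 n
    (fun i hi => (hB.bound i x).trans (le_sum_range hB.nonneg (hi.trans hn)))
    (B := (1 + ‖k‖) ^ N) (fun i hi => ?_)).trans ?_
  · refine (norm_iteratedFDeriv_planeWave_le i k x).trans ?_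
    exact (pow_le_pow_left₀ (norm_nonneg k) (by linarith) i).trans
      (pow_le_pow_right₀ h1 (hi.trans hn))
  · have : (2 : ℝ) ^ n ≤ 2 ^ N := pow_le_pow_right₀ one_le_two hn
    gcongr

/-- The Fourier transform of a compactly supported distribution is polynomially bounded. -/
theorem exists_norm_localFourier_le (u : 𝓓'(Ω, ℂ)) (φ : 𝓓(Ω, ℂ)) :
    ∃ (N : ℕ) (C : ℝ), 0 ≤ C ∧ ∀ k, ‖localFourier u φ k‖ ≤ C * (1 + ‖k‖) ^ N := by
  obtain ⟨N, C, hC, h⟩ := exists_norm_le_of_continuous (evalSupp u φ)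
  obtain ⟨B, hB⟩ := exists_norm_iteratedFDeriv_le φ
  have h0 : 0 ≤ ∑ i ∈ Finset.range (N + 1), B i := Finset.sum_nonneg fun i _ => hB.nonneg i
  refine ⟨N, C * (2 ^ N * ∑ i ∈ Finset.range (N + 1), B i), by positivity, fun k => ?_⟩
  rw [localFourier_eq_evalSupp, mul_assoc]
  exact h _ _ (by positivity) fun n hn x _ => norm_iteratedFDeriv_mul_planeWave_le hB hn k x

theorem integrable_pow_mul_norm (g : 𝓢(Mink, ℂ)) (n : ℕ) :
    Integrable fun q => (1 + ‖q‖) ^ n * ‖g q‖ := by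
  have h := (g.integrable_pow_mul volume n).add (g.integrable_pow_mul volume 0)
  refine (h.const_mul (2 ^ n)).mono' (by fun_prop) (Eventually.of_forall fun q => ?_)
  rw [Real.norm_of_nonneg (by positivity)]
  simp only [Pi.add_apply, pow_zero, one_mul]
  rw [← add_one_mul, ← mul_assoc]
  refine mul_le_mul_of_nonneg_right ?_ (norm_nonneg _)
  have h1 : (1 + ‖q‖) ^ n ≤ 2 ^ (n - 1) * (1 ^ n + ‖q‖ ^ n) :=
    add_pow_le zero_le_one (norm_nonneg q) n
  have h2 : (2 : ℝ) ^ (n - 1) ≤ 2 ^ n := pow_le_pow_right₀ one_le_two (Nat.sub_le n 1)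
  have h3 : (0 : ℝ) ≤ ‖q‖ ^ n := by positivity
  rw [one_pow] at h1
  nlinarith

/-- Fourier inversion under a compactly supported distribution: `(φu)(g) = ∫ ǧ(q) φu^(q) dq`. -/
theorem integral_invF_mul_localFourier (u : 𝓓'(Ω, ℂ)) (φ ψ : 𝓓(Ω, ℂ)) (g : 𝓢(Mink, ℂ))
    (h : ∀ x, ψ x = φ x * g x) :
    Integrable (fun q => invF g q * localFourier u φ q) ∧
      evalC u ψ = ∫ q, invF g q * localFourier u φ q := by
  obtain ⟨B, hB⟩ := exists_norm_iteratedFDeriv_le φ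
  have hcd : ∀ q, ContDiff ℝ ∞ fun x => invF g q * planeWave q x := fun q =>
    contDiff_const.mul (contDiff_planeWave q)
  have h1 : ContDiff ℝ ∞ fun z : Mink × Mink => φ z.2 * (invF g z.1 * planeWave z.1 z.2) :=
    (φ.contDiff.comp contDiff_snd).mul
      (((invF g).smooth ⊤ |>.comp contDiff_fst).mul (by fun_prop))
  have key := integral_map_testFunction (evalSupp u φ)
    (H := fun q => mulSupported φ (fun x => invF g q * planeWave q x) (hcd q)) h1
    (b := fun n q => (2 ^ n * (∑ i ∈ Finset.range (n + 1), B i)) * ((1 + ‖q‖) ^ n * ‖invF g q‖))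
    (fun n => (integrable_pow_mul_norm (invF g) n).const_mul _)
    (fun n q x => by
      have e : (mulSupported φ (fun x => invF g q * planeWave q x) (hcd q) : Mink → ℂ) =
          (invF g q) • fun x => φ x * planeWave q x := by
        funext x
        simp only [mulSupported_apply, Pi.smul_apply, smul_eq_mul]
        ring
      rw [e, iteratedFDeriv_const_smul_apply ((hB.contDiff.mul (contDiff_planeWave q)).of_le
        (by exact_mod_cast le_top)).contDiffAt, norm_smul, mul_comm ‖invF g q‖, ← mul_assoc]
      exact mul_le_mul_of_nonneg_right (norm_iteratedFDeriv_mul_planeWave_le hB le_rfl q x)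
        (norm_nonneg _))
    (F := mulSupported φ g (g.smooth ⊤)) (fun x => by
      simp only [mulSupported_apply]
      rw [integral_const_mul, integral_invF_mul_planeWave])
  have e1 : ∀ q, evalSupp u φ (mulSupported φ (fun x => invF g q * planeWave q x) (hcd q)) =
      invF g q * localFourier u φ q := fun q =>
    evalSupp_eq u φ fun x => by
      rw [mulSupported_apply, mulSmooth_apply]; ring
  have e2 : evalSupp u φ (mulSupported φ g (g.smooth ⊤)) = evalC u ψ := by
    rw [evalSupp_eq u φ (ψ := ψ) (z := 1) fun x => by rw [one_mul, mulSupported_apply, h], one_mul]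
  simp only [e1] at key
  rw [e2] at key
  exact key

theorem localFourier_mul_planeWave (u : 𝓓'(Ω, ℂ)) (φ : 𝓓(Ω, ℂ)) (k q : Mink) :
    localFourier u (mulSmooth φ (planeWave k) (contDiff_planeWave k)) q =
      localFourier u φ (k + q) := by
  rw [localFourier, localFourier]
  congr 1
  refine TestFunction.ext fun x => ?_
  simp only [mulSmooth_apply, planeWave_add, mul_assoc]

/-- The Fourier transform of `gφu` as a convolution. -/
theorem localFourier_mul_eq_integral (u : 𝓓'(Ω, ℂ)) (φ ψ : 𝓓(Ω, ℂ)) (g : 𝓢(Mink, ℂ))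
    (h : ∀ x, ψ x = φ x * g x) (k : Mink) :
    Integrable (fun q => invF g q * localFourier u φ (k + q)) ∧
      localFourier u ψ k = ∫ q, invF g q * localFourier u φ (k + q) := by
  have := integral_invF_mul_localFourier u (mulSmooth φ (planeWave k) (contDiff_planeWave k))
    (mulSmooth ψ (planeWave k) (contDiff_planeWave k)) g (fun x => by
      simp only [mulSmooth_apply, h]; ring)
  simp only [localFourier_mul_planeWave] at this
  exact this

/-- A cone is stable under multiplication by positive numbers. -/
def IsConic (V : Set Mink) : Prop := ∀ t : ℝ, 0 < t → ∀ l ∈ V, t • l ∈ V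

/-- Inside an open cone there is a smaller one at a distance proportional to the norm from the
complement. -/
theorem exists_subcone {V : Set Mink} (hV : IsOpen V) (hc : IsConic V) {k : Mink} (hk : k ∈ V) :
    ∃ V' : Set Mink, IsOpen V' ∧ k ∈ V' ∧ IsConic V' ∧ ∃ c : ℝ, 0 < c ∧ c ≤ 1 ∧
      ∀ l ∈ V', ∀ q : Mink, ‖q‖ ≤ c * ‖l‖ → l + q ∈ V := by
  obtain ⟨r, hr, hball⟩ := Metric.isOpen_iff.mp hV k hk
  set c := r / 2 with hc'
  have hc0 : 0 < c := by positivity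
  refine ⟨{l | ∃ t : ℝ, 0 < t ∧ ‖l - t • k‖ < c * t}, ?_, ⟨1, one_pos, by simpa using hc0⟩, ?_,
    c / (‖k‖ + c + 1), by positivity, ?_, ?_⟩
  · have : {l | ∃ t : ℝ, 0 < t ∧ ‖l - t • k‖ < c * t} =
        ⋃ t ∈ Set.Ioi (0 : ℝ), {l | ‖l - t • k‖ < c * t} := by
      ext l; simp
    rw [this]
    exact isOpen_biUnion fun t _ => isOpen_lt (by fun_prop) continuous_const
  · rintro s hs l ⟨t, ht, hl⟩
    refine ⟨s * t, mul_pos hs ht, ?_⟩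
    rw [mul_smul, ← smul_sub, norm_smul, Real.norm_of_nonneg hs.le]
    calc s * ‖l - t • k‖ < s * (c * t) := by gcongr
      _ = _ := by ring
  · rw [div_le_one (by positivity)]
    linarith [norm_nonneg k]
  · rintro l ⟨t, ht, hl⟩ q hq
    have h1 : ‖l‖ ≤ (‖k‖ + c) * t := by
      calc ‖l‖ = ‖t • k + (l - t • k)‖ := by rw [add_sub_cancel]
        _ ≤ ‖t • k‖ + ‖l - t • k‖ := norm_add_le _ _
        _ ≤ t * ‖k‖ + c * t := by rw [norm_smul, Real.norm_of_nonneg ht.le]; gcongr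
        _ = _ := by ring
    have h2 : ‖q‖ ≤ c * t := by
      refine hq.trans ?_
      rw [div_mul_eq_mul_div, div_le_iff₀ (by positivity)]
      have : c * ‖l‖ ≤ c * ((‖k‖ + c) * t) := by gcongr
      nlinarith [mul_pos hc0 ht]
    have h3 : l + q = t • (t⁻¹ • (l + q)) := by
      rw [smul_smul, mul_inv_cancel₀ ht.ne', one_smul]
    rw [h3]
    refine hc t ht _ (hball ?_)
    rw [Metric.mem_ball, dist_eq_norm]
    have h4 : t⁻¹ • (l + q) - k = t⁻¹ • ((l - t • k) + q) := by
      rw [show l - t • k + q = (l + q) - t • k by abel, smul_sub t⁻¹ (l + q), smul_smul,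
        inv_mul_cancel₀ ht.ne', one_smul]
    rw [h4, norm_smul, norm_inv, Real.norm_of_nonneg ht.le, inv_mul_lt_iff₀ ht]
    calc ‖l - t • k + q‖ ≤ ‖l - t • k‖ + ‖q‖ := norm_add_le _ _
      _ < c * t + c * t := by linarith
      _ = t * r := by rw [hc']; ring

/-- Translates of a polynomially bounded function that is rapidly decreasing on a cone. -/
theorem exists_pow_mul_norm_add_le {h : Mink → ℂ} {N : ℕ} {C : ℝ} (hC : 0 ≤ C)
    (hb : ∀ k, ‖h k‖ ≤ C * (1 + ‖k‖) ^ N) {V V' : Set Mink} (hV : RapidlyDecreasingOn h V) {c : ℝ}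
    (hc : 0 < c) (hc1 : c ≤ 1) (hVV' : ∀ l ∈ V', ∀ q : Mink, ‖q‖ ≤ c * ‖l‖ → l + q ∈ V) (M : ℕ) :
    ∃ D : ℝ, 0 ≤ D ∧ ∀ k ∈ V', ∀ q, (1 + ‖k‖) ^ M * ‖h (k + q)‖ ≤ D * (1 + ‖q‖) ^ (M + 2 * N) := by
  obtain ⟨D, hD⟩ := hV M
  refine ⟨|D| + C * (c⁻¹) ^ (M + N), by positivity, fun k hk q => ?_⟩
  have hq1 : (1 : ℝ) ≤ 1 + ‖q‖ := by linarith [norm_nonneg q]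
  -- for small `q` the translate stays in the cone; otherwise `‖k‖` is bounded by a multiple of `‖q‖`
  by_cases hq : ‖q‖ ≤ c * ‖k‖
  · have h1 := hD _ (hVV' k hk q hq)
    have h2 := pow_le_pow_left₀ (by positivity) (one_add_norm_le_mul k q) M
    calc (1 + ‖k‖) ^ M * ‖h (k + q)‖ ≤ ((1 + ‖k + q‖) * (1 + ‖q‖)) ^ M * ‖h (k + q)‖ := by gcongr
      _ = ((1 + ‖k + q‖) ^ M * ‖h (k + q)‖) * (1 + ‖q‖) ^ M := by rw [mul_pow]; ring
      _ ≤ |D| * (1 + ‖q‖) ^ M := by gcongr; exact h1.trans (le_abs_self D)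
      _ ≤ (|D| + C * (c⁻¹) ^ (M + N)) * (1 + ‖q‖) ^ (M + 2 * N) := by
          have h3 : 0 ≤ C * (c⁻¹) ^ (M + N) := by positivity
          have h4 : (1 + ‖q‖) ^ M ≤ (1 + ‖q‖) ^ (M + 2 * N) := pow_le_pow_right₀ hq1 (by omega)
          exact mul_le_mul (by linarith) h4 (by positivity) (by positivity)
  · have h1 : 1 + ‖k‖ ≤ c⁻¹ * (1 + ‖q‖) := by
      rw [inv_mul_eq_div, le_div_iff₀ hc]
      nlinarith [norm_nonneg k]
    calc (1 + ‖k‖) ^ M * ‖h (k + q)‖ ≤ (1 + ‖k‖) ^ M * (C * ((1 + ‖k‖) * (1 + ‖q‖)) ^ N) := by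
          gcongr
          refine (hb _).trans ?_
          gcongr
          exact one_add_norm_add_le_mul k q
      _ = C * (1 + ‖k‖) ^ (M + N) * (1 + ‖q‖) ^ N := by rw [mul_pow, pow_add]; ring
      _ ≤ C * (c⁻¹ * (1 + ‖q‖)) ^ (M + N) * (1 + ‖q‖) ^ N := by gcongr
      _ = C * (c⁻¹) ^ (M + N) * (1 + ‖q‖) ^ (M + 2 * N) := by
          rw [mul_pow, show M + 2 * N = (M + N) + N by ring, pow_add (1 + ‖q‖)]; ring
      _ ≤ _ := by
          gcongr
          linarith [abs_nonneg D]

/-- Multiplication by a smooth function preserves rapid decrease, up to shrinking the cone. -/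
theorem rapidlyDecreasingOn_localFourier_mul (u : 𝓓'(Ω, ℂ)) {φ ψ : 𝓓(Ω, ℂ)} (g : 𝓢(Mink, ℂ))
    (h : ∀ x, ψ x = φ x * g x) {V V' : Set Mink} (hV : RapidlyDecreasingOn (localFourier u φ) V)
    {c : ℝ} (hc : 0 < c) (hc1 : c ≤ 1)
    (hVV' : ∀ l ∈ V', ∀ q : Mink, ‖q‖ ≤ c * ‖l‖ → l + q ∈ V) :
    RapidlyDecreasingOn (localFourier u ψ) V' := by
  intro M
  obtain ⟨N, C, hC, hb⟩ := exists_norm_localFourier_le u φ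
  obtain ⟨D, hD, hDb⟩ := exists_pow_mul_norm_add_le hC hb hV hc hc1 hVV' M
  refine ⟨∫ q, D * ((1 + ‖q‖) ^ (M + 2 * N) * ‖invF g q‖), fun k hk => ?_⟩
  rw [(localFourier_mul_eq_integral u φ ψ g h k).2]
  have e : (1 + ‖k‖) ^ M * ‖∫ q, invF g q * localFourier u φ (k + q)‖ =
      ‖∫ q, ((1 + ‖k‖) ^ M : ℝ) • (invF g q * localFourier u φ (k + q))‖ := by
    rw [integral_smul, norm_smul, Real.norm_of_nonneg (by positivity)]
  rw [e]
  refine norm_integral_le_of_norm_le ((integrable_pow_mul_norm (invF g) _).const_mul D)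
    (Eventually.of_forall fun q => ?_)
  rw [norm_smul, Real.norm_of_nonneg (by positivity), norm_mul]
  calc (1 + ‖k‖) ^ M * (‖invF g q‖ * ‖localFourier u φ (k + q)‖) =
      ((1 + ‖k‖) ^ M * ‖localFourier u φ (k + q)‖) * ‖invF g q‖ := by ring
    _ ≤ (D * (1 + ‖q‖) ^ (M + 2 * N)) * ‖invF g q‖ := by
        exact mul_le_mul_of_nonneg_right (hDb k hk q) (norm_nonneg _)
    _ = _ := by ring

/-- Off the wavefront set, all test functions supported near the point have a rapidly decreasing
Fourier transform on a common conic neighbourhood. -/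
theorem exists_rapidlyDecreasingOn_of_notMem_WF (u : 𝓓'(Ω, ℂ)) {x k : Mink} (hx : x ∈ Ω)
    (hk : k ≠ 0) (h : (x, k) ∉ WF u) :
    ∃ O : Set Mink, IsOpen O ∧ x ∈ O ∧ ∃ V : Set Mink, IsOpen V ∧ k ∈ V ∧ IsConic V ∧
      ∀ φ : 𝓓(Ω, ℂ), tsupport φ ⊆ O → RapidlyDecreasingOn (localFourier u φ) V := by
  have h' : ∃ φ₀ : 𝓓(Ω, ℂ), φ₀ x ≠ 0 ∧ k ∉ singularDirections (localFourier u φ₀) := by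
    by_contra hcon
    push Not at hcon
    exact h ⟨hx, hk, hcon⟩
  obtain ⟨φ₀, hφ₀, hs⟩ := h'
  have h2 : ∃ V : Set Mink, IsOpen V ∧ k ∈ V ∧ (∀ t : ℝ, 0 < t → ∀ l ∈ V, t • l ∈ V) ∧
      RapidlyDecreasingOn (localFourier u φ₀) V := by
    by_contra hcon
    exact hs ⟨hk, hcon⟩
  obtain ⟨V, hV, hkV, hVc, hVr⟩ := h2
  obtain ⟨V', hV', hkV', hVc', c, hc, hc1, hVV'⟩ := exists_subcone hV hVc hkV
  refine ⟨{y | φ₀ y ≠ 0}, isOpen_ne_fun φ₀.continuous continuous_const, hφ₀, V', hV', hkV', hVc',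
    fun φ hφ => ?_⟩
  -- every test function supported where `φ₀ ≠ 0` is a smooth multiple of `φ₀`
  have hg : ContDiff ℝ ∞ fun y => φ y / φ₀ y := by
    rw [contDiff_iff_contDiffAt]
    intro y
    by_cases hy : y ∈ tsupport φ
    · simp only [div_eq_mul_inv]
      exact φ.contDiff.contDiffAt.mul (φ₀.contDiff.contDiffAt.inv (hφ hy))
    · refine (contDiffAt_const (c := (0 : ℂ))).congr_of_eventuallyEq ?_
      filter_upwards [(isClosed_tsupport φ).isOpen_compl.mem_nhds hy] with z hz
      rw [image_eq_zero_of_notMem_tsupport hz, zero_div]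
  have hgc : HasCompactSupport fun y => φ y / φ₀ y := by
    simp only [div_eq_mul_inv]
    exact φ.hasCompactSupport.mul_right
  refine rapidlyDecreasingOn_localFourier_mul u (hgc.toSchwartzMap hg) (fun y => ?_) hVr hc hc1 hVV'
  change φ y = φ₀ y * (φ y / φ₀ y)
  by_cases hy : φ₀ y = 0
  · have : φ y = 0 := by
      by_contra hne
      exact hφ (subset_tsupport _ hne) hy
    rw [this, zero_div, mul_zero]
  · rw [mul_div_cancel₀ _ hy]

end LocalFourier

/-! ### Multiplication by symbols in momentum space -/

/-- A family `B k` of smooth functions of `q` behaving like the translates `b(k + q)` of a symbol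
of order `e`: each derivative in `q` gains a power of `1 + ‖k‖`. -/
structure IsTranslateFamily (e : ℤ) (B : Mink → Mink → ℂ) : Prop where
  contDiff : ∀ k, ContDiff ℝ ∞ (B k)
  bound : ∀ n : ℕ, ∃ (C : ℝ) (M : ℕ), 0 ≤ C ∧ ∀ k q,
    ‖iteratedFDeriv ℝ n (B k) q‖ ≤ C * (1 + ‖k‖) ^ (e - n) * (1 + ‖q‖) ^ M

theorem IsSymbol.isTranslateFamily {d : ℕ} {b : Mink → ℂ} (h : IsSymbol d b) :
    IsTranslateFamily d (fun k q => b (k + q)) where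
  contDiff k := h.1.comp (contDiff_const.add contDiff_id)
  bound n := by
    obtain ⟨C, hC⟩ := h.2 n
    refine ⟨|C|, ((d : ℤ) - n).natAbs, abs_nonneg C, fun k q => ?_⟩
    rw [iteratedFDeriv_comp_add_left]
    calc ‖iteratedFDeriv ℝ n b (k + q)‖ ≤ |C| * (1 + ‖k + q‖) ^ ((d : ℤ) - n) := by
          refine (hC _).trans ?_
          gcongr
          exact le_abs_self C
      _ ≤ |C| * ((1 + ‖k‖) ^ ((d : ℤ) - n) * (1 + ‖q‖) ^ ((d : ℤ) - n).natAbs) := by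
          gcongr
          exact zpow_one_add_norm_add_le k q _
      _ = _ := by ring

theorem IsTranslateFamily.exists_bound {e : ℤ} {B : Mink → Mink → ℂ} (h : IsTranslateFamily e B)
    (N : ℕ) : ∃ (C : ℝ) (M : ℕ), 0 ≤ C ∧ ∀ n ≤ N, ∀ k q,
      ‖iteratedFDeriv ℝ n (B k) q‖ ≤ C * (1 + ‖k‖) ^ e * (1 + ‖q‖) ^ M := by
  choose C M hC hb using h.bound
  refine ⟨∑ i ∈ Finset.range (N + 1), C i, ∑ i ∈ Finset.range (N + 1), M i,
    Finset.sum_nonneg fun i _ => hC i, fun n hn k q => (hb n k q).trans ?_⟩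
  have h1 : (1 + ‖k‖) ^ (e - n) ≤ (1 + ‖k‖) ^ e :=
    zpow_le_zpow_right₀ (by linarith [norm_nonneg k]) (by omega)
  have h2 : (1 + ‖q‖) ^ M n ≤ (1 + ‖q‖) ^ (∑ i ∈ Finset.range (N + 1), M i) :=
    pow_le_pow_right₀ (by linarith [norm_nonneg q])
      (Finset.single_le_sum (f := M) (fun i _ => Nat.zero_le _) (Finset.mem_range_succ_iff.mpr hn))
  have h3 := le_sum_range hC hn
  have h4 : 0 ≤ ∑ i ∈ Finset.range (N + 1), C i := Finset.sum_nonneg fun i _ => hC i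
  gcongr

theorem IsTranslateFamily.hasTemperateGrowth {e : ℤ} {B : Mink → Mink → ℂ}
    (h : IsTranslateFamily e B) (k : Mink) : (B k).HasTemperateGrowth := by
  refine ⟨h.contDiff k, fun n => ?_⟩
  obtain ⟨C, M, -, hb⟩ := h.bound n
  exact ⟨M, C * (1 + ‖k‖) ^ (e - n), hb k⟩

/-- The coefficient of `qᵢ` in the Hadamard expansion `B q = B 0 + ∑ᵢ qᵢ Bᵢ q`. -/
def hadamard (B : Mink → ℂ) (i : Fin 4) (q : Mink) : ℂ :=
  ∫ t in Set.Ioc (0 : ℝ) 1, fderiv ℝ B (t • q) (EuclideanSpace.single i 1)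

/-- Hadamard's lemma. -/
theorem eq_add_sum_hadamard {B : Mink → ℂ} (hB : ContDiff ℝ ∞ B) (q : Mink) :
    B q = B 0 + ∑ i, (q i : ℂ) * hadamard B i q := by
  have hc : ∀ v, Continuous fun t : ℝ => fderiv ℝ B (t • q) v := fun v =>
    ((hB.continuous_fderiv (by simp)).comp (by fun_prop)).clm_apply continuous_const
  have h1 : ∫ t in (0 : ℝ)..1, fderiv ℝ B (t • q) q = B q - B 0 := by
    have := intervalIntegral.integral_eq_sub_of_hasDerivAt (a := (0 : ℝ)) (b := 1)
      (f := fun t : ℝ => B (t • q)) (f' := fun t => fderiv ℝ B (t • q) q) (fun t _ => ?_)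
      ((hc q).intervalIntegrable _ _)
    · simpa using this
    · have h := (hB.differentiable (by simp) (t • q)).hasFDerivAt.comp_hasDerivAt t
        ((hasDerivAt_id t).smul_const q)
      simpa [Function.comp_def] using h
  have hq : q = ∑ i, q i • EuclideanSpace.single i (1 : ℝ) := by
    have := (EuclideanSpace.basisFun (Fin 4) ℝ).sum_repr q
    simpa using this.symm
  have h2 : ∀ t : ℝ, fderiv ℝ B (t • q) q =
      ∑ i, (q i : ℂ) * fderiv ℝ B (t • q) (EuclideanSpace.single i 1) := by
    intro t
    conv_lhs => rw [show fderiv ℝ B (t • q) q =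
      fderiv ℝ B (t • q) (∑ i, q i • EuclideanSpace.single i (1 : ℝ)) from congrArg _ hq]
    rw [map_sum]
    simp
  simp only [h2] at h1
  rw [intervalIntegral.integral_of_le zero_le_one, integral_finsetSum _ fun i _ =>
    (((hc _).const_mul _).integrableOn_Icc (a := 0) (b := 1)).mono_set Set.Ioc_subset_Icc_self] at h1
  simp only [integral_const_mul] at h1
  change B q = B 0 + ∑ i, (q i : ℂ) * (∫ t in Set.Ioc (0 : ℝ) 1, fderiv ℝ B (t • q) _)
  rw [h1]
  ring

/-- The Hadamard coefficients are averages of first derivatives, hence of order one lower. -/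
theorem IsTranslateFamily.hadamard {e : ℤ} {B : Mink → Mink → ℂ} (h : IsTranslateFamily e B)
    (i : Fin 4) : IsTranslateFamily (e - 1) (fun k => hadamard (B k) i) := by
  set v : Mink := EuclideanSpace.single i 1 with hv
  have hv1 : ‖v‖ = 1 := by simp [hv]
  have hcd : ∀ k, ContDiff ℝ ∞ fun q => fderiv ℝ (B k) q v := fun k =>
    contDiff_fderiv_apply (h.contDiff k) v
  have hD : ∀ (k : Mink) (n : ℕ) (t : ℝ) (q : Mink),
      iteratedFDeriv ℝ n (fun q => fderiv ℝ (B k) (t • q) v) q =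
        t ^ n • iteratedFDeriv ℝ n (fun q => fderiv ℝ (B k) q v) (t • q) := fun k n t q =>
    congrFun (iteratedFDeriv_comp_const_smul (f := fun q => fderiv ℝ (B k) q v) t
      ((hcd k).of_le (by exact_mod_cast le_top))) q
  have hbd : ∀ n : ℕ, ∃ (C : ℝ) (M : ℕ), 0 ≤ C ∧ ∀ k, ∀ t ∈ Set.Ioc (0 : ℝ) 1, ∀ q,
      ‖iteratedFDeriv ℝ n (fun q => fderiv ℝ (B k) (t • q) v) q‖ ≤
        C * (1 + ‖k‖) ^ (e - 1 - n) * (1 + ‖q‖) ^ M := by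
    intro n
    obtain ⟨C, M, hC, hb⟩ := h.bound (n + 1)
    refine ⟨C, M, hC, fun k t ht q => ?_⟩
    have h1 := norm_iteratedFDeriv_clm_apply_const (c := v) (n := n) (x := t • q)
      ((h.contDiff k).fderiv_right (m := ∞) (by simp)).contDiffAt (by exact_mod_cast le_top)
    rw [hv1, one_mul, norm_iteratedFDeriv_fderiv] at h1
    rw [hD, norm_smul, norm_pow, Real.norm_of_nonneg ht.1.le]
    have h2 : t ^ n ≤ 1 := pow_le_one₀ ht.1.le ht.2
    have h3 : ‖t • q‖ ≤ ‖q‖ := by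
      rw [norm_smul, Real.norm_of_nonneg ht.1.le]
      nlinarith [norm_nonneg q, ht.2]
    calc _ ≤ 1 * (C * (1 + ‖k‖) ^ (e - (n + 1 : ℕ)) * (1 + ‖t • q‖) ^ M) := by
          exact mul_le_mul h2 (h1.trans (hb k _)) (norm_nonneg _) zero_le_one
      _ ≤ C * (1 + ‖k‖) ^ (e - (n + 1 : ℕ)) * (1 + ‖q‖) ^ M := by
          rw [one_mul]; gcongr
      _ = _ := by push_cast; rw [show e - ((n : ℤ) + 1) = e - 1 - n by ring]
  have key := fun k => iteratedFDeriv_integral_eq_of_dominated (μ := volume.restrict (Set.Ioc (0:ℝ) 1))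
    isOpen_univ (f := fun (t : ℝ) q => fderiv ℝ (B k) (t • q) v)
    (fun t => (hcd k).comp (contDiff_const_smul t)) (fun n x => by
      simp only [hD]
      have := (hcd k).continuous_iteratedFDeriv (m := n) (by exact_mod_cast le_top)
      exact Continuous.aestronglyMeasurable (by fun_prop)) (fun n x _ => by
      obtain ⟨C, M, hC, hb⟩ := hbd n
      refine ⟨Metric.ball x 1, Metric.ball_mem_nhds x one_pos,
        fun _ => C * (1 + ‖k‖) ^ (e - 1 - n) * (1 + (‖x‖ + 1)) ^ M, integrable_const _, ?_⟩
      refine (ae_restrict_iff' measurableSet_Ioc).mpr (Eventually.of_forall fun t ht y hy => ?_)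
      refine (hb k t ht y).trans ?_
      have : ‖y‖ ≤ ‖x‖ + 1 := by
        have h1 := norm_le_insert' y x
        rw [Metric.mem_ball, dist_eq_norm] at hy
        linarith
      change C * _ * (1 + ‖y‖) ^ M ≤ C * _ * (1 + (‖x‖ + 1)) ^ M
      gcongr)
  refine ⟨fun k => contDiffOn_univ.mp (key k).1, fun n => ?_⟩
  obtain ⟨C, M, hC, hb⟩ := hbd n
  refine ⟨C, M, hC, fun k q => ?_⟩
  change ‖iteratedFDeriv ℝ n (fun q => ∫ t in Set.Ioc (0 : ℝ) 1, fderiv ℝ (B k) (t • q) v) q‖ ≤ _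
  rw [(key k).2 n q (Set.mem_univ q)]
  have := norm_setIntegral_le_of_norm_le_const (μ := volume) (s := Set.Ioc (0 : ℝ) 1)
    (f := fun t => iteratedFDeriv ℝ n (fun q => fderiv ℝ (B k) (t • q) v) q)
    (C := C * (1 + ‖k‖) ^ (e - 1 - n) * (1 + ‖q‖) ^ M) (by simp) (fun t ht => hb k t ht q)
  simpa using this

/-- The translate by `k` of `B k` times `f`. -/
def translateMul (B : Mink → Mink → ℂ) (f : 𝓢(Mink, ℂ)) (k : Mink) : 𝓢(Mink, ℂ) :=
  SchwartzMap.compSubConstCLM ℂ k (SchwartzMap.smulLeftCLM ℂ (B k) f)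

theorem IsTranslateFamily.translateMul_apply {e : ℤ} {B : Mink → Mink → ℂ}
    (h : IsTranslateFamily e B) (f : 𝓢(Mink, ℂ)) (k p : Mink) :
    translateMul B f k p = B k (p - k) * f (p - k) := by
  rw [translateMul, SchwartzMap.compSubConstCLM_apply,
    SchwartzMap.smulLeftCLM_apply_apply (h.hasTemperateGrowth k), smul_eq_mul]

theorem exists_schwartz_bound (f : 𝓢(Mink, ℂ)) (L N : ℕ) :
    ∃ C : ℝ, 0 ≤ C ∧ ∀ n ≤ N, ∀ q, ‖iteratedFDeriv ℝ n f q‖ ≤ C * ((1 + ‖q‖) ^ L)⁻¹ := by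
  refine ⟨2 ^ L * ((Finset.Iic (L, N)).sup (schwartzSeminormFamily ℝ Mink ℂ)) f, by positivity,
    fun n hn q => ?_⟩
  rw [← div_eq_mul_inv, le_div_iff₀ (by positivity), mul_comm]
  exact SchwartzMap.one_add_le_sup_seminorm_apply (𝕜 := ℝ) (m := (L, N)) le_rfl hn f q

/-- A priori, the pairing with `scalarLim` grows like a power of `1 + ‖k‖` that depends only on the
order of the family. -/
theorem exists_norm_scalarLim_translateMul_le (m : ℝ) : ∃ K : ℕ, ∀ (e : ℤ) (B : Mink → Mink → ℂ)
    (_ : IsTranslateFamily e B) (f : 𝓢(Mink, ℂ)), ∃ C : ℝ, ∀ k,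
      ‖scalarLim m (translateMul B f k)‖ ≤ C * (1 + ‖k‖) ^ (e + K) := by
  obtain ⟨K, N, C₀, hC₀, h₀⟩ := exists_norm_scalarLim_le
  refine ⟨K, fun e B h f => ?_⟩
  obtain ⟨C, M, hC, hb⟩ := h.exists_bound N
  obtain ⟨C', hC', hf⟩ := exists_schwartz_bound f (M + K) N
  refine ⟨C₀ * (2 ^ N * C * C'), fun k => (h₀ m _).trans ?_⟩
  rw [mul_assoc C₀]
  gcongr
  refine sup_seminorm_le (by positivity) fun j hj n hn p => ?_
  have e1 : (translateMul B f k : Mink → ℂ) = fun p => (fun q => B k q * f q) (p - k) := by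
    funext p
    rw [h.translateMul_apply]
  rw [e1, iteratedFDeriv_comp_sub (f := fun q => B k q * f q)]
  set q := p - k with hq
  have hp : p = k + q := by rw [hq]; abel
  have h1 := norm_iteratedFDeriv_mul_le_of_le isOpen_univ (h.contDiff k).contDiffOn
    (f.smooth ⊤).contDiffOn (Set.mem_univ q) (A := C * (1 + ‖k‖) ^ e * (1 + ‖q‖) ^ M)
    (by positivity) n (fun i hi => hb i (hi.trans hn) k q) (fun i hi => hf i (hi.trans hn) q)
  have h2 : ‖p‖ ^ j ≤ ((1 + ‖k‖) * (1 + ‖q‖)) ^ K := by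
    rw [hp]
    have a1 := one_add_norm_add_le_mul k q
    calc ‖k + q‖ ^ j ≤ (1 + ‖k + q‖) ^ j :=
          pow_le_pow_left₀ (norm_nonneg _) (by linarith) j
      _ ≤ (1 + ‖k + q‖) ^ K := pow_le_pow_right₀ (by linarith [norm_nonneg (k + q)]) hj
      _ ≤ _ := pow_le_pow_left₀ (by positivity) a1 K
  have h3 : (2 : ℝ) ^ n ≤ 2 ^ N := pow_le_pow_right₀ one_le_two hn
  calc _ ≤ ((1 + ‖k‖) * (1 + ‖q‖)) ^ K * (2 ^ N * (C * (1 + ‖k‖) ^ e * (1 + ‖q‖) ^ M) *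
        (C' * ((1 + ‖q‖) ^ (M + K))⁻¹)) := by
        refine mul_le_mul h2 (h1.trans ?_) (norm_nonneg _) (by positivity)
        gcongr
    _ = 2 ^ N * C * C' * ((1 + ‖k‖) ^ e * (1 + ‖k‖) ^ K) := by
        rw [mul_pow, pow_add]
        field_simp
    _ = _ := by
        rw [zpow_add₀ (by positivity), zpow_natCast]

/-- If the pairings of `scalarLim` with all translates of the functions of a class stable under
multiplication by coordinates decrease rapidly on `V`, then so do the pairings with the translates
multiplied by a symbol. -/
theorem exists_norm_scalarLim_translateMul_le_of_rapidlyDecreasing {m : ℝ} {V : Set Mink}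
    {P : Set 𝓢(Mink, ℂ)} (hP : ∀ f ∈ P, ∀ i : Fin 4, ∃ g ∈ P, ∀ q, g q = (q i : ℂ) * f q)
    (hV : ∀ f ∈ P, RapidlyDecreasingOn
      (fun k => scalarLim m (SchwartzMap.compSubConstCLM ℂ k f)) V)
    {e : ℤ} {B : Mink → Mink → ℂ} (h : IsTranslateFamily e B) {f : 𝓢(Mink, ℂ)} (hf : f ∈ P) :
    RapidlyDecreasingOn (fun k => scalarLim m (translateMul B f k)) V := by
  obtain ⟨K, hK⟩ := exists_norm_scalarLim_translateMul_le m
  -- each application of Hadamard's lemma lowers the order, and with it the a priori bound, by one;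
  -- the factors `q i` are absorbed by the class `P`
  have key : ∀ (N : ℕ) (e : ℤ) (B : Mink → Mink → ℂ) (_ : IsTranslateFamily e B),
      ∀ f ∈ P, ∃ C : ℝ, ∀ k ∈ V,
        ‖scalarLim m (translateMul B f k)‖ ≤ C * (1 + ‖k‖) ^ (e + K - N) := by
    intro N
    induction N with
    | zero =>
      intro e B h f _
      obtain ⟨C, hC⟩ := hK e B h f
      exact ⟨C, fun k _ => by simpa using hC k⟩
    | succ N ih =>
      intro e B h f hf
      choose g hgP hg using hP f hf
      choose C hC using fun i => ih (e - 1) _ (h.hadamard i) (g i) (hgP i)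
      obtain ⟨C₀, M₀, hC₀, h₀⟩ := h.exists_bound 0
      obtain ⟨L, hL⟩ : ∃ L : ℕ, -(L : ℤ) ≤ (K : ℤ) - (N + 1 : ℕ) := ⟨N + 1, by push_cast; omega⟩
      obtain ⟨D, hD⟩ := hV f hf L
      refine ⟨C₀ * |D| + ∑ i, C i, fun k hk => ?_⟩
      have e1 : translateMul B f k = B k 0 • SchwartzMap.compSubConstCLM ℂ k f +
          ∑ i, translateMul (fun k => hadamard (B k) i) (g i) k := by
        ext p
        rw [h.translateMul_apply, add_apply, sum_apply, smul_apply,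
          SchwartzMap.compSubConstCLM_apply, eq_add_sum_hadamard (h.contDiff k) (p - k), add_mul,
          Finset.sum_mul, smul_eq_mul]
        congr 1
        refine Finset.sum_congr rfl fun i _ => ?_
        rw [(h.hadamard i).translateMul_apply, hg]
        ring
      have e2 : scalarLim m (translateMul B f k) =
          B k 0 * scalarLim m (SchwartzMap.compSubConstCLM ℂ k f) +
            ∑ i, scalarLim m (translateMul (fun k => hadamard (B k) i) (g i) k) := by
        simp only [← scalarLimCLM_apply]
        rw [e1, map_add, map_smul, map_sum, smul_eq_mul]
      have h1 : (1 : ℝ) ≤ 1 + ‖k‖ := by linarith [norm_nonneg k]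
      have b0 : ‖B k 0‖ ≤ C₀ * (1 + ‖k‖) ^ e := by
        have := h₀ 0 le_rfl k 0
        simpa using this
      have b1 : ‖scalarLim m (SchwartzMap.compSubConstCLM ℂ k f)‖ ≤
          |D| * (1 + ‖k‖) ^ ((K : ℤ) - (N + 1 : ℕ)) := by
        have a1 := (hD k hk).trans (le_abs_self D)
        rw [← le_div_iff₀' (by positivity)] at a1
        refine a1.trans ?_
        rw [div_eq_mul_inv, ← zpow_natCast, ← zpow_neg]
        gcongr
      rw [e2, add_mul]
      refine (norm_add_le _ _).trans (add_le_add ?_ ?_)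
      · rw [norm_mul]
        calc _ ≤ C₀ * (1 + ‖k‖) ^ e * (|D| * (1 + ‖k‖) ^ ((K : ℤ) - (N + 1 : ℕ))) := by gcongr
          _ = C₀ * |D| * ((1 + ‖k‖) ^ e * (1 + ‖k‖) ^ ((K : ℤ) - (N + 1 : ℕ))) := by ring
          _ = _ := by rw [← zpow_add₀ (by positivity)]; congr 2; ring
      · rw [Finset.sum_mul]
        refine (norm_sum_le _ _).trans (Finset.sum_le_sum fun i _ => (hC i k hk).trans_eq ?_)
        congr 2
        push_cast
        ring
  intro N
  obtain ⟨C, hC⟩ := key ((e + K + N).toNat) e B h f hf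
  refine ⟨|C|, fun k hk => ?_⟩
  have h1 : (1 : ℝ) ≤ 1 + ‖k‖ := by linarith [norm_nonneg k]
  calc (1 + ‖k‖) ^ N * ‖scalarLim m (translateMul B f k)‖ ≤
      (1 + ‖k‖) ^ N * (|C| * (1 + ‖k‖) ^ (-(N : ℤ))) := by
        gcongr
        refine (hC k hk).trans ?_
        gcongr
        · exact le_abs_self C
        · have := Int.self_le_toNat (e + K + N)
          omega
    _ = |C| := by
        rw [zpow_neg, zpow_natCast]
        field_simp

/-! ### Wavefront sets of the propagators -/

section Modulation

theorem hasTemperateGrowth_planeWave (k : Mink) : (planeWave k).HasTemperateGrowth :=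
  ⟨contDiff_planeWave k, fun n => ⟨0, ‖k‖ ^ n, fun x => by
    simpa using norm_iteratedFDeriv_planeWave_le n k x⟩⟩

/-- The product of a Schwartz function with a plane wave. -/
def modulate (ψ : 𝓢(Mink, ℂ)) (k : Mink) : 𝓢(Mink, ℂ) :=
  SchwartzMap.smulLeftCLM ℂ (planeWave k) ψ

theorem modulate_apply (ψ : 𝓢(Mink, ℂ)) (k x : Mink) :
    modulate ψ k x = ψ x * planeWave k x := by
  rw [modulate, SchwartzMap.smulLeftCLM_apply_apply (hasTemperateGrowth_planeWave k), smul_eq_mul,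
    mul_comm]

theorem invF_modulate_eq (ψ : 𝓢(Mink, ℂ)) (k : Mink) :
    invF (modulate ψ k) = SchwartzMap.compSubConstCLM ℂ k (invF ψ) := by
  ext p
  rw [invF_modulate (modulate_apply ψ k), SchwartzMap.compSubConstCLM_apply]

/-- The inverse Fourier transforms of test functions supported in `O` are stable under
multiplication by coordinates. -/
theorem exists_invF_eq_coord_mul {O : Set Mink} {ψ : 𝓢(Mink, ℂ)} (hψ : HasCompactSupport ψ)
    (hO : tsupport ψ ⊆ O) (i : Fin 4) : ∃ χ : 𝓢(Mink, ℂ), HasCompactSupport χ ∧ tsupport χ ⊆ O ∧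
      ∀ q, invF χ q = (q i : ℂ) * invF ψ q := by
  obtain ⟨s, hs⟩ : ∃ s : ℂ, ∀ q : Mink,
      s * (Complex.I * (mdot q (EuclideanSpace.single i 1) : ℂ)) = (q i : ℂ) := by
    fin_cases i
    · exact ⟨-Complex.I, fun q => by simp [mdot, ← mul_assoc]⟩
    all_goals exact ⟨Complex.I, fun q => by simp [mdot, ← mul_assoc]⟩
  set v : Mink := EuclideanSpace.single i 1
  have hsub := tsupport_fderiv_apply_subset (ψ := ψ) v
  have hc : HasCompactSupport fun x => fderiv ℝ ψ x v :=
    hψ.of_isClosed_subset (isClosed_tsupport _) hsub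
  set χ : 𝓢(Mink, ℂ) := hc.toSchwartzMap (contDiff_fderiv_apply (ψ.smooth ⊤) v)
  have hχ : tsupport (s • χ : 𝓢(Mink, ℂ)) ⊆ tsupport ψ := by
    refine (closure_mono fun x hx => ?_).trans hsub
    rw [Function.mem_support] at hx ⊢
    contrapose! hx
    change s • fderiv ℝ ψ x v = 0
    rw [hx, smul_zero]
  refine ⟨s • χ, hψ.of_isClosed_subset (isClosed_tsupport _) hχ, hχ.trans hO, fun q => ?_⟩
  rw [map_smul, smul_apply, smul_eq_mul, invF_fderiv (φ := ψ) (φ' := χ) (v := v) fun x => rfl,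
    ← mul_assoc, hs]

/-- Multiplication of a momentum-space kernel by a symbol does not enlarge the set of directions in
which localizations fail to decrease rapidly; contributions of bounded momenta are harmless. -/
theorem HasSymbol.rapidlyDecreasingOn_modulate {m : ℝ} {d : ℕ} {b : Mink → ℂ} {u : 𝓢'(Mink, ℂ)}
    (hu : HasSymbol m b u) (hb : IsSymbol d b) {O V : Set Mink}
    (hV : ∀ ψ : 𝓢(Mink, ℂ), HasCompactSupport ψ → tsupport ψ ⊆ O →
      RapidlyDecreasingOn (fun k => scalarLim m (invF (modulate ψ k))) V)
    {ψ : 𝓢(Mink, ℂ)} (hψ : HasCompactSupport ψ) (hO : tsupport ψ ⊆ O) :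
    RapidlyDecreasingOn (fun k => u (modulate ψ k)) V := by
  have h1 : RapidlyDecreasingOn
      (fun k => scalarLim m (translateMul (fun k q => b (k + q)) (invF ψ) k)) V := by
    refine exists_norm_scalarLim_translateMul_le_of_rapidlyDecreasing
      (P := {f | ∃ χ : 𝓢(Mink, ℂ), HasCompactSupport χ ∧ tsupport χ ⊆ O ∧ f = invF χ})
      ?_ ?_ hb.isTranslateFamily ⟨ψ, hψ, hO, rfl⟩
    · rintro f ⟨χ, hχ, hχO, rfl⟩ i
      obtain ⟨χ', h1, h2, h3⟩ := exists_invF_eq_coord_mul hχ hχO i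
      exact ⟨_, ⟨χ', h1, h2, rfl⟩, h3⟩
    · rintro f ⟨χ, hχ, hχO, rfl⟩
      simpa only [invF_modulate_eq] using hV χ hχ hχO
  have e1 : ∀ k, translateMul (fun k q => b (k + q)) (invF ψ) k =
      SchwartzMap.smulLeftCLM ℂ b (invF (modulate ψ k)) := by
    intro k
    ext p
    rw [hb.isTranslateFamily.translateMul_apply, SchwartzMap.smulLeftCLM_apply_apply
      hb.hasTemperateGrowth, invF_modulate_eq, SchwartzMap.compSubConstCLM_apply, add_sub_cancel,
      smul_eq_mul]
  simp only [e1] at h1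
  obtain ⟨N, D, hD, hu⟩ := hu
  intro M
  obtain ⟨C, hC⟩ := h1 M
  obtain ⟨C', hC', hf⟩ := exists_schwartz_bound (invF ψ) M N
  refine ⟨D * (C' * 3 ^ M) + C, fun k hk => ?_⟩
  -- the low frequencies: near `p = 0` the function `invF ψ (p - k)` decreases rapidly in `k`
  have h2 := hu (modulate ψ k) (C' * 3 ^ M * ((1 + ‖k‖) ^ M)⁻¹) fun n hn p hp => by
    rw [invF_modulate_eq]
    have e2 : (SchwartzMap.compSubConstCLM ℂ k (invF ψ) : Mink → ℂ) = fun p => invF ψ (p - k) := by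
      funext p
      rw [SchwartzMap.compSubConstCLM_apply]
    rw [e2, iteratedFDeriv_comp_sub]
    refine (hf n hn _).trans ?_
    rw [mul_assoc]
    gcongr
    rw [← div_eq_mul_inv, ← one_div, div_le_div_iff₀ (by positivity) (by positivity), one_mul,
      ← mul_pow]
    refine pow_le_pow_left₀ (by positivity) ?_ M
    have h3 := norm_sub_norm_le k p
    rw [norm_sub_rev] at h3
    nlinarith [norm_nonneg (p - k)]
  have h3 : ‖u (modulate ψ k)‖ ≤ D * (C' * 3 ^ M * ((1 + ‖k‖) ^ M)⁻¹) +
      ‖scalarLim m (SchwartzMap.smulLeftCLM ℂ b (invF (modulate ψ k)))‖ := by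
    have := norm_le_insert' (u (modulate ψ k))
      (scalarLim m (SchwartzMap.smulLeftCLM ℂ b (invF (modulate ψ k))))
    linarith
  calc (1 + ‖k‖) ^ M * ‖u (modulate ψ k)‖ ≤ (1 + ‖k‖) ^ M * (D * (C' * 3 ^ M * ((1 + ‖k‖) ^ M)⁻¹) +
      ‖scalarLim m (SchwartzMap.smulLeftCLM ℂ b (invF (modulate ψ k)))‖) := by gcongr
    _ = D * (C' * 3 ^ M) + (1 + ‖k‖) ^ M *
      ‖scalarLim m (SchwartzMap.smulLeftCLM ℂ b (invF (modulate ψ k)))‖ := by field_simp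
    _ ≤ _ := by gcongr; exact hC k hk

theorem exists_norm_scalarLim_invF_modulate_le (m : ℝ) (ψ : 𝓢(Mink, ℂ)) :
    ∃ (K : ℕ) (C : ℝ), ∀ k, ‖scalarLim m (invF (modulate ψ k))‖ ≤ C * (1 + ‖k‖) ^ K := by
  obtain ⟨K, hK⟩ := exists_norm_scalarLim_translateMul_le m
  have h := (isSymbol_const 1).isTranslateFamily
  obtain ⟨C, hC⟩ := hK _ _ h (invF ψ)
  refine ⟨K, C, fun k => ?_⟩
  have e1 : translateMul (fun _ _ => 1) (invF ψ) k = invF (modulate ψ k) := by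
    ext p
    rw [h.translateMul_apply, invF_modulate_eq, SchwartzMap.compSubConstCLM_apply, one_mul]
  have := hC k
  rw [e1] at this
  simpa using this

/-- A test function localized in a half space makes the scalar propagator decrease rapidly in the
opposite half space of directions. -/
theorem rapidlyDecreasingOn_scalarLim_modulate {n : Mink} {c : ℝ} (hc : 0 < c) (m : ℝ)
    {ψ : 𝓢(Mink, ℂ)} (hψ : HasCompactSupport ψ) (hsupp : ∀ x ∈ tsupport ψ, inner ℝ n x ≤ -c) :
    RapidlyDecreasingOn (fun k => scalarLim m (invF (modulate ψ k)))
      {k | c * ‖k‖ ≤ inner ℝ n k} := by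
  intro N
  obtain ⟨C, hC, h⟩ := exists_norm_scalarLim_modulate_le hc m (ψ.smooth ⊤) hψ hsupp N
  obtain ⟨K, C', h'⟩ := exists_norm_scalarLim_invF_modulate_le m ψ
  refine ⟨2 ^ N * C + 2 ^ N * (|C'| * 2 ^ K), fun k hk => ?_⟩
  rcases le_or_gt 1 ‖k‖ with hk1 | hk1
  · have h1 := h k (modulate ψ k) (modulate_apply ψ k) hk hk1
    calc (1 + ‖k‖) ^ N * ‖scalarLim m (invF (modulate ψ k))‖ ≤ (2 * ‖k‖) ^ N * (C / ‖k‖ ^ N) := by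
          gcongr; linarith
      _ = 2 ^ N * C := by rw [mul_pow]; field_simp
      _ ≤ _ := by have : 0 ≤ 2 ^ N * (|C'| * 2 ^ K) := by positivity
                  linarith
  · calc (1 + ‖k‖) ^ N * ‖scalarLim m (invF (modulate ψ k))‖ ≤ 2 ^ N * (|C'| * 2 ^ K) := by
          gcongr
          · linarith
          · refine (h' k).trans ?_
            gcongr
            · exact le_abs_self _
            · linarith
      _ ≤ _ := by have : 0 ≤ 2 ^ N * C := by positivity
                  linarith

theorem IsFeynmanPropagator.apply_eq {m : ℝ} {v : 𝓢'(Mink, ℂ)} (hv : IsFeynmanPropagator m v)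
    (φ : 𝓢(Mink, ℂ)) : v φ = scalarLim m (invF φ) := by
  refine tendsto_nhds_unique (hv φ) ((tendsto_scalarReg m (invF φ)).congr fun δ => ?_)
  refine integral_congr_ae (Eventually.of_forall fun p => ?_)
  simp only [evalPoly, map_one, map_zero, add_zero, invF_apply]
  ring

end Modulation

section TestFunctions

variable {Ω : Opens Mink}

theorem evalC_restrict (u : 𝓢'(Mink, ℂ)) (φ : 𝓓(Ω, ℂ)) :
    evalC (restrict Ω u) φ = u (testToSchwartz φ) := by
  change u (testToSchwartz _) + Complex.I * u (testToSchwartz _) = _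
  rw [← smul_eq_mul, ← map_smul, ← map_add]
  congr 1
  ext x
  change ((φ x).re : ℂ) + Complex.I * ((φ x).im : ℂ) = φ x
  rw [mul_comm, Complex.re_add_im]

theorem localFourier_restrict (u : 𝓢'(Mink, ℂ)) (φ : 𝓓(Ω, ℂ)) (k : Mink) :
    localFourier (restrict Ω u) φ k = u (modulate (testToSchwartz φ) k) := by
  rw [localFourier, evalC_restrict]
  congr 1
  ext x
  rw [modulate_apply]
  rfl

/-- A test function equal to `1` near a compact set. -/
theorem exists_testFunction_eq_one {K O : Set Mink} (hK : IsCompact K) (hO : IsOpen O)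
    (hKO : K ⊆ O) (hOΩ : O ⊆ Ω) :
    ∃ χ : 𝓓(Ω, ℂ), tsupport χ ⊆ O ∧ ∀ᶠ x in 𝓝ˢ K, χ x = 1 := by
  obtain ⟨L, hL, hKL, hLO⟩ := exists_compact_between hK hO hKO
  obtain ⟨f, hf0, hf1, -⟩ := exists_contMDiffMap_zero_one_nhds_of_isClosed
    (n := (⊤ : ℕ∞)) (modelWithCornersSelf ℝ Mink) (s := (interior L)ᶜ) (t := K)
    isOpen_interior.isClosed_compl hK.isClosed (by
      rw [Set.disjoint_left]
      exact fun x hx hxK => hx (hKL hxK))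
  have hsub : tsupport f ⊆ L := by
    refine closure_minimal (fun x hx => ?_) hL.isClosed
    by_contra hxL
    exact hx (hf0.self_of_nhdsSet x fun h => hxL (interior_subset h))
  have hcd : ContDiff ℝ ∞ fun x => (f x : ℂ) :=
    Complex.ofRealCLM.contDiff.comp f.contMDiff.contDiff
  have hs : tsupport (fun x => (f x : ℂ)) ⊆ L := by
    refine (closure_mono fun x hx => ?_).trans hsub
    rw [Function.mem_support] at hx ⊢
    exact fun h => hx (by rw [h, Complex.ofReal_zero])
  refine ⟨⟨fun x => (f x : ℂ), hcd, hL.of_isClosed_subset (isClosed_tsupport _) hs,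
    hs.trans (hLO.trans hOΩ)⟩, hs.trans hLO, ?_⟩
  filter_upwards [hf1] with x hx
  change (f x : ℂ) = 1
  rw [hx, Complex.ofReal_one]

theorem exists_testFunction_ne_zero {O : Set Mink} (hO : IsOpen O) {x : Mink} (hx : x ∈ O)
    (hxΩ : x ∈ Ω) : ∃ χ : 𝓓(Ω, ℂ), tsupport χ ⊆ O ∧ χ x ≠ 0 := by
  obtain ⟨χ, h1, h2⟩ := exists_testFunction_eq_one (Ω := Ω) (K := {x}) (O := O ∩ Ω)
    isCompact_singleton (hO.inter Ω.isOpen) (by simpa using ⟨hx, hxΩ⟩) Set.inter_subset_right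
  refine ⟨χ, h1.trans Set.inter_subset_left, ?_⟩
  rw [h2.self_of_nhdsSet x rfl]
  exact one_ne_zero

/-- The wavefront set of a distribution whose momentum-space kernel is that of the scalar Feynman
propagator multiplied by a symbol. -/
theorem HasSymbol.WF_restrict_subset {m : ℝ} {d : ℕ} {b : Mink → ℂ} {u v : 𝓢'(Mink, ℂ)}
    (hu : HasSymbol m b u) (hb : IsSymbol d b) (hv : IsFeynmanPropagator m v) :
    WF (restrict ⊤ u) ⊆ WF (restrict ⊤ v) := by
  rintro ⟨x, k⟩ hxk
  by_contra hcon
  obtain ⟨-, hk, hWF⟩ := hxk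
  obtain ⟨O, hO, hxO, V, hV, hkV, hVc, hr⟩ :=
    exists_rapidlyDecreasingOn_of_notMem_WF (restrict ⊤ v) (Set.mem_univ x) hk hcon
  obtain ⟨χ, hχO, hχx⟩ := exists_testFunction_ne_zero (Ω := ⊤) hO hxO (Set.mem_univ x)
  refine (hWF χ hχx).2 ⟨V, hV, hkV, hVc, ?_⟩
  have h1 := hu.rapidlyDecreasingOn_modulate hb (O := O) (V := V) (fun ψ hψ hψO => by
    have := hr ⟨ψ, ψ.smooth ⊤, hψ, Set.subset_univ _⟩ hψO
    intro N
    obtain ⟨C, hC⟩ := this N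
    refine ⟨C, fun k hk => ?_⟩
    change (1 + ‖k‖) ^ N * ‖scalarLim m (invF (modulate ψ k))‖ ≤ C
    rw [← hv.apply_eq]
    have := hC k hk
    rw [localFourier_restrict] at this
    exact this) (ψ := testToSchwartz χ) χ.hasCompactSupport hχO
  intro N
  obtain ⟨C, hC⟩ := h1 N
  refine ⟨C, fun k hk => ?_⟩
  rw [localFourier_restrict]
  exact hC k hk

end TestFunctions

section HalfSpaces

/-- Localizing `u` in an open half space `{n · x < 0}` makes its Fourier transform decrease rapidly
on closed cones inside `{n · k > 0} ∪ {0}`, for all `n`. This is a uniform form of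
`WF u ⊆ {(x, λx) | λ > 0}`. -/
def IsHalfSpaceRegular (u : 𝓓'(punctured, ℂ)) : Prop :=
  ∀ (n : Mink) (φ : 𝓓(punctured, ℂ)), (∀ x ∈ tsupport φ, inner ℝ n x < 0) → ∀ c : ℝ, 0 < c →
    RapidlyDecreasingOn (localFourier u φ) {k | c * ‖k‖ ≤ inner ℝ n k}

theorem RapidlyDecreasingOn.mono {g : Mink → ℂ} {V W : Set Mink} (h : RapidlyDecreasingOn g W)
    (hVW : V ⊆ W) : RapidlyDecreasingOn g V := fun N =>
  let ⟨C, hC⟩ := h N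
  ⟨C, fun k hk => hC k (hVW hk)⟩

theorem RapidlyDecreasingOn.union {g : Mink → ℂ} {V W : Set Mink} (hV : RapidlyDecreasingOn g V)
    (hW : RapidlyDecreasingOn g W) : RapidlyDecreasingOn g (V ∪ W) := by
  intro N
  obtain ⟨C, hC⟩ := hV N
  obtain ⟨D, hD⟩ := hW N
  refine ⟨max C D, ?_⟩
  rintro k (hk | hk)
  · exact (hC k hk).trans (le_max_left _ _)
  · exact (hD k hk).trans (le_max_right _ _)

theorem RapidlyDecreasingOn.iUnion {ι : Type*} [Fintype ι] {g : Mink → ℂ} {V : ι → Set Mink}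
    (h : ∀ i, RapidlyDecreasingOn g (V i)) : RapidlyDecreasingOn g (⋃ i, V i) := by
  intro N
  choose C hC using fun i => h i N
  refine ⟨∑ i, |C i|, fun k hk => ?_⟩
  obtain ⟨i, hi⟩ := Set.mem_iUnion.mp hk
  exact ((hC i k hi).trans (le_abs_self _)).trans
    (Finset.single_le_sum (f := fun i => |C i|) (fun i _ => abs_nonneg _) (Finset.mem_univ i))

/-- The support is compact, so it is at a positive distance from the boundary of the half space. -/
theorem HasSymbol.isHalfSpaceRegular {m : ℝ} {d : ℕ} {b : Mink → ℂ} {u : 𝓢'(Mink, ℂ)}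
    (hu : HasSymbol m b u) (hb : IsSymbol d b) : IsHalfSpaceRegular (restrict punctured u) := by
  intro n φ hφ c hc
  obtain ⟨c', hc', hc'c, hsupp⟩ : ∃ c' > 0, c' ≤ c ∧ ∀ x ∈ tsupport φ, inner ℝ n x ≤ -c' := by
    rcases (tsupport φ).eq_empty_or_nonempty with h | h
    · exact ⟨c, hc, le_rfl, by simp [h]⟩
    · obtain ⟨x, hx, hmax⟩ := φ.hasCompactSupport.isCompact.exists_isMaxOn h
        (f := fun x => (inner ℝ n x : ℝ)) (by fun_prop)
      refine ⟨min c (-(inner ℝ n x)), lt_min hc (neg_pos.mpr (hφ x hx)), min_le_left _ _,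
        fun y hy => ?_⟩
      have h1 : inner ℝ n y ≤ inner ℝ n x := hmax hy
      have h2 := min_le_right c (-(inner ℝ n x))
      linarith
  have h1 := hu.rapidlyDecreasingOn_modulate hb (O := {x | inner ℝ n x ≤ -c'})
    (fun ψ hψ hψO => rapidlyDecreasingOn_scalarLim_modulate hc' m hψ hψO)
    (ψ := testToSchwartz φ) φ.hasCompactSupport hsupp
  intro N
  obtain ⟨C, hC⟩ := h1 N
  refine ⟨C, fun k hk => ?_⟩
  rw [localFourier_restrict]
  have hk : c * ‖k‖ ≤ inner ℝ n k := hk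
  refine hC k (show c' * ‖k‖ ≤ inner ℝ n k from le_trans ?_ hk)
  gcongr

/-- The only directions over `x` in the wavefront set are the positive multiples of `x`. -/
theorem IsHalfSpaceRegular.exists_smul_of_mem_WF {u : 𝓓'(punctured, ℂ)} (hu : IsHalfSpaceRegular u)
    {x k : Mink} (h : (x, k) ∈ WF u) : ∃ r : ℝ, 0 < r ∧ k = r • x := by
  obtain ⟨hx, hk, hWF⟩ := h
  have hx0 : x ≠ 0 := hx
  have hx' : 0 < ‖x‖ := norm_pos_iff.mpr hx0
  have hk' : 0 < ‖k‖ := norm_pos_iff.mpr hk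
  by_contra hcon
  have hlt : inner ℝ x k < ‖x‖ * ‖k‖ := by
    refine lt_of_le_of_ne (real_inner_le_norm x k) fun heq => hcon ?_
    rw [inner_eq_norm_mul_iff_real] at heq
    refine ⟨‖k‖ / ‖x‖, by positivity, ?_⟩
    rw [div_eq_inv_mul, mul_smul, heq, smul_smul, inv_mul_cancel₀ hx'.ne', one_smul]
  -- if `k` is not on the ray through `x`, this `n` separates the two: `n·x < 0 < n·k`
  set n : Mink := ‖x‖ • k - ‖k‖ • x with hn
  have h1 : inner ℝ n x < 0 := by
    rw [hn, inner_sub_left, inner_smul_left, inner_smul_left, real_inner_self_eq_norm_sq,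
      real_inner_comm]
    simp only [conj_trivial]
    nlinarith
  have h2 : 0 < inner ℝ n k := by
    rw [hn, inner_sub_left, inner_smul_left, inner_smul_left, real_inner_self_eq_norm_sq]
    simp only [conj_trivial]
    nlinarith
  obtain ⟨χ, hχO, hχx⟩ := exists_testFunction_ne_zero (Ω := punctured)
    (O := {y | inner ℝ n y < 0}) (isOpen_lt (by fun_prop) continuous_const) h1 hx
  set c := inner ℝ n k / (2 * ‖k‖) with hc
  have hc0 : 0 < c := by positivity
  refine (hWF χ hχx).2 ⟨{l | c * ‖l‖ < inner ℝ n l}, isOpen_lt (by fun_prop) (by fun_prop), ?_, ?_,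
    (hu n χ (fun y hy => hχO hy) c hc0).mono fun l (hl : c * ‖l‖ < inner ℝ n l) =>
      show c * ‖l‖ ≤ inner ℝ n l from hl.le⟩
  · change c * ‖k‖ < inner ℝ n k
    rw [hc]
    field_simp
    linarith
  · intro t ht l hl
    change c * ‖t • l‖ < inner ℝ n (t • l)
    rw [norm_smul, Real.norm_of_nonneg ht.le, inner_smul_right]
    have : c * ‖l‖ < inner ℝ n l := hl
    nlinarith

/-- Two distributions regular in this sense satisfy Hörmander's criterion. -/
theorem IsHalfSpaceRegular.notMem_WF {u v : 𝓓'(punctured, ℂ)} (hu : IsHalfSpaceRegular u)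
    (hv : IsHalfSpaceRegular v) (x k : Mink) (h : (x, k) ∈ WF u) : (x, -k) ∉ WF v := by
  intro h'
  obtain ⟨r, hr, h1⟩ := hu.exists_smul_of_mem_WF h
  obtain ⟨s, hs, h2⟩ := hv.exists_smul_of_mem_WF h'
  have hx0 : x ≠ 0 := h.1
  have h3 : (r + s) • x = 0 := by rw [add_smul, ← h1, ← h2, add_neg_cancel]
  rcases smul_eq_zero.mp h3 with h4 | h4
  · linarith
  · exact hx0 h4

/-- The unit vectors on the positive and negative coordinate axes. -/
def axis (j : Fin 4 × Bool) : Mink := EuclideanSpace.single j.1 (if j.2 then (1 : ℝ) else -1)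

theorem exists_le_inner_axis (x : Mink) : ∃ j, 1 / 2 * ‖x‖ ≤ inner ℝ (axis j) x := by
  obtain ⟨i, hi⟩ : ∃ i, ‖x‖ / 2 ≤ |x i| := by
    by_contra hcon
    push Not at hcon
    have h5 : ‖x‖ ^ 2 = ∑ i, x i ^ 2 := by
      rw [EuclideanSpace.norm_sq_eq]; simp
    have h6 : ∀ i, x i ^ 2 < (‖x‖ / 2) ^ 2 := fun i => by
      rw [← sq_abs]; exact pow_lt_pow_left₀ (hcon i) (abs_nonneg _) two_ne_zero
    have h7 : ∑ i, x i ^ 2 < ∑ _i : Fin 4, (‖x‖ / 2) ^ 2 :=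
      Finset.sum_lt_sum_of_nonempty Finset.univ_nonempty fun i _ => h6 i
    simp at h7
    linarith
  refine ⟨(i, decide (0 ≤ x i)), ?_⟩
  have h8 : (if decide (0 ≤ x i) then (1 : ℝ) else -1) * x i = |x i| := by
    by_cases h : 0 ≤ x i
    · simp [h, abs_of_nonneg h]
    · simp [h, abs_of_neg (not_le.mp h)]
  rw [axis, EuclideanSpace.inner_single_left]
  simp only [conj_trivial, h8]
  linarith

/-- Localizing in a proper cone around `n` confines the non-decreasing directions to a proper cone
around `n`: if `n · k ≤ b/4 ‖k‖`, then `-n + b e` with a suitable half-axis `e` defines a half space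
containing `k`, while it is negative on the support. -/
theorem IsHalfSpaceRegular.rapidlyDecreasingOn_of_cone {u : 𝓓'(punctured, ℂ)}
    (hu : IsHalfSpaceRegular u) {n : Mink} {b : ℝ} (hb : 0 < b) {φ : 𝓓(punctured, ℂ)}
    (hφ : ∀ x ∈ tsupport φ, b * ‖x‖ < inner ℝ n x) :
    RapidlyDecreasingOn (localFourier u φ) {k | inner ℝ n k ≤ b / 4 * ‖k‖} := by
  have h1 : ∀ j, RapidlyDecreasingOn (localFourier u φ)
      {k | b / 4 * ‖k‖ ≤ inner ℝ (-n + b • axis j) k} := by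
    intro j
    refine hu _ φ (fun x hx => ?_) _ (by positivity)
    have h2 := hφ x hx
    have h3 := real_inner_le_norm (axis j) x
    have h4 : ‖axis j‖ = 1 := by
      rw [axis, PiLp.norm_single]; split_ifs <;> simp
    rw [h4, one_mul] at h3
    rw [inner_add_left, inner_neg_left, inner_smul_left]
    simp only [conj_trivial]
    nlinarith
  refine (RapidlyDecreasingOn.iUnion h1).mono fun k hk => ?_
  have hk : inner ℝ n k ≤ b / 4 * ‖k‖ := hk
  obtain ⟨j, hj⟩ := exists_le_inner_axis k
  rw [Set.mem_iUnion]
  refine ⟨j, ?_⟩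
  change b / 4 * ‖k‖ ≤ inner ℝ _ k
  rw [inner_add_left, inner_neg_left, inner_smul_left]
  simp only [conj_trivial]
  nlinarith

end HalfSpaces

/-! ### Convolution of localized Fourier transforms -/

section Convolution

/-- Polynomial boundedness. -/
def IsPolyBounded (f : Mink → ℂ) : Prop :=
  ∃ (N : ℕ) (C : ℝ), 0 ≤ C ∧ ∀ k, ‖f k‖ ≤ C * (1 + ‖k‖) ^ N

theorem integrable_inv_one_add_norm_pow :
    Integrable fun l : Mink => ((1 + ‖l‖) ^ 5)⁻¹ := by
  have := integrable_one_add_norm (E := Mink) (μ := volume) (r := 5) (by simp; norm_num)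
  refine this.congr (Eventually.of_forall fun l => ?_)
  simp only
  rw [Real.rpow_neg (by positivity)]
  norm_cast

/-- The integrand of the convolution of `f` and `g` is dominated by an integrable function, up to a
polynomial in the argument. -/
def IsConvolvable (f g : Mink → ℂ) : Prop :=
  ∃ (N : ℕ) (C : ℝ), 0 ≤ C ∧ ∀ k l,
    ‖f l‖ * ‖g (k - l)‖ ≤ C * (1 + ‖k‖) ^ N * ((1 + ‖l‖) ^ 5)⁻¹

/-- If the non-decreasing directions of `f` and `g` lie in a common proper cone, then `l` and
`k - l` are both in that cone only for `‖l‖ = O(‖k‖)`. -/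
theorem isConvolvable_of_cone {f g : Mink → ℂ} (hf : IsPolyBounded f) (hg : IsPolyBounded g)
    {n : Mink} {b : ℝ} (hb : 0 < b) (hfn : RapidlyDecreasingOn f {k | inner ℝ n k ≤ b * ‖k‖})
    (hgn : RapidlyDecreasingOn g {k | inner ℝ n k ≤ b * ‖k‖}) : IsConvolvable f g := by
  obtain ⟨N, C, hC, hf⟩ := hf
  obtain ⟨N', C', hC', hg⟩ := hg
  obtain ⟨D, hD⟩ := hfn (N' + 5)
  obtain ⟨D', hD'⟩ := hgn (N + 5)
  set A := 1 + ‖n‖ / b with hA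
  have hA1 : 1 ≤ A := by
    have : 0 ≤ ‖n‖ / b := by positivity
    linarith
  set E := C' * |D| + C * |D'| + C * C' * A ^ (N + 5 + N') with hE
  have E1 : 0 ≤ C' * |D| := by positivity
  have E2 : 0 ≤ C * |D'| := by positivity
  have E3 : 0 ≤ C * C' * A ^ (N + 5 + N') := by positivity
  refine ⟨N + N' + 5, E, by positivity, fun k l => ?_⟩
  set r := 1 + ‖k‖
  set s := 1 + ‖l‖
  set t := 1 + ‖k - l‖
  have hr : 1 ≤ r := by linarith [norm_nonneg k]
  have hs : 1 ≤ s := by linarith [norm_nonneg l]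
  have ht : 1 ≤ t := by linarith [norm_nonneg (k - l)]
  have hts : t ≤ r * s := by
    have := one_add_norm_add_le_mul k (-l)
    rwa [norm_neg, ← sub_eq_add_neg] at this
  have hst : s ≤ r * t := by
    have := one_add_norm_add_le_mul k (-(k - l))
    rwa [norm_neg, ← sub_eq_add_neg, sub_sub_cancel] at this
  rw [← div_eq_mul_inv, le_div_iff₀ (by positivity)]
  have hrN : r ^ N' ≤ r ^ (N + N' + 5) := pow_le_pow_right₀ hr (by omega)
  have hrN' : r ^ (N + 5) ≤ r ^ (N + N' + 5) := pow_le_pow_right₀ hr (by omega)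
  -- either `f` decreases at `l`, or `g` decreases at `k - l`, or both arguments are `O(‖k‖)`
  by_cases h1 : inner ℝ n l ≤ b * ‖l‖
  · have a1 := (hD l h1).trans (le_abs_self D)
    calc ‖f l‖ * ‖g (k - l)‖ * s ^ 5 ≤ ‖f l‖ * (C' * (r * s) ^ N') * s ^ 5 := by
          gcongr
          refine (hg _).trans ?_
          gcongr
      _ = C' * (s ^ (N' + 5) * ‖f l‖) * r ^ N' := by rw [mul_pow, pow_add]; ring
      _ ≤ C' * |D| * r ^ N' := by gcongr
      _ ≤ E * r ^ (N + N' + 5) := by gcongr; linarith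
  by_cases h2 : inner ℝ n (k - l) ≤ b * ‖k - l‖
  · have a1 := (hD' _ h2).trans (le_abs_self D')
    calc ‖f l‖ * ‖g (k - l)‖ * s ^ 5 ≤ (C * s ^ N) * ‖g (k - l)‖ * s ^ 5 := by
          gcongr
          exact hf l
      _ = C * s ^ (N + 5) * ‖g (k - l)‖ := by rw [pow_add]; ring
      _ ≤ C * (r * t) ^ (N + 5) * ‖g (k - l)‖ := by gcongr
      _ = C * (t ^ (N + 5) * ‖g (k - l)‖) * r ^ (N + 5) := by rw [mul_pow]; ring
      _ ≤ C * |D'| * r ^ (N + 5) := by gcongr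
      _ ≤ E * r ^ (N + N' + 5) := by gcongr; linarith
  · push Not at h1 h2
    have h3 := real_inner_le_norm n k
    rw [inner_sub_right] at h2
    have h4 : ‖l‖ ≤ ‖n‖ / b * ‖k‖ := by
      rw [div_mul_eq_mul_div, le_div_iff₀ hb]
      nlinarith [norm_nonneg (k - l)]
    have h5 : ‖k - l‖ ≤ ‖n‖ / b * ‖k‖ := by
      rw [div_mul_eq_mul_div, le_div_iff₀ hb]
      nlinarith [norm_nonneg l]
    have h6 : s ≤ A * r := by
      have : 0 ≤ ‖n‖ / b := by positivity
      change 1 + ‖l‖ ≤ (1 + ‖n‖ / b) * (1 + ‖k‖)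
      nlinarith [norm_nonneg k]
    calc ‖f l‖ * ‖g (k - l)‖ * s ^ 5 ≤ (C * s ^ N) * ‖g (k - l)‖ * s ^ 5 := by
          gcongr
          exact hf l
      _ = C * s ^ (N + 5) * ‖g (k - l)‖ := by rw [pow_add]; ring
      _ ≤ C * (A * r) ^ (N + 5) * (C' * (A * r) ^ N') := by
          gcongr
          refine (hg _).trans ?_
          gcongr
          change 1 + ‖k - l‖ ≤ (1 + ‖n‖ / b) * (1 + ‖k‖)
          have : 0 ≤ ‖n‖ / b := by positivity
          nlinarith [norm_nonneg k]
      _ = C * C' * A ^ (N + 5 + N') * r ^ (N + N' + 5) := by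
          rw [mul_pow, mul_pow, pow_add A, show N + N' + 5 = (N + 5) + N' by ring, pow_add r]; ring
      _ ≤ E * r ^ (N + N' + 5) := by
          gcongr
          linarith

/-- If for `k` in `T` one of the two factors is rapidly decreasing at an argument of size at least
`‖k‖ / A`, then the convolution is rapidly decreasing on `T`. -/
theorem rapidlyDecreasingOn_convolution {f g : Mink → ℂ} (hf : IsPolyBounded f)
    (hg : IsPolyBounded g) {Z T : Set Mink} (hfZ : RapidlyDecreasingOn f Z)
    (hgZ : RapidlyDecreasingOn g Z) {A : ℝ} (hA : 0 ≤ A)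
    (hT : ∀ k ∈ T, ∀ l, (l ∈ Z ∧ 1 + ‖k‖ ≤ A * (1 + ‖l‖)) ∨
      (k - l ∈ Z ∧ 1 + ‖k‖ ≤ A * (1 + ‖k - l‖))) :
    RapidlyDecreasingOn (fun k => ∫ l, f l * g (k - l)) T := by
  intro M
  obtain ⟨N, C, hC, hf⟩ := hf
  obtain ⟨N', C', hC', hg⟩ := hg
  obtain ⟨D, hD⟩ := hfZ (N' + M + (N' + 5))
  obtain ⟨D', hD'⟩ := hgZ (N + 5 + M + (N + 5))
  set E := C' * A ^ (N' + M) * |D| + C * A ^ (N + 5 + M) * |D'| with hE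
  have E1 : 0 ≤ C' * A ^ (N' + M) * |D| := by positivity
  have E2 : 0 ≤ C * A ^ (N + 5 + M) * |D'| := by positivity
  refine ⟨∫ l : Mink, E * ((1 + ‖l‖) ^ 5)⁻¹, fun k hk => ?_⟩
  have e : (1 + ‖k‖) ^ M * ‖∫ l, f l * g (k - l)‖ =
      ‖∫ l, ((1 + ‖k‖) ^ M : ℝ) • (f l * g (k - l))‖ := by
    rw [integral_smul, norm_smul, Real.norm_of_nonneg (by positivity)]
  rw [e]
  refine norm_integral_le_of_norm_le (integrable_inv_one_add_norm_pow.const_mul E)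
    (Eventually.of_forall fun l => ?_)
  rw [norm_smul, Real.norm_of_nonneg (by positivity), norm_mul]
  have hT' := hT k hk l
  set r := 1 + ‖k‖
  set s := 1 + ‖l‖
  set t := 1 + ‖k - l‖
  have hr : 1 ≤ r := by linarith [norm_nonneg k]
  have hs : 1 ≤ s := by linarith [norm_nonneg l]
  have ht : 1 ≤ t := by linarith [norm_nonneg (k - l)]
  have hts : t ≤ r * s := by
    have := one_add_norm_add_le_mul k (-l)
    rwa [norm_neg, ← sub_eq_add_neg] at this
  have hst : s ≤ r * t := by
    have := one_add_norm_add_le_mul k (-(k - l))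
    rwa [norm_neg, ← sub_eq_add_neg, sub_sub_cancel] at this
  rw [← div_eq_mul_inv, le_div_iff₀ (by positivity)]
  rcases hT' with ⟨hl, hrs⟩ | ⟨hl, hrt⟩
  · have a1 := (hD l hl).trans (le_abs_self D)
    calc r ^ M * (‖f l‖ * ‖g (k - l)‖) * s ^ 5
        ≤ r ^ M * (‖f l‖ * (C' * (r * s) ^ N')) * s ^ 5 := by
          gcongr
          refine (hg _).trans ?_
          gcongr
      _ = C' * r ^ (N' + M) * (s ^ (N' + 5) * ‖f l‖) := by
          rw [mul_pow, pow_add, pow_add]; ring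
      _ ≤ C' * (A * s) ^ (N' + M) * (s ^ (N' + 5) * ‖f l‖) := by gcongr
      _ = C' * A ^ (N' + M) * (s ^ (N' + M + (N' + 5)) * ‖f l‖) := by
          rw [mul_pow, pow_add s (N' + M)]; ring
      _ ≤ C' * A ^ (N' + M) * |D| := by gcongr
      _ ≤ E := by linarith
  · have a1 := (hD' _ hl).trans (le_abs_self D')
    calc r ^ M * (‖f l‖ * ‖g (k - l)‖) * s ^ 5
        ≤ r ^ M * ((C * (r * t) ^ N) * ‖g (k - l)‖) * (r * t) ^ 5 := by
          gcongr
          refine (hf _).trans ?_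
          gcongr
      _ = C * r ^ (N + 5 + M) * (t ^ (N + 5) * ‖g (k - l)‖) := by
          rw [mul_pow, mul_pow, pow_add, pow_add, pow_add]; ring
      _ ≤ C * (A * t) ^ (N + 5 + M) * (t ^ (N + 5) * ‖g (k - l)‖) := by gcongr
      _ = C * A ^ (N + 5 + M) * (t ^ (N + 5 + M + (N + 5)) * ‖g (k - l)‖) := by
          rw [mul_pow, pow_add t (N + 5 + M)]; ring
      _ ≤ C * A ^ (N + 5 + M) * |D'| := by gcongr
      _ ≤ E := by linarith

/-- The geometry behind the wavefront set of a product: if `l` and `k - l` lie in the proper cone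
`n · l > b ‖l‖`, and `m · k ≥ c ‖k‖`, then `m · l` or `m · (k - l)` is positive with a margin. -/
theorem exists_cone_split {n m : Mink} {b c : ℝ} (hb : 0 < b) (hc : 0 < c) :
    ∃ c' A : ℝ, 0 < c' ∧ 0 ≤ A ∧ ∀ k : Mink, c * ‖k‖ ≤ inner ℝ m k → ∀ l : Mink,
      ((inner ℝ n l ≤ b * ‖l‖ ∨ c' * ‖l‖ ≤ inner ℝ m l) ∧ 1 + ‖k‖ ≤ A * (1 + ‖l‖)) ∨
      ((inner ℝ n (k - l) ≤ b * ‖k - l‖ ∨ c' * ‖k - l‖ ≤ inner ℝ m (k - l)) ∧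
        1 + ‖k‖ ≤ A * (1 + ‖k - l‖)) := by
  have hn0 : 0 < ‖n‖ + 1 := by positivity
  have hm0 : 0 < ‖m‖ + 1 := by positivity
  set c' := min (c / 4) (c * b / (‖n‖ + 1)) with hc'
  set ε := min (1 / 2) (c / (2 * (‖m‖ + 1))) with hε
  have hc'0 : 0 < c' := lt_min (by positivity) (by positivity)
  have hε0 : 0 < ε := lt_min (by norm_num) (by positivity)
  have hc1 : c' ≤ c / 4 := min_le_left _ _
  have hc2 : c' * (‖n‖ + 1) ≤ c * b := by
    rw [← le_div_iff₀ hn0]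
    exact min_le_right _ _
  have hε1 : ε ≤ 1 / 2 := min_le_left _ _
  have hε2 : ε * (2 * (‖m‖ + 1)) ≤ c := by
    rw [← le_div_iff₀ (by positivity)]
    exact min_le_right _ _
  have hsize : ∀ k l : Mink, ε * ‖k‖ ≤ ‖l‖ → 1 + ‖k‖ ≤ ε⁻¹ * (1 + ‖l‖) := by
    intro k l h
    rw [inv_mul_eq_div, le_div_iff₀ hε0]
    nlinarith
  have hsmall : ∀ k : Mink, c * ‖k‖ ≤ inner ℝ m k → ∀ q : Mink, ‖q‖ ≤ ε * ‖k‖ →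
      c' * ‖k - q‖ ≤ inner ℝ m (k - q) ∧ ε * ‖k‖ ≤ ‖k - q‖ := by
    intro k hk q hq
    have h1 := norm_sub_le k q
    have h2 := norm_sub_norm_le k q
    have h3 := real_inner_le_norm m q
    have h4 : ‖m‖ * ‖q‖ ≤ ‖m‖ * (ε * ‖k‖) := by gcongr
    have h5 : ε * ‖k‖ ≤ 1 / 2 * ‖k‖ := by gcongr
    have h6 : ε * (2 * (‖m‖ + 1)) * ‖k‖ ≤ c * ‖k‖ := by gcongr
    have h8 : c' * ‖k - q‖ ≤ c / 4 * (2 * ‖k‖) := by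
      refine mul_le_mul hc1 (by linarith [norm_nonneg k]) (norm_nonneg _) (by positivity)
    have h9 : 0 ≤ ε * ‖k‖ := by positivity
    rw [inner_sub_right]
    constructor <;> nlinarith
  refine ⟨c', ε⁻¹, hc'0, by positivity, fun k hk l => ?_⟩
  -- if one of `l`, `k - l` is small compared with `k`, then the other is close to `k`
  rcases le_total ‖l‖ (ε * ‖k‖) with h1 | h1
  · obtain ⟨a1, a2⟩ := hsmall k hk l h1
    exact Or.inr ⟨Or.inr a1, hsize k _ a2⟩
  rcases le_total ‖k - l‖ (ε * ‖k‖) with h2 | h2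
  · obtain ⟨a1, a2⟩ := hsmall k hk (k - l) h2
    rw [sub_sub_cancel] at a1 a2
    exact Or.inl ⟨Or.inr a1, hsize k _ a2⟩
  by_contra hcon
  push Not at hcon
  have h3 : ¬(inner ℝ n l ≤ b * ‖l‖ ∨ c' * ‖l‖ ≤ inner ℝ m l) := fun h =>
    absurd (hsize k l h1) (not_le.mpr (hcon.1 h))
  have h4 : ¬(inner ℝ n (k - l) ≤ b * ‖k - l‖ ∨ c' * ‖k - l‖ ≤ inner ℝ m (k - l)) := fun h =>
    absurd (hsize k _ h2) (not_le.mpr (hcon.2 h))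
  push Not at h3 h4
  obtain ⟨a1, a2⟩ := h3
  obtain ⟨a3, a4⟩ := h4
  rw [inner_sub_right] at a3 a4
  have h5 := real_inner_le_norm n k
  have h6 : b * (‖l‖ + ‖k - l‖) ≤ ‖n‖ * ‖k‖ := by linarith
  have h7 : c * ‖k‖ < c' * (‖l‖ + ‖k - l‖) := by linarith
  have h8 : b * (c * ‖k‖) < c' * (‖n‖ * ‖k‖) :=
    calc b * (c * ‖k‖) < b * (c' * (‖l‖ + ‖k - l‖)) := by gcongr
      _ = c' * (b * (‖l‖ + ‖k - l‖)) := by ring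
      _ ≤ _ := by gcongr
  have h9 : c' * (‖n‖ + 1) * ‖k‖ ≤ c * b * ‖k‖ := by gcongr
  have h10 : 0 ≤ c' * ‖k‖ := by positivity
  nlinarith

theorem IsConvolvable.integrable {f g : Mink → ℂ} (h : IsConvolvable f g) (hf : Continuous f)
    (hg : Continuous g) (k : Mink) : Integrable fun l => f l * g (k - l) := by
  obtain ⟨N, C, hC, h⟩ := h
  refine (integrable_inv_one_add_norm_pow.const_mul (C * (1 + ‖k‖) ^ N)).mono'
    (Continuous.aestronglyMeasurable (by fun_prop)) (Eventually.of_forall fun l => ?_)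
  rw [norm_mul]
  exact h k l

theorem IsConvolvable.isPolyBounded {f g : Mink → ℂ} (h : IsConvolvable f g) :
    IsPolyBounded fun k => ∫ l, f l * g (k - l) := by
  obtain ⟨N, C, hC, h⟩ := h
  refine ⟨N, ∫ l : Mink, C * ((1 + ‖l‖) ^ 5)⁻¹, integral_nonneg fun l => by positivity,
    fun k => ?_⟩
  rw [← integral_mul_const]
  refine norm_integral_le_of_norm_le ((integrable_inv_one_add_norm_pow.const_mul C).mul_const _)
    (Eventually.of_forall fun l => ?_)
  rw [norm_mul]
  exact (h k l).trans_eq (by ring)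

/-- Averaging translates of the first factor. -/
theorem IsConvolvable.integral_average_left {f g : Mink → ℂ} (h : IsConvolvable f g)
    (hf : Continuous f) (hg : Continuous g) (a : 𝓢(Mink, ℂ)) (k : Mink) :
    ∫ l, (∫ q, a q * f (l + q)) * g (k - l) = ∫ q, a q * ∫ l, f l * g (k + q - l) := by
  obtain ⟨N, C, hC, h⟩ := h
  have hint : Integrable (Function.uncurry fun (l q : Mink) => a q * f (l + q) * g (k - l))
      (volume.prod volume) := by
    have h1 := integrable_inv_one_add_norm_pow.mul_prod
      ((integrable_pow_mul_norm a (N + 5)).const_mul (C * (1 + ‖k‖) ^ N))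
    refine h1.mono' (Continuous.aestronglyMeasurable ?_) (Eventually.of_forall fun z => ?_)
    · have := a.continuous
      simp only [Function.uncurry_def]
      fun_prop
    · obtain ⟨l, q⟩ := z
      simp only [Function.uncurry_apply_pair, norm_mul]
      have h2 := h (k + q) (l + q)
      rw [add_sub_add_right_eq_sub] at h2
      have h3 := one_add_norm_add_le_mul k q
      have h4 := one_add_norm_le_mul l q
      rw [mul_assoc]
      calc ‖a q‖ * (‖f (l + q)‖ * ‖g (k - l)‖)
          ≤ ‖a q‖ * (C * (1 + ‖k + q‖) ^ N * ((1 + ‖l + q‖) ^ 5)⁻¹) := by gcongr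
        _ ≤ ‖a q‖ * (C * ((1 + ‖k‖) * (1 + ‖q‖)) ^ N *
            ((1 + ‖q‖) ^ 5 * ((1 + ‖l‖) ^ 5)⁻¹)) := by
            gcongr
            rw [← div_eq_mul_inv, inv_eq_one_div, div_le_div_iff₀ (by positivity) (by positivity),
              one_mul, ← mul_pow]
            gcongr
            linarith
        _ = _ := by rw [mul_pow, pow_add]; ring
  calc ∫ l, (∫ q, a q * f (l + q)) * g (k - l)
      = ∫ l, ∫ q, a q * f (l + q) * g (k - l) := by simp only [integral_mul_const]
    _ = ∫ q, ∫ l, a q * f (l + q) * g (k - l) := integral_integral_swap hint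
    _ = _ := by
      refine integral_congr_ae (Eventually.of_forall fun q => ?_)
      simp only [mul_assoc, integral_const_mul]
      congr 1
      rw [← integral_add_right_eq_self (fun l => f l * g (k + q - l)) q]
      simp only [add_sub_add_right_eq_sub]

/-- Averaging translates of the second factor. -/
theorem IsConvolvable.integral_average_right {f g : Mink → ℂ} (h : IsConvolvable f g)
    (hf : Continuous f) (hg : Continuous g) (a : 𝓢(Mink, ℂ)) (k : Mink) :
    ∫ l, f l * (∫ q, a q * g (k - l + q)) = ∫ q, a q * ∫ l, f l * g (k + q - l) := by
  obtain ⟨N, C, hC, h⟩ := h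
  have hint : Integrable (Function.uncurry fun (l q : Mink) => a q * (f l * g (k + q - l)))
      (volume.prod volume) := by
    have h1 := integrable_inv_one_add_norm_pow.mul_prod
      ((integrable_pow_mul_norm a N).const_mul (C * (1 + ‖k‖) ^ N))
    refine h1.mono' (Continuous.aestronglyMeasurable ?_) (Eventually.of_forall fun z => ?_)
    · have := a.continuous
      simp only [Function.uncurry_def]
      fun_prop
    · obtain ⟨l, q⟩ := z
      simp only [Function.uncurry_apply_pair, norm_mul]
      have h2 := h (k + q) l
      have h3 := one_add_norm_add_le_mul k q
      calc ‖a q‖ * (‖f l‖ * ‖g (k + q - l)‖)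
          ≤ ‖a q‖ * (C * (1 + ‖k + q‖) ^ N * ((1 + ‖l‖) ^ 5)⁻¹) := by gcongr
        _ ≤ ‖a q‖ * (C * ((1 + ‖k‖) * (1 + ‖q‖)) ^ N * ((1 + ‖l‖) ^ 5)⁻¹) := by gcongr
        _ = _ := by rw [mul_pow]; ring
  calc ∫ l, f l * (∫ q, a q * g (k - l + q))
      = ∫ l, ∫ q, a q * (f l * g (k + q - l)) := by
        refine integral_congr_ae (Eventually.of_forall fun l => ?_)
        simp only
        rw [← integral_const_mul]
        refine integral_congr_ae (Eventually.of_forall fun q => ?_)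
        simp only
        rw [show k - l + q = k + q - l by abel]
        ring
    _ = ∫ q, ∫ l, a q * (f l * g (k + q - l)) := integral_integral_swap hint
    _ = _ := by simp only [integral_const_mul]

end Convolution

section LocalProduct

variable {Ω : Opens Mink}

/-- The convolution `(2π)⁻⁴ ∫ û_α(l) v̂_β(k - l) dl`, which is the Fourier transform of `αβuv`. -/
def localConv (u v : 𝓓'(Ω, ℂ)) (α β : 𝓓(Ω, ℂ)) (k : Mink) : ℂ :=
  ((2 * Real.pi : ℝ) ^ 4 : ℂ)⁻¹ * ∫ l : Mink, localFourier u α l * localFourier v β (k - l)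

theorem isPolyBounded_localFourier (u : 𝓓'(Ω, ℂ)) (φ : 𝓓(Ω, ℂ)) :
    IsPolyBounded (localFourier u φ) := exists_norm_localFourier_le u φ

theorem localConv_mul_left {u v : 𝓓'(Ω, ℂ)} {α β α' : 𝓓(Ω, ℂ)}
    (h : IsConvolvable (localFourier u α) (localFourier v β)) (g : 𝓢(Mink, ℂ))
    (hα' : ∀ x, α' x = α x * g x) (k : Mink) :
    localConv u v α' β k = ∫ q, invF g q * localConv u v α β (k + q) := by
  simp only [localConv, (localFourier_mul_eq_integral u α α' g hα' _).2]
  rw [h.integral_average_left (continuous_localFourier u α) (continuous_localFourier v β),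
    ← integral_const_mul]
  refine integral_congr_ae (Eventually.of_forall fun q => ?_)
  simp only
  ring

theorem localConv_mul_right {u v : 𝓓'(Ω, ℂ)} {α β β' : 𝓓(Ω, ℂ)}
    (h : IsConvolvable (localFourier u α) (localFourier v β)) (g : 𝓢(Mink, ℂ))
    (hβ' : ∀ x, β' x = β x * g x) (k : Mink) :
    localConv u v α β' k = ∫ q, invF g q * localConv u v α β (k + q) := by
  simp only [localConv, (localFourier_mul_eq_integral v β β' g hβ' _).2]
  rw [h.integral_average_right (continuous_localFourier u α) (continuous_localFourier v β),
    ← integral_const_mul]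
  refine integral_congr_ae (Eventually.of_forall fun q => ?_)
  simp only
  ring

/-- A test function factor can be moved from one localization to the other. -/
theorem localConv_mul_comm {u v : 𝓓'(Ω, ℂ)} {α β α' β' : 𝓓(Ω, ℂ)}
    (h : IsConvolvable (localFourier u α) (localFourier v β)) (g : 𝓓(Ω, ℂ))
    (hα' : ∀ x, α' x = α x * g x) (hβ' : ∀ x, β' x = β x * g x) (k : Mink) :
    localConv u v α' β k = localConv u v α β' k := by
  rw [localConv_mul_left h (testToSchwartz g) hα', localConv_mul_right h (testToSchwartz g) hβ']

theorem localConv_mul_planeWave (u v : 𝓓'(Ω, ℂ)) (α β : 𝓓(Ω, ℂ)) (k q : Mink) :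
    localConv u v (mulSmooth α (planeWave k) (contDiff_planeWave k)) β q =
      localConv u v α β (k + q) := by
  simp only [localConv, localFourier_mul_planeWave]
  congr 1
  rw [← integral_add_left_eq_self (fun l => localFourier u α l * localFourier v β (k + q - l)) k]
  simp only [add_sub_add_left_eq_sub]

end LocalProduct

/-! ### Products away from the origin -/

section Multiplication

variable {Ω : Opens Mink}

/-- Product of a test function on `Ω` with a function that is smooth on `Ω` only. -/
def mulSmoothOn (φ : 𝓓(Ω, ℂ)) (g : Mink → ℂ) (hg : ∀ x ∈ Ω, ContDiffAt ℝ ∞ g x) : 𝓓(Ω, ℂ) where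
  toFun := fun x => φ x * g x
  contDiff' := by
    refine contDiff_iff_contDiffAt.mpr fun x => ?_
    by_cases hx : x ∈ tsupport φ
    · exact φ.contDiff.contDiffAt.mul (hg x (φ.tsupport_subset hx))
    · refine (contDiffAt_const (c := (0 : ℂ))).congr_of_eventuallyEq ?_
      filter_upwards [(isClosed_tsupport φ).isOpen_compl.mem_nhds hx] with y hy
      rw [image_eq_zero_of_notMem_tsupport hy, zero_mul]
  hasCompactSupport' := φ.hasCompactSupport.mul_right
  tsupport_subset' := (tsupport_mul_subset_left).trans φ.tsupport_subset

theorem tsupport_subset_of_eq_mul {α φ : 𝓓(Ω, ℂ)} {g : Mink → ℂ} (h : ∀ x, α x = φ x * g x) :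
    tsupport α ⊆ tsupport φ := by
  have : (α : Mink → ℂ) = fun x => φ x * g x := funext h
  rw [this]
  exact tsupport_mul_subset_left

theorem eq_mul_of_eq_one {α θ : 𝓓(Ω, ℂ)} (h : ∀ x ∈ tsupport α, θ x = 1) (x : Mink) :
    α x = θ x * α x := by
  by_cases hx : x ∈ tsupport α
  · rw [h x hx, one_mul]
  · rw [image_eq_zero_of_notMem_tsupport hx, mul_zero]

theorem localConv_eq_of_eq_one {u v : 𝓓'(Ω, ℂ)} {α θ θ' : 𝓓(Ω, ℂ)}
    (h : IsConvolvable (localFourier u θ') (localFourier v θ)) (hθ : ∀ x ∈ tsupport α, θ x = 1)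
    (hθ' : ∀ x ∈ tsupport α, θ' x = 1) (k : Mink) :
    localConv u v α θ k = localConv u v θ' α k :=
  localConv_mul_comm h α (eq_mul_of_eq_one hθ') (eq_mul_of_eq_one hθ) k

theorem exists_testFunction_eq_one_on {K O : Set Mink} (hK : IsCompact K) (hO : IsOpen O)
    (hKO : K ⊆ O) (hKΩ : K ⊆ Ω) :
    ∃ χ : 𝓓(Ω, ℂ), tsupport χ ⊆ O ∧ ∀ x ∈ K, χ x = 1 := by
  obtain ⟨χ, h1, h2⟩ := exists_testFunction_eq_one hK (hO.inter Ω.isOpen)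
    (Set.subset_inter hKO hKΩ) (Ω := Ω) Set.inter_subset_right
  exact ⟨χ, h1.trans Set.inter_subset_left, fun x hx => h2.self_of_nhdsSet x hx⟩

end Multiplication

section Cones

/-- Eight open proper cones around the coordinate half-axes; they cover `ℝ⁴ ∖ {0}`. -/
def axisCone (j : Fin 4 × Bool) : Set Mink := {x | 1 / 4 * ‖x‖ < inner ℝ (axis j) x}

theorem isOpen_axisCone (j : Fin 4 × Bool) : IsOpen (axisCone j) :=
  isOpen_lt (by fun_prop) (by fun_prop)

/-- A smooth function on `ℝ⁴ ∖ {0}`, homogeneous of degree `0` and supported in `axisCone j`. -/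
def coneWeight (j : Fin 4 × Bool) (x : Mink) : ℝ :=
  expNegInvGlue (inner ℝ (axis j) x / ‖x‖ - 1 / 3)

theorem contDiffAt_coneWeight (j : Fin 4 × Bool) {x : Mink} (hx : x ≠ 0) :
    ContDiffAt ℝ ∞ (coneWeight j) x := by
  refine expNegInvGlue.contDiff.contDiffAt.comp x (ContDiffAt.sub (ContDiffAt.div ?_ ?_ ?_)
    contDiffAt_const)
  · exact (contDiff_const.inner ℝ contDiff_id).contDiffAt
  · exact contDiffAt_norm ℝ hx
  · exact norm_ne_zero_iff.mpr hx

theorem coneWeight_nonneg (j : Fin 4 × Bool) (x : Mink) : 0 ≤ coneWeight j x :=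
  expNegInvGlue.nonneg _

theorem sum_coneWeight_pos {x : Mink} (hx : x ≠ 0) : 0 < ∑ j, coneWeight j x := by
  obtain ⟨j, hj⟩ := exists_le_inner_axis x
  refine Finset.sum_pos' (fun i _ => coneWeight_nonneg i x) ⟨j, Finset.mem_univ j, ?_⟩
  have h0 : 0 < ‖x‖ := norm_pos_iff.mpr hx
  refine expNegInvGlue.pos_of_pos ?_
  have : 1 / 2 ≤ inner ℝ (axis j) x / ‖x‖ := by rwa [le_div_iff₀ h0]
  linarith

/-- A smooth partition of unity on `ℝ⁴ ∖ {0}` subordinate to the cones `axisCone j`. -/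
def conePartition (j : Fin 4 × Bool) (x : Mink) : ℂ :=
  ((coneWeight j x / ∑ i, coneWeight i x : ℝ) : ℂ)

theorem contDiffAt_conePartition (j : Fin 4 × Bool) :
    ∀ x ∈ punctured, ContDiffAt ℝ ∞ (conePartition j) x := by
  intro x hx
  have hx0 : x ≠ 0 := hx
  refine Complex.ofRealCLM.contDiff.contDiffAt.comp x ?_
  exact (contDiffAt_coneWeight j hx0).div (ContDiffAt.sum fun i _ => contDiffAt_coneWeight i hx0)
    (sum_coneWeight_pos hx0).ne'

theorem sum_conePartition {x : Mink} (hx : x ≠ 0) : ∑ j, conePartition j x = 1 := by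
  simp only [conePartition]
  rw [← Complex.ofReal_sum, ← Finset.sum_div, div_self (sum_coneWeight_pos hx).ne',
    Complex.ofReal_one]

theorem le_inner_of_conePartition_ne_zero {j : Fin 4 × Bool} {x : Mink} (hx : x ≠ 0)
    (h : conePartition j x ≠ 0) : 1 / 3 * ‖x‖ ≤ inner ℝ (axis j) x := by
  have h0 : 0 < ‖x‖ := norm_pos_iff.mpr hx
  by_contra hlt
  rw [not_le] at hlt
  refine h ?_
  have h1 : inner ℝ (axis j) x / ‖x‖ < 1 / 3 := by rwa [div_lt_iff₀ h0]
  rw [conePartition, coneWeight, expNegInvGlue.zero_of_nonpos (by linarith), zero_div,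
    Complex.ofReal_zero]

/-- The part of a test function in the cone around `axis j`. -/
def conePart (φ : 𝓓(punctured, ℂ)) (j : Fin 4 × Bool) : 𝓓(punctured, ℂ) :=
  mulSmoothOn φ (conePartition j) (contDiffAt_conePartition j)

theorem conePart_apply (φ : 𝓓(punctured, ℂ)) (j : Fin 4 × Bool) (x : Mink) :
    conePart φ j x = φ x * conePartition j x := rfl

theorem ne_zero_of_apply_ne_zero {φ : 𝓓(punctured, ℂ)} {x : Mink} (h : φ x ≠ 0) : x ≠ 0 :=
  φ.tsupport_subset (subset_tsupport _ h)

theorem sum_conePart (φ : 𝓓(punctured, ℂ)) (x : Mink) : ∑ j, conePart φ j x = φ x := by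
  simp only [conePart_apply, ← Finset.mul_sum]
  by_cases h : φ x = 0
  · rw [h, zero_mul]
  · rw [sum_conePartition (ne_zero_of_apply_ne_zero h), mul_one]

theorem tsupport_conePart_subset (φ : 𝓓(punctured, ℂ)) (j : Fin 4 × Bool) :
    tsupport (conePart φ j) ⊆ tsupport φ :=
  tsupport_subset_of_eq_mul (conePart_apply φ j)

theorem tsupport_conePart_subset_axisCone (φ : 𝓓(punctured, ℂ)) (j : Fin 4 × Bool) :
    tsupport (conePart φ j) ⊆ axisCone j := by
  have h1 : tsupport (conePart φ j) ⊆ {x | 1 / 3 * ‖x‖ ≤ inner ℝ (axis j) x} := by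
    refine closure_minimal (fun x hx => ?_) (isClosed_le (by fun_prop) (by fun_prop))
    have hx0 := ne_zero_of_apply_ne_zero hx
    rw [Function.mem_support, conePart_apply] at hx
    exact le_inner_of_conePartition_ne_zero hx0 (right_ne_zero_of_mul hx)
  intro x hx
  have hx0 : x ≠ 0 := (conePart φ j).tsupport_subset hx
  have h0 : 0 < ‖x‖ := norm_pos_iff.mpr hx0
  have h2 : 1 / 3 * ‖x‖ ≤ inner ℝ (axis j) x := h1 hx
  change 1 / 4 * ‖x‖ < inner ℝ (axis j) x
  linarith

theorem IsHalfSpaceRegular.isConvolvable {u v : 𝓓'(punctured, ℂ)} (hu : IsHalfSpaceRegular u)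
    (hv : IsHalfSpaceRegular v) {j : Fin 4 × Bool} {α β : 𝓓(punctured, ℂ)}
    (hα : tsupport α ⊆ axisCone j) (hβ : tsupport β ⊆ axisCone j) :
    IsConvolvable (localFourier u α) (localFourier v β) :=
  isConvolvable_of_cone (isPolyBounded_localFourier u α) (isPolyBounded_localFourier v β)
    (n := axis j) (b := 1 / 4 / 4) (by norm_num)
    (hu.rapidlyDecreasingOn_of_cone (by norm_num) fun x hx => hα hx)
    (hv.rapidlyDecreasingOn_of_cone (by norm_num) fun x hx => hβ hx)

end Cones

section Pairing

/-- A continuous polynomially bounded function as a tempered distribution. -/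
theorem exists_clm_integral_mul {H : Mink → ℂ} (hc : Continuous H) (hH : IsPolyBounded H) :
    ∃ T : 𝓢(Mink, ℂ) →L[ℂ] ℂ, ∀ f, T f = ∫ q, f q * H q := by
  obtain ⟨N, C, hC, hb⟩ := hH
  have hint : ∀ f : 𝓢(Mink, ℂ), Integrable fun q => f q * H q := fun f => by
    have := f.continuous
    refine ((integrable_pow_mul_norm f N).const_mul C).mono'
      (Continuous.aestronglyMeasurable (by fun_prop)) (Eventually.of_forall fun q => ?_)
    rw [norm_mul]
    calc ‖f q‖ * ‖H q‖ ≤ ‖f q‖ * (C * (1 + ‖q‖) ^ N) := by gcongr; exact hb q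
      _ = _ := by ring
  refine ⟨SchwartzMap.mkCLMtoNormedSpace (fun f => ∫ q, f q * H q) (fun f g => ?_) (fun z f => ?_)
    ⟨Finset.Iic (N + 5, 0), 2 ^ (N + 5) * C * ∫ q : Mink, ((1 + ‖q‖) ^ 5)⁻¹, by positivity,
      fun f => ?_⟩, fun f => rfl⟩
  · rw [← integral_add (hint f) (hint g)]
    refine integral_congr_ae (Eventually.of_forall fun q => ?_)
    simp only [add_apply]
    ring
  · rw [RingHom.id_apply, smul_eq_mul, ← integral_const_mul]
    refine integral_congr_ae (Eventually.of_forall fun q => ?_)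
    simp only [smul_apply, smul_eq_mul]
    ring
  · set S := ((Finset.Iic (N + 5, 0)).sup (schwartzSeminormFamily ℂ Mink ℂ)) f with hS
    have e : 2 ^ (N + 5) * C * (∫ q : Mink, ((1 + ‖q‖) ^ 5)⁻¹) * S =
        ∫ q : Mink, (2 ^ (N + 5) * C * S) * ((1 + ‖q‖) ^ 5)⁻¹ := by
      rw [integral_const_mul]; ring
    rw [e]
    refine norm_integral_le_of_norm_le (integrable_inv_one_add_norm_pow.const_mul _)
      (Eventually.of_forall fun q => ?_)
    have h1 := SchwartzMap.one_add_le_sup_seminorm_apply (𝕜 := ℂ) (m := (N + 5, 0)) le_rfl le_rfl f q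
    rw [norm_iteratedFDeriv_zero] at h1
    rw [norm_mul, ← div_eq_mul_inv, le_div_iff₀ (by positivity)]
    calc ‖f q‖ * ‖H q‖ * (1 + ‖q‖) ^ 5 ≤ ‖f q‖ * (C * (1 + ‖q‖) ^ N) * (1 + ‖q‖) ^ 5 := by
          gcongr; exact hb q
      _ = C * ((1 + ‖q‖) ^ (N + 5) * ‖f q‖) := by rw [pow_add]; ring
      _ ≤ C * (2 ^ (N + 5) * S) := mul_le_mul_of_nonneg_left h1 hC
      _ = _ := by ring

end Pairing

section Product

theorem continuous_localConv {u v : 𝓓'(punctured, ℂ)} {α β : 𝓓(punctured, ℂ)}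
    (h : IsConvolvable (localFourier u α) (localFourier v β)) :
    Continuous (localConv u v α β) := by
  obtain ⟨N, C, hC, hb⟩ := h
  refine continuous_const.mul (continuous_iff_continuousAt.mpr fun k₀ => ?_)
  have h1 := continuous_localFourier u α
  have h2 := continuous_localFourier v β
  refine continuousAt_of_dominated (bound := fun l => C * (2 + ‖k₀‖) ^ N * ((1 + ‖l‖) ^ 5)⁻¹)
    (Eventually.of_forall fun k => Continuous.aestronglyMeasurable (by fun_prop)) ?_
    (integrable_inv_one_add_norm_pow.const_mul _)
    (Eventually.of_forall fun l => Continuous.continuousAt (by fun_prop))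
  filter_upwards [Metric.ball_mem_nhds k₀ one_pos] with k hk
  refine Eventually.of_forall fun l => ?_
  rw [norm_mul]
  refine (hb k l).trans ?_
  have : ‖k‖ ≤ ‖k₀‖ + 1 := by
    have h3 := norm_le_insert' k k₀
    rw [Metric.mem_ball, dist_eq_norm] at hk
    linarith
  have h4 : (1 + ‖k‖) ^ N ≤ (2 + ‖k₀‖) ^ N := pow_le_pow_left₀ (by positivity) (by linarith) N
  gcongr

theorem isPolyBounded_localConv {u v : 𝓓'(punctured, ℂ)} {α β : 𝓓(punctured, ℂ)}
    (h : IsConvolvable (localFourier u α) (localFourier v β)) :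
    IsPolyBounded (localConv u v α β) := by
  obtain ⟨N, C, hC, hb⟩ := h.isPolyBounded
  refine ⟨N, ‖((2 * Real.pi : ℝ) ^ 4 : ℂ)⁻¹‖ * C, by positivity, fun k => ?_⟩
  rw [localConv, norm_mul, mul_assoc]
  gcongr
  exact hb k

/-- A cutoff in `axisCone j` equal to `1` on the support of the part of `φ` in that cone. -/
theorem exists_coneCutoff (φ : 𝓓(punctured, ℂ)) (j : Fin 4 × Bool) :
    ∃ θ : 𝓓(punctured, ℂ), tsupport θ ⊆ axisCone j ∧ ∀ x ∈ tsupport (conePart φ j), θ x = 1 :=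
  exists_testFunction_eq_one_on (conePart φ j).hasCompactSupport (isOpen_axisCone j)
    (tsupport_conePart_subset_axisCone φ j) (conePart φ j).tsupport_subset

/-- A choice of the cutoff of `exists_coneCutoff`. -/
def coneCutoff (φ : 𝓓(punctured, ℂ)) (j : Fin 4 × Bool) : 𝓓(punctured, ℂ) :=
  (exists_coneCutoff φ j).choose

theorem coneCutoff_spec (φ : 𝓓(punctured, ℂ)) (j : Fin 4 × Bool) :
    tsupport (coneCutoff φ j) ⊆ axisCone j ∧
      ∀ x ∈ tsupport (conePart φ j), coneCutoff φ j x = 1 :=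
  (exists_coneCutoff φ j).choose_spec

/-- The value of the product `uv` on a test function. In each of the cones the product is defined
by the convolution of Fourier transforms. -/
def prodEval (u v : 𝓓'(punctured, ℂ)) (φ : 𝓓(punctured, ℂ)) : ℂ :=
  ∑ j, localConv u v (conePart φ j) (coneCutoff φ j) 0

variable {u v : 𝓓'(punctured, ℂ)}

/-- The product does not depend on the cutoffs. -/
theorem localConv_cutoff_eq (hu : IsHalfSpaceRegular u) (hv : IsHalfSpaceRegular v)
    {j : Fin 4 × Bool} {α θ θ' : 𝓓(punctured, ℂ)} (hθ : tsupport θ ⊆ axisCone j)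
    (hθ' : tsupport θ' ⊆ axisCone j) (h1 : ∀ x ∈ tsupport α, θ x = 1)
    (h2 : ∀ x ∈ tsupport α, θ' x = 1) (k : Mink) :
    localConv u v α θ k = localConv u v α θ' k := by
  rw [localConv_eq_of_eq_one (hu.isConvolvable hv hθ' hθ) h1 h2,
    localConv_eq_of_eq_one (hu.isConvolvable hv hθ' hθ') h2 h2]

/-- On the test functions with support in a given compact set, the product is the restriction of a
tempered distribution. -/
theorem exists_clm_eq_prodEval (hu : IsHalfSpaceRegular u) (hv : IsHalfSpaceRegular v)
    {K : Set Mink} (hK : IsCompact K) (hK0 : K ⊆ punctured) :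
    ∃ T : 𝓢(Mink, ℂ) →L[ℂ] ℂ, ∀ φ : 𝓓(punctured, ℂ), tsupport φ ⊆ K →
      prodEval u v φ = T (testToSchwartz φ) := by
  obtain ⟨κ, -, hκ⟩ := exists_testFunction_eq_one_on (Ω := punctured) hK punctured.isOpen hK0 hK0
  have hconv := fun j => hu.isConvolvable hv (coneCutoff_spec κ j).1 (coneCutoff_spec κ j).1
  choose T hT using fun j => exists_clm_integral_mul (continuous_localConv (hconv j))
    (isPolyBounded_localConv (hconv j))
  refine ⟨∑ j, (T j).comp ((invF : 𝓢(Mink, ℂ) →L[ℂ] 𝓢(Mink, ℂ)).comp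
    (SchwartzMap.smulLeftCLM ℂ (conePart κ j))), fun φ hφ => ?_⟩
  rw [prodEval, sum_apply]
  refine Finset.sum_congr rfl fun j _ => ?_
  have e1 : ∀ x, conePart φ j x = conePart κ j x * φ x := by
    intro x
    rw [conePart_apply, conePart_apply]
    by_cases hx : x ∈ tsupport φ
    · rw [hκ x (hφ hx)]; ring
    · rw [image_eq_zero_of_notMem_tsupport hx]; ring
  have hsub := tsupport_subset_of_eq_mul e1
  rw [localConv_cutoff_eq hu hv (coneCutoff_spec φ j).1 (coneCutoff_spec κ j).1
    (coneCutoff_spec φ j).2 (fun x hx => (coneCutoff_spec κ j).2 x (hsub hx))]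
  obtain ⟨B, hB⟩ := exists_norm_iteratedFDeriv_le (conePart κ j)
  rw [localConv_mul_left (hconv j)
    (SchwartzMap.smulLeftCLM ℂ (conePart κ j) (testToSchwartz φ)) (fun x => ?_)]
  · simp only [zero_add]
    exact (hT j _).symm
  · rw [SchwartzMap.smulLeftCLM_apply_apply hB.hasTemperateGrowth, smul_eq_mul]
    change _ = _ * (conePart κ j x * φ x)
    rw [← e1]
    exact eq_mul_of_eq_one (fun x hx => (coneCutoff_spec κ j).2 x (hsub hx)) x

/-- The product as a continuous functional on complex test functions. -/
def prodCLM (hu : IsHalfSpaceRegular u) (hv : IsHalfSpaceRegular v) : 𝓓(punctured, ℂ) →L[ℝ] ℂ :=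
  TestFunction.mkCLM ℝ (prodEval u v)
    (fun φ ψ => by
      obtain ⟨T, hT⟩ := exists_clm_eq_prodEval hu hv
        (φ.hasCompactSupport.isCompact.union ψ.hasCompactSupport.isCompact)
        (Set.union_subset φ.tsupport_subset ψ.tsupport_subset)
      rw [hT _ Set.subset_union_left, hT _ Set.subset_union_right, hT _ (tsupport_add _ _),
        ← map_add]
      rfl)
    (fun a φ => by
      obtain ⟨T, hT⟩ := exists_clm_eq_prodEval hu hv φ.hasCompactSupport φ.tsupport_subset
      have hs : tsupport (a • φ : 𝓓(punctured, ℂ)) ⊆ tsupport φ := by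
        refine closure_mono fun x hx => ?_
        rw [Function.mem_support] at hx ⊢
        contrapose! hx
        change a • φ x = 0
        rw [hx, smul_zero]
      rw [hT _ subset_rfl, hT _ hs]
      have : testToSchwartz (a • φ) = (a : ℂ) • testToSchwartz φ := by
        ext x
        change a • φ x = (a : ℂ) • φ x
        simp
      rw [this, map_smul]
      simp)
    (by
      intro K hK
      obtain ⟨T, hT⟩ := exists_clm_eq_prodEval hu hv K.isCompact hK
      have e : prodEval u v ∘ TestFunction.ofSupportedIn hK = fun f =>
          T (testToSchwartzCLM punctured (TestFunction.ofSupportedInCLM ℝ hK f)) := by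
        funext f
        exact hT _ f.tsupport_subset
      rw [e]
      fun_prop)

/-- The product of two distributions whose wavefront sets over each `x ≠ 0` lie in the ray through
`x`. -/
def prodDistribution (hu : IsHalfSpaceRegular u) (hv : IsHalfSpaceRegular v) :
    𝓓'(punctured, ℂ) where
  toFun φ := prodCLM hu hv (TestFunction.postcompCLM Complex.ofRealCLM φ)
  map_add' φ ψ := by simp
  map_smul' a φ := by simp
  cont := (prodCLM hu hv).cont.comp (TestFunction.postcompCLM Complex.ofRealCLM).cont

theorem evalC_prodDistribution (hu : IsHalfSpaceRegular u) (hv : IsHalfSpaceRegular v)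
    (φ : 𝓓(punctured, ℂ)) : evalC (prodDistribution hu hv) φ = prodEval u v φ := by
  obtain ⟨T, hT⟩ := exists_clm_eq_prodEval hu hv φ.hasCompactSupport φ.tsupport_subset
  change prodEval u v _ + Complex.I * prodEval u v _ = _
  rw [hT φ subset_rfl, hT, hT, ← smul_eq_mul, ← map_smul, ← map_add]
  · congr 1
    ext x
    change ((φ x).re : ℂ) + Complex.I * ((φ x).im : ℂ) = φ x
    rw [mul_comm, Complex.re_add_im]
  all_goals
    refine closure_mono fun x hx => ?_
    rw [Function.mem_support] at hx ⊢
    contrapose! hx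
  · change ((φ x).im : ℂ) = 0
    rw [hx, Complex.zero_im, Complex.ofReal_zero]
  · change ((φ x).re : ℂ) = 0
    rw [hx, Complex.zero_re, Complex.ofReal_zero]

/-- The Fourier transform of the product, computed with arbitrary cutoffs. -/
theorem localFourier_prodDistribution (hu : IsHalfSpaceRegular u) (hv : IsHalfSpaceRegular v)
    (ψ : 𝓓(punctured, ℂ)) {θ : Fin 4 × Bool → 𝓓(punctured, ℂ)}
    (hθ : ∀ j, tsupport (θ j) ⊆ axisCone j)
    (hθ1 : ∀ j, ∀ x ∈ tsupport (conePart ψ j), θ j x = 1) (k : Mink) :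
    localFourier (prodDistribution hu hv) ψ k =
      ∑ j, localConv u v (conePart ψ j) (θ j) k := by
  rw [localFourier, evalC_prodDistribution, prodEval]
  refine Finset.sum_congr rfl fun j _ => ?_
  set ψk := mulSmooth ψ (planeWave k) (contDiff_planeWave k)
  have e1 : conePart ψk j = mulSmooth (conePart ψ j) (planeWave k) (contDiff_planeWave k) := by
    refine TestFunction.ext fun x => ?_
    rw [mulSmooth_apply, conePart_apply, conePart_apply, mulSmooth_apply]
    ring
  have hsub : tsupport (conePart ψk j) ⊆ tsupport (conePart ψ j) := by
    rw [e1]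
    exact tsupport_subset_of_eq_mul (mulSmooth_apply _ _ _)
  rw [localConv_cutoff_eq hu hv (coneCutoff_spec ψk j).1 (hθ j) (coneCutoff_spec ψk j).2
    (fun x hx => hθ1 j x (hsub hx)), e1, localConv_mul_planeWave, add_zero]

/-- The parts in the cones add up, for a fixed localization of the first factor. -/
theorem localConv_sum_conePart (φ ψ : 𝓓(punctured, ℂ)) (k : Mink)
    (h : ∀ j, Integrable fun l => localFourier u φ l * localFourier v (conePart ψ j) (k - l)) :
    ∑ j, localConv u v φ (conePart ψ j) k = localConv u v φ ψ k := by
  have e : ∀ l, localFourier v ψ l = ∑ j, localFourier v (conePart ψ j) l := by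
    intro l
    simp only [localFourier, ← evalCLM_apply]
    rw [← map_sum]
    congr 1
    refine TestFunction.ext fun x => ?_
    have h1 : (∑ j, mulSmooth (conePart ψ j) (planeWave l) (contDiff_planeWave l)) x =
        ∑ j, mulSmooth (conePart ψ j) (planeWave l) (contDiff_planeWave l) x := by
      simp
    rw [h1]
    simp only [mulSmooth_apply]
    rw [← Finset.sum_mul, sum_conePart]
  simp only [localConv]
  rw [← Finset.mul_sum, ← integral_finsetSum _ fun j _ => h j]
  simp only [e, Finset.mul_sum]

/-- The product exists in the sense of Hörmander. -/
theorem isHormanderProduct_prodDistribution (hu : IsHalfSpaceRegular u)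
    (hv : IsHalfSpaceRegular v) : IsHormanderProduct u v (prodDistribution hu hv) where
  criterion := hu.notMem_WF hv
  local_product := by
    intro x hx
    have hx0 : x ≠ 0 := hx
    obtain ⟨i, hi⟩ := exists_le_inner_axis x
    refine ⟨axisCone i, isOpen_axisCone i, ?_, fun φ hφ k => ⟨?_, ?_⟩⟩
    · have h0 : 0 < ‖x‖ := norm_pos_iff.mpr hx0
      change 1 / 4 * ‖x‖ < inner ℝ (axis i) x
      linarith
    · exact (hu.isConvolvable hv hφ hφ).integrable (continuous_localFourier u φ)
        (continuous_localFourier v φ) k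
    set ψ := mulSmooth φ φ φ.contDiff
    have hconv : ∀ j, IsConvolvable (localFourier u φ) (localFourier v (conePart φ j)) := fun j =>
      hu.isConvolvable hv hφ ((tsupport_conePart_subset φ j).trans hφ)
    rw [localFourier_prodDistribution hu hv ψ (fun j => (coneCutoff_spec ψ j).1)
      (fun j => (coneCutoff_spec ψ j).2)]
    change _ = localConv u v φ φ k
    rw [← localConv_sum_conePart φ φ k fun j => (hconv j).integrable (continuous_localFourier u φ)
      (continuous_localFourier v _) k]
    refine Finset.sum_congr rfl fun j _ => ?_
    -- a cutoff in the intersection of both cones, where all the products involved are convolvable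
    obtain ⟨η, hη, hη1⟩ := exists_testFunction_eq_one_on (Ω := punctured)
      (conePart φ j).hasCompactSupport ((isOpen_axisCone j).inter (isOpen_axisCone i))
      (Set.subset_inter (tsupport_conePart_subset_axisCone φ j)
        ((tsupport_conePart_subset φ j).trans hφ)) (conePart φ j).tsupport_subset
    have e1 : ∀ x, conePart ψ j x = conePart φ j x * φ x := fun x => by
      rw [conePart_apply, conePart_apply, mulSmooth_apply]; ring
    have hsub := tsupport_subset_of_eq_mul e1
    have hφi := (tsupport_conePart_subset φ j).trans hφ
    rw [localConv_eq_of_eq_one (hu.isConvolvable hv (hη.trans Set.inter_subset_left)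
      (coneCutoff_spec ψ j).1) (coneCutoff_spec ψ j).2 (fun x hx => hη1 x (hsub hx)),
      ← localConv_mul_comm (α' := mulSmooth φ η η.contDiff) (hu.isConvolvable hv
        (hη.trans Set.inter_subset_right) hφi) φ (fun x => by rw [mulSmooth_apply, mul_comm]) e1]
    exact localConv_mul_comm (hconv j) η (mulSmooth_apply φ η η.contDiff)
      (fun x => by rw [mul_comm]; exact eq_mul_of_eq_one hη1 x) k

theorem RapidlyDecreasingOn.const_mul {g : Mink → ℂ} {V : Set Mink} (h : RapidlyDecreasingOn g V)
    (z : ℂ) : RapidlyDecreasingOn (fun k => z * g k) V := by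
  intro N
  obtain ⟨C, hC⟩ := h N
  refine ⟨‖z‖ * C, fun k hk => ?_⟩
  rw [norm_mul, mul_left_comm]
  gcongr
  exact hC k hk

theorem RapidlyDecreasingOn.sum {ι : Type*} [Fintype ι] {g : ι → Mink → ℂ} {V : Set Mink}
    (h : ∀ i, RapidlyDecreasingOn (g i) V) : RapidlyDecreasingOn (fun k => ∑ i, g i k) V := by
  intro N
  choose C hC using fun i => h i N
  refine ⟨∑ i, C i, fun k hk => ?_⟩
  calc (1 + ‖k‖) ^ N * ‖∑ i, g i k‖ ≤ (1 + ‖k‖) ^ N * ∑ i, ‖g i k‖ := by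
        gcongr
        exact norm_sum_le _ _
    _ = ∑ i, (1 + ‖k‖) ^ N * ‖g i k‖ := Finset.mul_sum _ _ _
    _ ≤ _ := Finset.sum_le_sum fun i _ => hC i k hk

/-- The product inherits the bound on the wavefront set, because the rays over each point are
convex cones. -/
theorem isHalfSpaceRegular_prodDistribution (hu : IsHalfSpaceRegular u)
    (hv : IsHalfSpaceRegular v) : IsHalfSpaceRegular (prodDistribution hu hv) := by
  intro m ψ hψ c hc
  have hθ : ∀ j, ∃ θ : 𝓓(punctured, ℂ), tsupport θ ⊆ axisCone j ∩ {x | inner ℝ m x < 0} ∧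
      ∀ x ∈ tsupport (conePart ψ j), θ x = 1 := fun j =>
    exists_testFunction_eq_one_on (conePart ψ j).hasCompactSupport
      ((isOpen_axisCone j).inter (isOpen_lt (by fun_prop) continuous_const))
      (Set.subset_inter (tsupport_conePart_subset_axisCone ψ j)
        fun x hx => hψ x (tsupport_conePart_subset ψ j hx)) (conePart ψ j).tsupport_subset
  choose θ hθ hθ1 using hθ
  have e : localFourier (prodDistribution hu hv) ψ =
      fun k => ∑ j, localConv u v (conePart ψ j) (θ j) k := funext fun k =>
    localFourier_prodDistribution hu hv ψ (fun j => (hθ j).trans Set.inter_subset_left) hθ1 k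
  rw [e]
  refine RapidlyDecreasingOn.sum fun j => RapidlyDecreasingOn.const_mul ?_ _
  obtain ⟨c', A, hc', hA, hsplit⟩ := exists_cone_split (n := axis j) (m := m) (b := 1 / 4 / 4)
    (by norm_num) hc
  refine rapidlyDecreasingOn_convolution (isPolyBounded_localFourier u _)
    (isPolyBounded_localFourier v _)
    (Z := {k | inner ℝ (axis j) k ≤ 1 / 4 / 4 * ‖k‖} ∪ {k | c' * ‖k‖ ≤ inner ℝ m k}) ?_ ?_ hA hsplit
  · exact (hu.rapidlyDecreasingOn_of_cone (by norm_num)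
      fun x hx => tsupport_conePart_subset_axisCone ψ j hx).union
      (hu m _ (fun x hx => hψ x (tsupport_conePart_subset ψ j hx)) c' hc')
  · exact (hv.rapidlyDecreasingOn_of_cone (by norm_num) fun x hx => (hθ j hx).1).union
      (hv m _ (fun x hx => (hθ j hx).2) c' hc')

end Product

/-! ### Uniqueness of products -/

section Uniqueness

variable {Ω : Opens Mink}

theorem evalC_ofReal (w : 𝓓'(Ω, ℂ)) (φ : 𝓓(Ω, ℝ)) :
    evalC w (TestFunction.postcompCLM Complex.ofRealCLM φ) = w φ := by
  have h1 : TestFunction.postcompCLM Complex.reCLM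
      (TestFunction.postcompCLM Complex.ofRealCLM φ) = φ :=
    TestFunction.ext fun x => by simp
  have h2 : TestFunction.postcompCLM Complex.imCLM
      (TestFunction.postcompCLM Complex.ofRealCLM φ) = 0 :=
    TestFunction.ext fun x => by simp
  rw [evalC, h1, h2, map_zero, mul_zero, add_zero]

/-- Distributions that agree locally are equal. -/
theorem eq_of_forall_exists_evalC_eq {w w' : 𝓓'(Ω, ℂ)}
    (h : ∀ x ∈ Ω, ∃ U : Set Mink, IsOpen U ∧ x ∈ U ∧
      ∀ ψ : 𝓓(Ω, ℂ), tsupport ψ ⊆ U → evalC w ψ = evalC w' ψ) : w = w' := by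
  have key : ∀ K : Set Mink, IsCompact K → K ⊆ Ω → ∃ O : Set Mink, IsOpen O ∧ K ⊆ O ∧
      ∀ ψ : 𝓓(Ω, ℂ), tsupport ψ ⊆ O → evalC w ψ = evalC w' ψ := by
    intro K hK hKΩ
    refine hK.induction_on (p := fun K => ∃ O : Set Mink, IsOpen O ∧ K ⊆ O ∧
      ∀ ψ : 𝓓(Ω, ℂ), tsupport ψ ⊆ O → evalC w ψ = evalC w' ψ) ?_ ?_ ?_ ?_
    · refine ⟨∅, isOpen_empty, subset_rfl, fun ψ hψ => ?_⟩
      have h0 : ψ = 0 := TestFunction.ext fun x =>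
        image_eq_zero_of_notMem_tsupport fun hx => hψ hx
      rw [h0, ← evalCLM_apply, ← evalCLM_apply, map_zero, map_zero]
    · rintro s t hst ⟨O, hO, htO, hψ⟩
      exact ⟨O, hO, hst.trans htO, hψ⟩
    · rintro s t ⟨O, hO, hsO, h1⟩ ⟨O', hO', htO', h2⟩
      refine ⟨O ∪ O', hO.union hO', Set.union_subset_union hsO htO', fun ψ hψ => ?_⟩
      obtain ⟨χ, hχ, hχ1⟩ := exists_testFunction_eq_one (Ω := Ω) (K := tsupport ψ \ O')
        (O := O ∩ Ω) (ψ.hasCompactSupport.isCompact.diff hO') (hO.inter Ω.isOpen)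
        (fun x hx => ⟨(hψ hx.1).resolve_right hx.2, ψ.tsupport_subset hx.1⟩) Set.inter_subset_right
      set ψ₁ := mulSmooth ψ χ χ.contDiff
      set ψ₂ := mulSmooth ψ (fun x => 1 - χ x) (contDiff_const.sub χ.contDiff)
      have e : ψ = ψ₁ + ψ₂ := TestFunction.ext fun x => by
        change ψ x = ψ x * χ x + ψ x * (1 - χ x)
        ring
      have s1 : tsupport ψ₁ ⊆ O :=
        (tsupport_mul_subset_right (f := ψ) (g := χ)).trans (hχ.trans Set.inter_subset_left)
      have s2 : tsupport ψ₂ ⊆ O' := by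
        intro x hx
        by_contra hxO'
        have hxψ : x ∈ tsupport ψ := tsupport_subset_of_eq_mul (mulSmooth_apply _ _ _) hx
        have h3 : ∀ᶠ y in 𝓝 x, χ y = 1 := (eventually_nhdsSet_iff_forall.mp hχ1) x ⟨hxψ, hxO'⟩
        refine notMem_tsupport_iff_eventuallyEq.mpr ?_ hx
        filter_upwards [h3] with y hy
        change ψ y * (1 - χ y) = 0
        rw [hy, sub_self, mul_zero]
      rw [e, evalC_add, evalC_add, h1 ψ₁ s1, h2 ψ₂ s2]
    · intro x hx
      obtain ⟨U, hU, hxU, hψ⟩ := h x (hKΩ hx)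
      exact ⟨U, mem_nhdsWithin_of_mem_nhds (hU.mem_nhds hxU), U, hU, subset_rfl, hψ⟩
  refine DFunLike.ext _ _ fun φ => ?_
  rw [← evalC_ofReal w, ← evalC_ofReal w']
  obtain ⟨O, -, hKO, hO⟩ := key _
    (TestFunction.postcompCLM Complex.ofRealCLM φ).hasCompactSupport.isCompact
    (TestFunction.postcompCLM Complex.ofRealCLM φ).tsupport_subset
  exact hO _ hKO

/-- The Hörmander product is unique: near each point the Fourier transform of `φ²w` is prescribed,
and this determines `w` on the test functions supported where `φ = 1`. -/
theorem IsHormanderProduct.unique {u v w w' : 𝓓'(Ω, ℂ)} (h : IsHormanderProduct u v w)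
    (h' : IsHormanderProduct u v w') : w = w' := by
  refine eq_of_forall_exists_evalC_eq fun x hx => ?_
  obtain ⟨U, hU, hxU, hw⟩ := h.local_product x hx
  obtain ⟨U', hU', hxU', hw'⟩ := h'.local_product x hx
  obtain ⟨φ, hφ, hφ1⟩ := exists_testFunction_eq_one (Ω := Ω) (K := {x}) (O := U ∩ U' ∩ Ω)
    isCompact_singleton ((hU.inter hU').inter Ω.isOpen)
    (by rw [Set.singleton_subset_iff]; exact ⟨⟨hxU, hxU'⟩, hx⟩) Set.inter_subset_right
  rw [nhdsSet_singleton, eventually_nhds_iff] at hφ1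
  obtain ⟨O, hO1, hO, hxO⟩ := hφ1
  refine ⟨O, hO, hxO, fun ψ hψ => ?_⟩
  have e : ∀ x, ψ x = mulSmooth φ φ φ.contDiff x * testToSchwartz ψ x := by
    intro x
    rw [mulSmooth_apply]
    change ψ x = φ x * φ x * ψ x
    by_cases hxψ : x ∈ tsupport ψ
    · rw [hO1 x (hψ hxψ), one_mul, one_mul]
    · rw [image_eq_zero_of_notMem_tsupport hxψ, mul_zero]
  rw [(integral_invF_mul_localFourier w _ ψ _ e).2, (integral_invF_mul_localFourier w' _ ψ _ e).2]
  refine integral_congr_ae (Eventually.of_forall fun q => ?_)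
  simp only
  rw [(hw φ (hφ.trans (Set.inter_subset_left.trans Set.inter_subset_left)) q).2,
    (hw' φ (hφ.trans (Set.inter_subset_left.trans Set.inter_subset_right)) q).2]

theorem IsIteratedProduct.unique {L : List 𝓓'(Ω, ℂ)} {w w' : 𝓓'(Ω, ℂ)}
    (h : IsIteratedProduct L w) (h' : IsIteratedProduct L w') : w = w' := by
  induction h generalizing w' with
  | single u =>
    cases h' with
    | single => rfl
    | cons _ _ _ _ h1 _ => cases h1
  | cons u L v w h1 h2 ih =>
    cases h' with
    | single => cases h1
    | cons _ _ v' _ h3 h4 =>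
      obtain rfl := ih h3
      exact h2.unique h4

theorem exists_isIteratedProduct {L : List 𝓓'(punctured, ℂ)} (hL : L ≠ [])
    (h : ∀ u ∈ L, IsHalfSpaceRegular u) : ∃ w, IsIteratedProduct L w ∧ IsHalfSpaceRegular w := by
  induction L with
  | nil => exact absurd rfl hL
  | cons u L ih =>
    have hu := h u List.mem_cons_self
    rcases eq_or_ne L [] with rfl | hL'
    · exact ⟨u, .single u, hu⟩
    · obtain ⟨v, hv, hv'⟩ := ih hL' fun u' hu' => h u' (List.mem_cons_of_mem u hu')
      exact ⟨_, .cons u L v _ hv (isHormanderProduct_prodDistribution hu hv'),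
        isHalfSpaceRegular_prodDistribution hu hv'⟩

end Uniqueness

end StringLocalized

end

theorem mainTheorem2 :
    -- the smeared string-localized and the point-localized propagators of all masses exist
    (∀ (m : ℝ) (s : ℕ) (β : ℕ → ℂ) (f f' : StringLocalized.Mink)
        (c : 𝓓(StringLocalized.spacelike, ℂ)), 0 ≤ m →
      ∃! u : 𝓢'(StringLocalized.Mink, ℂ),
        StringLocalized.IsStringPropagator m s β f f' c u) ∧
    (∀ (m : ℝ) (M N : MvPolynomial (Fin 4) ℂ), 0 ≤ m →
      ∃! u : 𝓢'(StringLocalized.Mink, ℂ), StringLocalized.IsPointPropagator m M N u) ∧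
    -- massive case: bound by the wavefront set of the scalar Feynman propagator of the same mass
    (∀ (m : ℝ) (s : ℕ) (β : ℕ → ℂ) (f f' : StringLocalized.Mink)
        (c : 𝓓(StringLocalized.spacelike, ℂ)) (u v : 𝓢'(StringLocalized.Mink, ℂ)), 0 < m →
      StringLocalized.IsStringPropagator m s β f f' c u →
      StringLocalized.IsFeynmanPropagator m v →
      StringLocalized.WF (StringLocalized.restrict ⊤ u) ⊆
        StringLocalized.WF (StringLocalized.restrict ⊤ v)) ∧
    -- all finite products of such propagators are well-defined away from the origin
    (∀ L : List 𝓢'(StringLocalized.Mink, ℂ), L ≠ [] →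
      (∀ u ∈ L, StringLocalized.IsPropagator u) →
      ∃! w : 𝓓'(StringLocalized.punctured, ℂ),
        StringLocalized.IsIteratedProduct
          (L.map (StringLocalized.restrict StringLocalized.punctured)) w) := by
  open StringLocalized in
  refine ⟨fun m s β f f' c _ => ?_, fun m M N _ => ?_, fun m s β f f' c u v _ hu hv => ?_,
    fun L hL h => ?_⟩
  · obtain ⟨u, hu, -⟩ := exists_isStringPropagator m s β f f' c
    exact ⟨u, hu, fun v hv => IsFourierLimit.unique hv hu⟩
  · obtain ⟨u, hu, -⟩ := exists_isPointPropagator m M N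
    exact ⟨u, hu, fun v hv => IsFourierLimit.unique hv hu⟩
  · obtain ⟨u', hu', d, b, hb, hub⟩ := exists_isStringPropagator m s β f f' c
    obtain rfl := IsFourierLimit.unique hu hu'
    exact hub.WF_restrict_subset hb hv
  · obtain ⟨w, hw, -⟩ := exists_isIteratedProduct (L := L.map (restrict punctured))
      (by simpa using hL) (by
        intro u' hu'
        obtain ⟨u, hu, rfl⟩ := List.mem_map.mp hu'
        obtain ⟨m, d, b, hb, hub⟩ := (h u hu).exists_hasSymbol
        exact hub.isHalfSpaceRegular hb)
    exact ⟨w, hw, fun w' hw' => hw'.unique hw⟩
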